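/- Let $\Bbbk$ be a field of characteristic $0$ and write $\otimes=\otimes_\Bbbk$. **Quivers.** Let $Q$ be a quiver with finite vertex set $I$ and finite arrow set; an arrow $a$ goes from its tail $t(a)$ to its head $h(a)$. Its double $\bar Q$ is obtained by adding an arrow $a^*:h(a)\to t(a)$ for each $a\in Q$, and one sets $(a^*)^*=a$, so that $*$ is an involution on $\bar Q$. The path algebra $\Bbbk\bar Q$ has generators $e_s$ ($s\in I$) and $a\in\bar Q$, with relations $e_se_{s'}=\delta_{ss'}e_s$, $\sum_s e_s=1$, $a=e_{t(a)}ae_{h(a)}$. Let $A_Q$ be the universal localisation of $\Bbbk\bar Q$ at the set $\{1+aa^*\mid a\in\bar Q\}$; it is an algebra over $B=\bigoplus_{s\in I}\Bbbk e_s$. **Quasi-Hamiltonian algebras.** A $B$-linear double bracket on a $B$-algebra $A$ is a $\Bbbk$-bilinear map $\{\!\{-,-\}\!\}:A\times A\to A\otimes A$, vanishing if one entry is in $B$, such that $\{\!\{a,b\}\!\}=-\{\!\{b,a\}\!\}^\circ$, where $\circ$ swaps the two tensor factors, and $\{\!\{a,bc\}\!\}=\{\!\{a,b\}\!\}(1\otimes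 c)+(b\otimes 1)\{\!\{a,c\}\!\}$. With $\tau(x\otimes y\otimes z)=z\otimes x\otimes y$ and $d=d'\otimes d''$ (Sweedler notation), its triple bracket is $$\{\!\{a,b,c\}\!\}=\{\!\{a,\{\!\{b,c\}\!\}'\}\!\}\otimes\{\!\{b,c\}\!\}''+\tau\big(\{\!\{b,\{\!\{c,a\}\!\}'\}\!\}\otimes\{\!\{c,a\}\!\}''\big)+\tau^2\big(\{\!\{c,\{\!\{a,b\}\!\}'\}\!\}\otimes\{\!\{a,b\}\!\}''\big).$$ The double bracket is quasi-Poisson if for all $a,b,c\in A$ $$\begin{aligned}\{\!\{a,b,c\}\!\}=\tfrac14\sum_{s\in I}\big(&ce_sa\otimes e_sb\otimes e_s-ce_sa\otimes e_s\otimes be_s-ce_s\otimes ae_sb\otimes e_s+ce_s\otimes ae_s\otimes be_s\\&-e_sa\otimes e_sb\otimes e_sc+e_sa\otimes e_s\otimes be_sc+e_s\otimes ae_sb\otimes e_sc-e_s\otimes ae_s\otimes be_sc\big).\end{aligned}$$ A multiplicative moment map is an invertible element $\Phi=\sum_s\Phi_s$ with $\Phi_s\in e_sAe_s$ and $\{\!\{\Phi_s,a\}\!\}=\frac12(ae_s\otimes\Phi_s-e_s\otimes\Phi_sa+a\Phi_s\otimes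 e_s-\Phi_s\otimes e_sa)$ for all $s\in I$, $a\in A$. A quasi-Hamiltonian algebra over $B$ is a triple $(A,\{\!\{-,-\}\!\},\Phi)$ of a $B$-algebra, a $B$-linear double quasi-Poisson bracket and a multiplicative moment map. An isomorphism of quasi-Hamiltonian algebras over $B$ is an isomorphism of $B$-algebras $\psi$ with $\{\!\{\psi(a),\psi(b)\}\!\}=(\psi\otimes\psi)\{\!\{a,b\}\!\}$ for all $a,b$, which maps the multiplicative moment map to the multiplicative moment map. **Van den Bergh's structure.** For each $s\in I$ choose a total ordering $<_s$ on $T_s=\{a\in\bar Q\mid t(a)=s\}$. Put $o_s(a,b)=1$ if $a,b\in T_s$ and $a<_sb$, $o_s(a,b)=-1$ if $a,b\in T_s$ and $b<_sa$, and $o_s(a,b)=0$ otherwise. Consider the $B$-linear double bracket on $A_Q$ with $$\{\!\{a,a\}\!\}=\tfrac12o_{t(a)}(a,a^*)\big(a^2\otimes e_{t(a)}-e_{h(a)}\otimes a^2\big)\qquad(a\in\bar Q),$$ $$\{\!\{a,a^*\}\!\}=e_{h(a)}\otimes e_{t(a)}+\tfrac12a^*a\otimes e_{t(a)}+\tfrac12e_{h(a)}\otimes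 aa^*+\tfrac12o_{t(a)}(a,a^*)(a^*\otimes a-a\otimes a^*)\qquad(a\in Q),$$ $$\{\!\{b,c\}\!\}=-\tfrac12o_{t(b)}(b,c)\,b\otimes c-\tfrac12o_{h(b)}(b^*,c^*)\,c\otimes b+\tfrac12o_{t(b)}(b,c^*)\,cb\otimes e_{t(b)}+\tfrac12o_{h(b)}(b^*,c)\,e_{h(b)}\otimes bc$$ for $b,c\in\bar Q$ with $c\neq b,b^*$, and the element $\Phi=\sum_{s\in I}\Phi_s$, where $$\Phi_s=\prod^{\longrightarrow}_{a\in T_s}(e_s+aa^*)^{\epsilon(a)}$$ is the product in $e_sA_Qe_s$ in increasing order for $<_s$, with $\epsilon(a)=1$ if $a\in Q$ and $\epsilon(a)=-1$ if $a\in\bar Q\setminus Q$. **Theorem.** For every finite quiver $Q$ and every choice of orderings there is exactly one $B$-linear double bracket on $A_Q$ with these values, and $(A_Q,\{\!\{-,-\}\!\},\Phi)$ is a quasi-Hamiltonian algebra over $B$. Up to isomorphism of quasi-Hamiltonian algebras over $B$ it depends only on $Q$ seen as an undirected graph: if $Q_1$ and $Q_2$ are finite quivers with the same vertex set $I$, and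 if there is a bijection between their arrows that preserves the unordered pair of end points of every arrow, then for all choices of orderings for $Q_1$ and for $Q_2$ the quasi-Hamiltonian algebras $(A_{Q_1},\{\!\{-,-\}\!\}_1,\Phi_1)$ and $(A_{Q_2},\{\!\{-,-\}\!\}_2,\Phi_2)$ are isomorphic over $B$. -/

import Mathlib

open scoped TensorProduct

namespace VdB

noncomputable section

universe u v w z

/-! ### Quivers, their doubles, and the underlying undirected graph -/

/-- A quiver with vertex set `I` and arrow set `E`; the arrow `a` goes from its tail `t a`
to its head `h a`. -/
structure FinQuiver (I : Type u) (E : Type v) where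
  t : E → I
  h : E → I

namespace FinQuiver

variable {I : Type u} {E : Type v}

/-- The double quiver: `Sum.inl a` is the arrow `a`, and `Sum.inr a` is the opposite
arrow `a^* : h a ⟶ t a`. -/
def double (Q : FinQuiver I E) : FinQuiver I (E ⊕ E) where
  t := Sum.elim Q.t Q.h
  h := Sum.elim Q.h Q.t

/-- The unordered pair of end points of an arrow. -/
def ends (Q : FinQuiver I E) (a : E) : Sym2 I := s(Q.t a, Q.h a)

/-- Two quivers on the same vertex set have the same underlying undirected (multi)graph:
there is a bijection between their arrows which preserves unordered end points. -/
def SameGraph {E' : Type w} (Q : FinQuiver I E) (Q' : FinQuiver I E') : Prop :=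
  ∃ τ : E ≃ E', ∀ a : E, Q'.ends (τ a) = Q.ends a

/-- The set `T_s` of arrows of the double quiver with tail `s`. -/
abbrev T (Q : FinQuiver I E) (s : I) : Type v := {a : E ⊕ E // Q.double.t a = s}

/-- A choice of a total ordering `<_s` on `T_s` for each vertex `s`. -/
abbrev Ordering (Q : FinQuiver I E) : Type (max u v) := ∀ s : I, LinearOrder (Q.T s)

/-- The ordering function `o_s(a, b)`: it is `1` if `a <_s b`, `-1` if `b <_s a`, and `0`
otherwise (that is, if `a = b`, or if `a` or `b` does not have tail `s`). -/
def ordFun [DecidableEq I] (Q : FinQuiver I E) (o : Q.Ordering) (s : I) (a b : E ⊕ E) : ℤ :=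
  if hab : Q.double.t a = s ∧ Q.double.t b = s then
    letI := o s
    if (⟨a, hab.1⟩ : Q.T s) < ⟨b, hab.2⟩ then 1
    else if (⟨b, hab.2⟩ : Q.T s) < ⟨a, hab.1⟩ then -1
    else 0
  else 0

/-- The elements of `T_s`, listed increasingly for `<_s`. -/
def sortedT [DecidableEq I] [Fintype E] (Q : FinQuiver I E) (o : Q.Ordering) (s : I) :
    List (Q.T s) :=
  letI := o s
  (Finset.univ : Finset (Q.T s)).sort (· ≤ ·)

end FinQuiver

/-! ### Path algebras -/

section PathAlgebra

variable (k : Type z) [Field k] {I : Type u} {E : Type v} [Fintype I] [DecidableEq I]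

/-- Relations of the path algebra on the generators `e_s` (`s` a vertex) and `a` (an arrow).
Paths are read from left to right. -/
inductive PathRel (Q : FinQuiver I E) : FreeAlgebra k (I ⊕ E) → FreeAlgebra k (I ⊕ E) → Prop
  | idem (s : I) : PathRel Q
      (FreeAlgebra.ι k (Sum.inl s) * FreeAlgebra.ι k (Sum.inl s)) (FreeAlgebra.ι k (Sum.inl s))
  | orth (s s' : I) (hs : s ≠ s') : PathRel Q
      (FreeAlgebra.ι k (Sum.inl s) * FreeAlgebra.ι k (Sum.inl s')) 0
  | one : PathRel Q (∑ s : I, FreeAlgebra.ι k (Sum.inl s)) 1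
  | arrow (a : E) : PathRel Q
      (FreeAlgebra.ι k (Sum.inl (Q.t a)) * FreeAlgebra.ι k (Sum.inr a) *
        FreeAlgebra.ι k (Sum.inl (Q.h a)))
      (FreeAlgebra.ι k (Sum.inr a))

/-- The path algebra of a quiver with finitely many vertices. -/
def PathAlgebra (Q : FinQuiver I E) : Type _ := RingQuot (PathRel k Q)

instance (Q : FinQuiver I E) : Ring (PathAlgebra k Q) :=
  inferInstanceAs (Ring (RingQuot (PathRel k Q)))

instance (Q : FinQuiver I E) : Algebra k (PathAlgebra k Q) :=
  inferInstanceAs (Algebra k (RingQuot (PathRel k Q)))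

/-- The idempotent attached to the vertex `s`. -/
def PathAlgebra.idem (Q : FinQuiver I E) (s : I) : PathAlgebra k Q :=
  RingQuot.mkAlgHom k (PathRel k Q) (FreeAlgebra.ι k (Sum.inl s))

/-- The arrow `a`, as an element of the path algebra. -/
def PathAlgebra.arrow (Q : FinQuiver I E) (a : E) : PathAlgebra k Q :=
  RingQuot.mkAlgHom k (PathRel k Q) (FreeAlgebra.ι k (Sum.inr a))

end PathAlgebra

/-! ### Universal localisation -/

section UnivLoc

variable (k : Type z) [Field k] {R : Type u} [Ring R] [Algebra k R] {ι : Type v}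

/-- Relations which say that the generators indexed by `R` form a homomorphic image of the
`k`-algebra `R`, and that the generator indexed by `i : ι` is a two-sided inverse of the image
of `f i`. -/
inductive UnivLocRel (f : ι → R) : FreeAlgebra k (R ⊕ ι) → FreeAlgebra k (R ⊕ ι) → Prop
  | add (x y : R) : UnivLocRel f (FreeAlgebra.ι k (Sum.inl (x + y)))
      (FreeAlgebra.ι k (Sum.inl x) + FreeAlgebra.ι k (Sum.inl y))
  | mul (x y : R) : UnivLocRel f (FreeAlgebra.ι k (Sum.inl (x * y)))
      (FreeAlgebra.ι k (Sum.inl x) * FreeAlgebra.ι k (Sum.inl y))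
  | scalar (c : k) : UnivLocRel f (FreeAlgebra.ι k (Sum.inl (algebraMap k R c)))
      (algebraMap k _ c)
  | mul_inv (i : ι) : UnivLocRel f
      (FreeAlgebra.ι k (Sum.inl (f i)) * FreeAlgebra.ι k (Sum.inr i)) 1
  | inv_mul (i : ι) : UnivLocRel f
      (FreeAlgebra.ι k (Sum.inr i) * FreeAlgebra.ι k (Sum.inl (f i))) 1

/-- The universal localisation of the `k`-algebra `R` at the family `f` of its elements. -/
def UnivLoc (f : ι → R) : Type _ := RingQuot (UnivLocRel k f)

instance (f : ι → R) : Ring (UnivLoc k f) :=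
  inferInstanceAs (Ring (RingQuot (UnivLocRel k f)))

instance (f : ι → R) : Algebra k (UnivLoc k f) :=
  inferInstanceAs (Algebra k (RingQuot (UnivLocRel k f)))

/-- The canonical map from `R` to its localisation. -/
def UnivLoc.of (f : ι → R) (x : R) : UnivLoc k f :=
  RingQuot.mkAlgHom k (UnivLocRel k f) (FreeAlgebra.ι k (Sum.inl x))

/-- The inverse of `f i` in the localisation. -/
def UnivLoc.inv (f : ι → R) (i : ι) : UnivLoc k f :=
  RingQuot.mkAlgHom k (UnivLocRel k f) (FreeAlgebra.ι k (Sum.inr i))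

end UnivLoc

/-! ### Double brackets and quasi-Hamiltonian algebras

Here `A` is a `k`-algebra, `e` is a finite family of elements of `A` (orthogonal idempotents with
sum `1` in the applications), and `B` is the span of the `e s`. -/

section DoubleBracket

variable {k : Type z} [Field k] {A : Type u} [Ring A] [Algebra k A] {I : Type v}

/-- A double bracket: a `k`-bilinear map `A × A → A ⊗ A` with cyclic antisymmetry and the right
derivation rule for the outer bimodule structure `x d y = x d' ⊗ d'' y`, which is written
through the product of the algebra `A ⊗ A`. -/
structure IsDoubleBracket (br : A →ₗ[k] A →ₗ[k] A ⊗[k] A) : Prop where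
  antisymm : ∀ a b : A, br a b = - TensorProduct.comm k A A (br b a)
  deriv : ∀ a b c : A,
    br a (b * c) = br a b * ((1 : A) ⊗ₜ[k] c) + (b ⊗ₜ[k] (1 : A)) * br a c

/-- `B`-linearity: the bracket vanishes if one of its entries is in the span of the `e s`. -/
def IsBLinear (e : I → A) (br : A →ₗ[k] A →ₗ[k] A ⊗[k] A) : Prop :=
  ∀ (s : I) (a : A), br (e s) a = 0 ∧ br a (e s) = 0

/-- The cyclic permutation `a₁ ⊗ a₂ ⊗ a₃ ↦ a₃ ⊗ a₁ ⊗ a₂`. -/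
def tau : A ⊗[k] A ⊗[k] A →ₗ[k] A ⊗[k] A ⊗[k] A :=
  (TensorProduct.assoc k A A A).symm.toLinearMap ∘ₗ
    (TensorProduct.comm k (A ⊗[k] A) A).toLinearMap

/-- The triple bracket associated with a double bracket. The linear map
`(br a).rTensor A` sends `x ⊗ y` to `{{a, x}} ⊗ y`. -/
def tripleBracket (br : A →ₗ[k] A →ₗ[k] A ⊗[k] A) (a b c : A) : A ⊗[k] A ⊗[k] A :=
  (br a).rTensor A (br b c) + tau ((br b).rTensor A (br c a)) +
    tau (tau ((br c).rTensor A (br a b)))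

/-- A (`B`-linear) double quasi-Poisson bracket. -/
structure IsDoubleQuasiPoisson [Fintype I] (e : I → A)
    (br : A →ₗ[k] A →ₗ[k] A ⊗[k] A) : Prop where
  isDoubleBracket : IsDoubleBracket br
  isBLinear : IsBLinear e br
  triple : ∀ a b c : A, tripleBracket br a b c = (1 / 4 : k) • ∑ s : I,
    ((c * e s * a) ⊗ₜ[k] (e s * b) ⊗ₜ[k] (e s)
      - (c * e s * a) ⊗ₜ[k] (e s) ⊗ₜ[k] (b * e s)
      - (c * e s) ⊗ₜ[k] (a * e s * b) ⊗ₜ[k] (e s)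
      + (c * e s) ⊗ₜ[k] (a * e s) ⊗ₜ[k] (b * e s)
      - (e s * a) ⊗ₜ[k] (e s * b) ⊗ₜ[k] (e s * c)
      + (e s * a) ⊗ₜ[k] (e s) ⊗ₜ[k] (b * e s * c)
      + (e s) ⊗ₜ[k] (a * e s * b) ⊗ₜ[k] (e s * c)
      - (e s) ⊗ₜ[k] (a * e s) ⊗ₜ[k] (b * e s * c))

/-- The element `∑ s, Φ s` is a multiplicative moment map with components `Φ s ∈ e_s A e_s`. -/
structure IsMultMomentMap [Fintype I] (e : I → A)
    (br : A →ₗ[k] A →ₗ[k] A ⊗[k] A) (Φ : I → A) : Prop where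
  mem : ∀ s : I, e s * Φ s * e s = Φ s
  isUnit : IsUnit (∑ s : I, Φ s)
  mult : ∀ (s : I) (a : A), br (Φ s) a = (1 / 2 : k) •
    ((a * e s) ⊗ₜ[k] Φ s - e s ⊗ₜ[k] (Φ s * a) + (a * Φ s) ⊗ₜ[k] e s - Φ s ⊗ₜ[k] (e s * a))

/-- The triple `(A, br, ∑ s, Φ s)` is a quasi-Hamiltonian algebra over `B`. -/
structure IsQuasiHamiltonian [Fintype I] (e : I → A)
    (br : A →ₗ[k] A →ₗ[k] A ⊗[k] A) (Φ : I → A) : Prop where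
  quasiPoisson : IsDoubleQuasiPoisson e br
  moment : IsMultMomentMap e br Φ

end DoubleBracket

/-- Isomorphisms between two quasi-Hamiltonian algebras over `B`: isomorphisms of `B`-algebras
which preserve the double brackets and the multiplicative moment maps. -/
structure IsQHIso {k : Type z} [Field k] {I : Type v} [Fintype I]
    {A : Type u} [Ring A] [Algebra k A] {A' : Type w} [Ring A'] [Algebra k A']
    (e : I → A) (br : A →ₗ[k] A →ₗ[k] A ⊗[k] A) (Φ : I → A)
    (e' : I → A') (br' : A' →ₗ[k] A' →ₗ[k] A' ⊗[k] A') (Φ' : I → A')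
    (ψ : A ≃ₐ[k] A') : Prop where
  map_idem : ∀ s : I, ψ (e s) = e' s
  map_bracket : ∀ a b : A,
    br' (ψ a) (ψ b) = TensorProduct.map ψ.toLinearMap ψ.toLinearMap (br a b)
  map_moment : ψ (∑ s : I, Φ s) = ∑ s : I, Φ' s

/-! ### Van den Bergh's structure on the localised path algebra of a double quiver -/

section Quivers

variable (k : Type z) [Field k] {I : Type u} {E : Type v} [Fintype I] [DecidableEq I]

/-- The elements `1 + a a^*` of the path algebra of the double quiver. -/
def locFamily (Q : FinQuiver I E) (a : E ⊕ E) : PathAlgebra k Q.double :=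
  1 + PathAlgebra.arrow k Q.double a * PathAlgebra.arrow k Q.double a.swap

/-- The algebra `A_Q`: the universal localisation of the path algebra of the double quiver at the
elements `1 + a a^*`, for all arrows `a` of the double quiver. -/
abbrev AQ (Q : FinQuiver I E) : Type _ := UnivLoc k (locFamily k Q)

/-- The idempotent `e_s` in `A_Q`. -/
def idem (Q : FinQuiver I E) (s : I) : AQ k Q :=
  UnivLoc.of k (locFamily k Q) (PathAlgebra.idem k Q.double s)

/-- The arrow `a` of the double quiver in `A_Q`; the arrow `a^*` is `arr k Q a.swap`. -/
def arr (Q : FinQuiver I E) (a : E ⊕ E) : AQ k Q :=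
  UnivLoc.of k (locFamily k Q) (PathAlgebra.arrow k Q.double a)

/-- The factor `(e_s + a a^*)^{ε(a)}` of `Φ_s`, where `ε(a) = 1` for an arrow of `Q` and
`ε(a) = -1` for an arrow `a^*`. The inverse is the one in the algebra `e_s A_Q e_s`, which is
`e_s (1 + a a^*)⁻¹ e_s`. -/
def momentFactor (Q : FinQuiver I E) (s : I) : E ⊕ E → AQ k Q
  | Sum.inl a => idem k Q s + arr k Q (Sum.inl a) * arr k Q (Sum.inr a)
  | Sum.inr a => idem k Q s * UnivLoc.inv k (locFamily k Q) (Sum.inr a) * idem k Q s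

/-- `Φ_s`, the increasing product over `T_s` of the factors `(e_s + a a^*)^{ε(a)}`, taken in the
algebra `e_s A_Q e_s` with unit `e_s`. -/
def momentMap [Fintype E] (Q : FinQuiver I E) (o : Q.Ordering) (s : I) : AQ k Q :=
  idem k Q s * ((Q.sortedT o s).map fun a => momentFactor k Q s a.1).prod

/-- `br` is Van den Bergh's bracket: the `B`-linear double bracket on `A_Q` with the given values
on the arrows of the double quiver. -/
structure IsVdBBracket (Q : FinQuiver I E) (o : Q.Ordering)
    (br : AQ k Q →ₗ[k] AQ k Q →ₗ[k] AQ k Q ⊗[k] AQ k Q) : Prop where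
  isDoubleBracket : IsDoubleBracket br
  isBLinear : IsBLinear (idem k Q) br
  self : ∀ a : E ⊕ E, br (arr k Q a) (arr k Q a) =
    ((1 / 2 : k) * (Q.ordFun o (Q.double.t a) a a.swap : k)) •
      ((arr k Q a * arr k Q a) ⊗ₜ[k] idem k Q (Q.double.t a)
        - idem k Q (Q.double.h a) ⊗ₜ[k] (arr k Q a * arr k Q a))
  star : ∀ a : E, br (arr k Q (Sum.inl a)) (arr k Q (Sum.inr a)) =
    idem k Q (Q.h a) ⊗ₜ[k] idem k Q (Q.t a)
      + (1 / 2 : k) •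
        ((arr k Q (Sum.inr a) * arr k Q (Sum.inl a)) ⊗ₜ[k] idem k Q (Q.t a))
      + (1 / 2 : k) •
        (idem k Q (Q.h a) ⊗ₜ[k] (arr k Q (Sum.inl a) * arr k Q (Sum.inr a)))
      + ((1 / 2 : k) * (Q.ordFun o (Q.t a) (Sum.inl a) (Sum.inr a) : k)) •
        (arr k Q (Sum.inr a) ⊗ₜ[k] arr k Q (Sum.inl a)
          - arr k Q (Sum.inl a) ⊗ₜ[k] arr k Q (Sum.inr a))
  other : ∀ b c : E ⊕ E, c ≠ b → c ≠ b.swap → br (arr k Q b) (arr k Q c) =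
    - (((1 / 2 : k) * (Q.ordFun o (Q.double.t b) b c : k)) • (arr k Q b ⊗ₜ[k] arr k Q c))
      - ((1 / 2 : k) * (Q.ordFun o (Q.double.h b) b.swap c.swap : k)) •
        (arr k Q c ⊗ₜ[k] arr k Q b)
      + ((1 / 2 : k) * (Q.ordFun o (Q.double.t b) b c.swap : k)) •
        ((arr k Q c * arr k Q b) ⊗ₜ[k] idem k Q (Q.double.t b))
      + ((1 / 2 : k) * (Q.ordFun o (Q.double.h b) b.swap c : k)) •
        (idem k Q (Q.double.h b) ⊗ₜ[k] (arr k Q b * arr k Q c))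

end Quivers

end

end VdB

/-!
A derivation of `A_Q` is determined by its values on the idempotents and the arrows, and arrow
values compatible with the idempotents extend to the localisation; applied in both arguments, this
gives existence and uniqueness of the bracket. Both sides of the quasi-Poisson identity are
triderivations, so it is enough to compare them on arrows. There the bracket splits into a part
which depends only on the antisymmetric form `o(a, b)`, and a part which pairs `a` with `a^*`; the
identity `o(p, q) o(q, r) + o(q, r) o(r, p) + o(r, p) o(p, q) = -1` for a total ordering makes the
triple bracket come out right. The moment map property telescopes along the product, since each
factor `1 + a a^*` changes only the position at which the form cuts the list of arrows.

For the isomorphisms, the map `a ↦ -(1 + a a^*)⁻¹ a`, `a^* ↦ a^*` reverses an arrow `a` and keeps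
the orderings. If `b` comes directly before `a ≠ b^*` in the ordering, the map `b ↦ u b`,
`b^* ↦ b^* u⁻¹`, with `u` the factor of `a` in the moment map, exchanges the two; if `a = b^*`, the
exchange is a relabelling up to orientation. These exchanges generate all changes of the orderings.
-/

open Algebra.TensorProduct (includeLeft includeRight)

namespace VdB

noncomputable section

namespace FinQuiver

variable {I E : Type*} (Q : FinQuiver I E)

theorem double_h (p : E ⊕ E) : Q.double.h p = Q.double.t p.swap := by
  cases p <;> rfl

end FinQuiver

/-! ### Universal properties of path algebras and universal localisations -/

section UniversalProperties

variable {k : Type*} [Field k]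

namespace PathAlgebra

variable {I E : Type*} [Fintype I] {Q : FinQuiver I E}

variable (k Q) in
/-- The quotient map from the free algebra on the vertices and arrows. -/
def mk : FreeAlgebra k (I ⊕ E) →ₐ[k] PathAlgebra k Q := RingQuot.mkAlgHom k (PathRel k Q)

theorem mk_rel {x y : FreeAlgebra k (I ⊕ E)} (h : PathRel k Q x y) : mk k Q x = mk k Q y :=
  RingQuot.mkAlgHom_rel k h

theorem mk_ι_inl (s : I) : mk k Q (FreeAlgebra.ι k (Sum.inl s)) = idem k Q s := rfl

theorem mk_ι_inr (a : E) : mk k Q (FreeAlgebra.ι k (Sum.inr a)) = arrow k Q a := rfl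

variable (k Q) in
theorem completeOrthogonalIdempotents_idem : CompleteOrthogonalIdempotents (idem k Q) where
  idem s := show idem k Q s * idem k Q s = idem k Q s by
    simpa only [map_mul, mk_ι_inl] using mk_rel (PathRel.idem (k := k) (Q := Q) s)
  ortho s s' hs := by
    simpa only [map_mul, map_zero, mk_ι_inl] using
      mk_rel (PathRel.orth (k := k) (Q := Q) s s' hs)
  complete := by
    simpa only [map_sum, map_one, mk_ι_inl] using mk_rel (PathRel.one (k := k) (Q := Q))

theorem idem_mul_arrow_mul_idem (a : E) :
    idem k Q (Q.t a) * arrow k Q a * idem k Q (Q.h a) = arrow k Q a := by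
  simpa only [map_mul, mk_ι_inl, mk_ι_inr] using mk_rel (PathRel.arrow (k := k) (Q := Q) a)

theorem induction {P : PathAlgebra k Q → Prop} (algebraMap : ∀ c : k, P (algebraMap k _ c))
    (idem : ∀ s, P (idem k Q s)) (arrow : ∀ a, P (arrow k Q a))
    (add : ∀ x y, P x → P y → P (x + y)) (mul : ∀ x y, P x → P y → P (x * y))
    (x : PathAlgebra k Q) : P x := by
  obtain ⟨x, rfl⟩ := RingQuot.mkAlgHom_surjective k (PathRel k Q) x
  induction x using FreeAlgebra.induction with
  | grade0 c => exact (mk k Q).commutes c ▸ algebraMap c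
  | grade1 g => exact g.rec idem arrow
  | mul x y hx hy => exact map_mul (mk k Q) x y ▸ mul _ _ hx hy
  | add x y hx hy => exact map_add (mk k Q) x y ▸ add _ _ hx hy

theorem exists_lift {C : Type*} [Ring C] [Algebra k C] {e : I → C} {x : E → C}
    (he : CompleteOrthogonalIdempotents e) (hx : ∀ a, e (Q.t a) * x a * e (Q.h a) = x a) :
    ∃ g : PathAlgebra k Q →ₐ[k] C, (∀ s, g (idem k Q s) = e s) ∧ ∀ a, g (arrow k Q a) = x a := by
  have hrel : ∀ ⦃y z⦄, PathRel k Q y z →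
      FreeAlgebra.lift k (Sum.elim e x) y = FreeAlgebra.lift k (Sum.elim e x) z := by
    rintro _ _ (s | ⟨s, s', hs⟩ | _ | a)
    · simpa using (he.idem s).eq
    · simpa using he.ortho hs
    · simpa using he.complete
    · simpa using hx a
  refine ⟨RingQuot.liftAlgHom k ⟨_, hrel⟩, fun s => ?_, fun a => ?_⟩ <;>
    exact (RingQuot.liftAlgHom_mkAlgHom_apply k _ hrel _).trans (by simp)

end PathAlgebra

namespace UnivLoc

variable {R ι : Type*} [Ring R] [Algebra k R] {f : ι → R}

variable (k f) in
/-- The quotient map from the free algebra on `R` and the formal inverses. -/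
def mk : FreeAlgebra k (R ⊕ ι) →ₐ[k] UnivLoc k f := RingQuot.mkAlgHom k (UnivLocRel k f)

theorem mk_rel {x y : FreeAlgebra k (R ⊕ ι)} (h : UnivLocRel k f x y) : mk k f x = mk k f y :=
  RingQuot.mkAlgHom_rel k h

theorem mk_ι_inl (x : R) : mk k f (FreeAlgebra.ι k (Sum.inl x)) = of k f x := rfl

theorem mk_ι_inr (i : ι) : mk k f (FreeAlgebra.ι k (Sum.inr i)) = inv k f i := rfl

theorem of_algebraMap (c : k) : of k f (algebraMap k R c) = algebraMap k (UnivLoc k f) c :=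
  (mk_rel (UnivLocRel.scalar (f := f) c)).trans ((mk k f).commutes c)

variable (k f) in
/-- The canonical map from `R` to its localisation, as an algebra homomorphism. -/
def ofHom : R →ₐ[k] UnivLoc k f where
  toFun := of k f
  map_one' := by simpa only [map_one] using of_algebraMap (f := f) (1 : k)
  map_mul' x y := by
    simpa only [map_mul, mk_ι_inl] using mk_rel (UnivLocRel.mul (k := k) (f := f) x y)
  map_zero' := by simpa only [map_zero] using of_algebraMap (f := f) (0 : k)
  map_add' x y := by
    simpa only [map_add, mk_ι_inl] using mk_rel (UnivLocRel.add (k := k) (f := f) x y)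
  commutes' := of_algebraMap

variable (k f) in
/-- The element `f i`, as a unit of the localisation. -/
def unit (i : ι) : (UnivLoc k f)ˣ where
  val := of k f (f i)
  inv := inv k f i
  val_inv := by
    simpa only [map_mul, map_one, mk_ι_inl, mk_ι_inr] using
      mk_rel (UnivLocRel.mul_inv (k := k) (f := f) i)
  inv_val := by
    simpa only [map_mul, map_one, mk_ι_inl, mk_ι_inr] using
      mk_rel (UnivLocRel.inv_mul (k := k) (f := f) i)

theorem induction {P : UnivLoc k f → Prop} (ofHom : ∀ x, P (ofHom k f x))
    (inv : ∀ i, P ↑(unit k f i)⁻¹) (add : ∀ x y, P x → P y → P (x + y))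
    (mul : ∀ x y, P x → P y → P (x * y)) (x : UnivLoc k f) : P x := by
  obtain ⟨x, rfl⟩ := RingQuot.mkAlgHom_surjective k (UnivLocRel k f) x
  induction x using FreeAlgebra.induction with
  | grade0 c => exact (of_algebraMap c).trans ((mk k f).commutes c).symm ▸ ofHom (algebraMap k R c)
  | grade1 g => exact g.rec ofHom inv
  | mul x y hx hy => exact map_mul (mk k f) x y ▸ mul _ _ hx hy
  | add x y hx hy => exact map_add (mk k f) x y ▸ add _ _ hx hy

theorem exists_lift {C : Type*} [Ring C] [Algebra k C] {g : R →ₐ[k] C}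
    (hg : ∀ i, IsUnit (g (f i))) :
    ∃ φ : UnivLoc k f →ₐ[k] C, ∀ x, φ (ofHom k f x) = g x := by
  choose u hu using hg
  have hrel : ∀ ⦃y z⦄, UnivLocRel k f y z →
      FreeAlgebra.lift k (Sum.elim g fun i => ((u i)⁻¹ : Cˣ)) y =
        FreeAlgebra.lift k (Sum.elim g fun i => ((u i)⁻¹ : Cˣ)) z := by
    rintro _ _ (⟨x, y⟩ | ⟨x, y⟩ | c | i | i) <;> simp [← hu]
  exact ⟨RingQuot.liftAlgHom k ⟨_, hrel⟩, fun x =>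
    (RingQuot.liftAlgHom_mkAlgHom_apply k _ hrel _).trans (by simp)⟩

end UnivLoc

end UniversalProperties

/-! ### The algebra `A_Q` -/

section LocalisedPathAlgebra

variable {k : Type*} [Field k] {I E : Type*} [Fintype I] {Q : FinQuiver I E}

variable (k Q) in
theorem completeOrthogonalIdempotents_idem : CompleteOrthogonalIdempotents (idem k Q) :=
  (PathAlgebra.completeOrthogonalIdempotents_idem k Q.double).map
    (UnivLoc.ofHom k (locFamily k Q)).toRingHom

theorem idem_mul_self (s : I) : idem k Q s * idem k Q s = idem k Q s :=
  (completeOrthogonalIdempotents_idem k Q).idem s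

theorem idem_mul_of_ne {s s' : I} (hs : s ≠ s') : idem k Q s * idem k Q s' = 0 :=
  (completeOrthogonalIdempotents_idem k Q).ortho hs

theorem idem_mul_arr_mul_idem (p : E ⊕ E) :
    idem k Q (Q.double.t p) * arr k Q p * idem k Q (Q.double.t p.swap) = arr k Q p := by
  have := congrArg (UnivLoc.ofHom k (locFamily k Q))
    (PathAlgebra.idem_mul_arrow_mul_idem (k := k) (Q := Q.double) p)
  rwa [map_mul, map_mul, Q.double_h] at this

theorem idem_mul_arr (p : E ⊕ E) : idem k Q (Q.double.t p) * arr k Q p = arr k Q p := by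
  rw [← idem_mul_arr_mul_idem, ← mul_assoc, ← mul_assoc, idem_mul_self]

theorem arr_mul_idem (p : E ⊕ E) : arr k Q p * idem k Q (Q.double.t p.swap) = arr k Q p := by
  rw [← idem_mul_arr_mul_idem, mul_assoc, idem_mul_self]

theorem arr_swap_mul_idem (p : E ⊕ E) :
    arr k Q p.swap * idem k Q (Q.double.t p) = arr k Q p.swap := by
  simpa only [Sum.swap_swap] using arr_mul_idem (k := k) (Q := Q) p.swap

theorem idem_mul_arr_of_ne {s : I} {p : E ⊕ E} (h : s ≠ Q.double.t p) :
    idem k Q s * arr k Q p = 0 := by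
  rw [← idem_mul_arr, ← mul_assoc, idem_mul_of_ne h, zero_mul]

theorem arr_mul_idem_of_ne {s : I} {p : E ⊕ E} (h : s ≠ Q.double.t p.swap) :
    arr k Q p * idem k Q s = 0 := by
  rw [← arr_mul_idem, mul_assoc, idem_mul_of_ne h.symm, mul_zero]

variable (k Q) in
/-- The invertible element `1 + p p^*` of `A_Q`. -/
def zUnit (p : E ⊕ E) : (AQ k Q)ˣ := UnivLoc.unit k (locFamily k Q) p

theorem coe_zUnit (p : E ⊕ E) : (zUnit k Q p : AQ k Q) = 1 + arr k Q p * arr k Q p.swap := by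
  change UnivLoc.ofHom k (locFamily k Q) (1 + _) = _
  rw [map_add, map_one, map_mul]
  rfl

theorem AQ.induction {P : AQ k Q → Prop} (algebraMap : ∀ c : k, P (algebraMap k _ c))
    (idem : ∀ s, P (idem k Q s)) (arr : ∀ p, P (arr k Q p))
    (add : ∀ a b, P a → P b → P (a + b)) (mul : ∀ a b, P a → P b → P (a * b))
    (inv : ∀ u : (AQ k Q)ˣ, P u → P ↑u⁻¹) (a : AQ k Q) : P a := by
  induction a using UnivLoc.induction with
  | ofHom x =>
    induction x using PathAlgebra.induction with
    | algebraMap c => exact (UnivLoc.ofHom k (locFamily k Q)).commutes c ▸ algebraMap c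
    | idem s => exact idem s
    | arrow p => exact arr p
    | add x y hx hy => exact map_add (UnivLoc.ofHom k (locFamily k Q)) x y ▸ add _ _ hx hy
    | mul x y hx hy => exact map_mul (UnivLoc.ofHom k (locFamily k Q)) x y ▸ mul _ _ hx hy
  | inv p =>
    refine inv (zUnit k Q p) ?_
    rw [coe_zUnit]
    exact add _ _ (by simpa only [map_one] using algebraMap 1) (mul _ _ (arr p) (arr p.swap))
  | add x y hx hy => exact add x y hx hy
  | mul x y hx hy => exact mul x y hx hy

theorem AQ.exists_lift {C : Type*} [Ring C] [Algebra k C] {e : I → C} {x : E ⊕ E → C}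
    (he : CompleteOrthogonalIdempotents e)
    (hx : ∀ p, e (Q.double.t p) * x p * e (Q.double.t p.swap) = x p)
    (hunit : ∀ p, IsUnit (1 + x p * x p.swap)) :
    ∃ φ : AQ k Q →ₐ[k] C, (∀ s, φ (idem k Q s) = e s) ∧ ∀ p, φ (arr k Q p) = x p := by
  obtain ⟨g, hge, hgx⟩ := PathAlgebra.exists_lift (k := k) (Q := Q.double) he
    fun p => by rw [Q.double_h, hx]
  obtain ⟨φ, hφ⟩ := UnivLoc.exists_lift (f := locFamily k Q) (g := g) fun p => by
    rw [locFamily, map_add, map_one, map_mul, hgx, hgx]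
    exact hunit p
  exact ⟨φ, fun s => (hφ _).trans (hge s), fun p => (hφ _).trans (hgx p)⟩

theorem AQ.algHom_ext {C : Type*} [Ring C] [Algebra k C] {φ ψ : AQ k Q →ₐ[k] C}
    (idem : ∀ s, φ (idem k Q s) = ψ (VdB.idem k Q s))
    (arr : ∀ p, φ (arr k Q p) = ψ (VdB.arr k Q p)) : φ = ψ := by
  ext a
  induction a using AQ.induction with
  | algebraMap c => rw [AlgHom.commutes, AlgHom.commutes]
  | idem s => exact idem s
  | arr p => exact arr p
  | add a b ha hb => rw [map_add, map_add, ha, hb]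
  | mul a b ha hb => rw [map_mul, map_mul, ha, hb]
  | inv u hu =>
    have : Units.map (φ : AQ k Q →* C) u = Units.map (ψ : AQ k Q →* C) u := Units.ext hu
    exact congrArg (fun v : Cˣ => (↑v⁻¹ : C)) this

end LocalisedPathAlgebra

/-! ### Derivations, and double brackets on `A_Q` -/

section Derivations

variable {k : Type*} [Field k]

/-- `d` is a derivation from `A` to the algebra `M`, for the bimodule structure on `M` with left
action through `l` and right action through `r`. -/
def IsDer {A : Type*} [Ring A] [Algebra k A] {M : Type*} [Ring M] [Algebra k M]
    (l r : A →ₐ[k] M) (d : A →ₗ[k] M) : Prop :=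
  ∀ a b, d (a * b) = d a * r b + l a * d b

namespace IsDer

section General

variable {A : Type*} [Ring A] [Algebra k A] {M : Type*} [Ring M] [Algebra k M]
variable {l r : A →ₐ[k] M} {d d' : A →ₗ[k] M}

theorem map_one (h : IsDer l r d) : d 1 = 0 := by
  simpa using h 1 1

theorem map_algebraMap (h : IsDer l r d) (c : k) : d (algebraMap k A c) = 0 := by
  rw [Algebra.algebraMap_eq_smul_one, map_smul, h.map_one, smul_zero]

theorem map_inv (h : IsDer l r d) (u : Aˣ) :
    d ↑u⁻¹ = -(l ↑u⁻¹ * d u * r ↑u⁻¹) := by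
  have hmul : d u * r ↑u⁻¹ + l u * d ↑u⁻¹ = 0 := by rw [← h, u.mul_inv, h.map_one]
  calc d ↑u⁻¹ = l ↑u⁻¹ * (l u * d ↑u⁻¹) := by
        rw [← mul_assoc, ← map_mul, u.inv_mul, _root_.map_one, one_mul]
    _ = -(l ↑u⁻¹ * d u * r ↑u⁻¹) := by
        rw [eq_neg_of_add_eq_zero_right hmul, mul_neg, mul_assoc]

theorem map_mul_of_eq (h : IsDer l r d) {a b : A} {x y z : M}
    (ha : d a = l a * y - x * r a) (hb : d b = l b * z - y * r b) :
    d (a * b) = l (a * b) * z - x * r (a * b) := by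
  rw [h, ha, hb, map_mul, map_mul]
  noncomm_ring

theorem map_inv_of_eq (h : IsDer l r d) {u : Aˣ} {x y : M} (hu : d u = l u * y - x * r u) :
    d ↑u⁻¹ = l ↑u⁻¹ * x - y * r ↑u⁻¹ := by
  have hl : l ↑u⁻¹ * l u = 1 := by rw [← map_mul, u.inv_mul, _root_.map_one]
  have hr : r u * r ↑u⁻¹ = 1 := by rw [← map_mul, u.mul_inv, _root_.map_one]
  calc d ↑u⁻¹ = l ↑u⁻¹ * x * (r u * r ↑u⁻¹) - (l ↑u⁻¹ * l u) * y * r ↑u⁻¹ := by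
        rw [h.map_inv, hu]
        noncomm_ring
    _ = l ↑u⁻¹ * x - y * r ↑u⁻¹ := by rw [hl, hr, one_mul, mul_one]

theorem add (h : IsDer l r d) (h' : IsDer l r d') : IsDer l r (d + d') := fun a b => by
  simp only [LinearMap.add_apply, h a b, h' a b]
  noncomm_ring

theorem neg (h : IsDer l r d) : IsDer l r (-d) := fun a b => by
  simp only [LinearMap.neg_apply, h a b]
  noncomm_ring

theorem sub (h : IsDer l r d) (h' : IsDer l r d') : IsDer l r (d - d') :=
  sub_eq_add_neg d d' ▸ h.add h'.neg

theorem smul (h : IsDer l r d) (c : k) : IsDer l r (c • d) := fun a b => by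
  simp only [LinearMap.smul_apply, h a b, smul_add, smul_mul_assoc, mul_smul_comm]

theorem mulLeft (h : IsDer l r d) {m : M} (hm : ∀ a, Commute m (l a)) :
    IsDer l r (LinearMap.mulLeft k m ∘ₗ d) := fun a b => by
  simp only [LinearMap.comp_apply, LinearMap.mulLeft_apply, h a b, mul_add, ← mul_assoc,
    (hm a).eq]

theorem mulRight (h : IsDer l r d) {m : M} (hm : ∀ a, Commute m (r a)) :
    IsDer l r (LinearMap.mulRight k m ∘ₗ d) := fun a b => by
  simp only [LinearMap.comp_apply, LinearMap.mulRight_apply, h a b, add_mul, mul_assoc,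
    (hm b).eq]

theorem algHom_comp {N : Type*} [Ring N] [Algebra k N] (h : IsDer l r d) (φ : M →ₐ[k] N) :
    IsDer (φ.comp l) (φ.comp r) (φ.toLinearMap ∘ₗ d) := fun a b => by
  simp only [LinearMap.comp_apply, AlgHom.toLinearMap_apply, AlgHom.comp_apply, h a b, map_add,
    map_mul]

end General

variable {I E : Type*} [Fintype I] {Q : FinQuiver I E}
variable {M : Type*} [Ring M] [Algebra k M] {l r : AQ k Q →ₐ[k] M}

theorem eq_zero {d : AQ k Q →ₗ[k] M} (h : IsDer l r d)
    (idem : ∀ s, d (idem k Q s) = 0) (arr : ∀ p, d (arr k Q p) = 0) (a : AQ k Q) : d a = 0 := by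
  induction a using AQ.induction with
  | algebraMap c => exact h.map_algebraMap c
  | idem s => exact idem s
  | arr p => exact arr p
  | add a b ha hb => rw [map_add, ha, hb, add_zero]
  | mul a b ha hb => rw [h, ha, hb, zero_mul, mul_zero, add_zero]
  | inv u hu => rw [h.map_inv, hu, mul_zero, zero_mul, neg_zero]

theorem ext {d d' : AQ k Q →ₗ[k] M} (h : IsDer l r d) (h' : IsDer l r d')
    (idem : ∀ s, d (idem k Q s) = d' (idem k Q s)) (arr : ∀ p, d (arr k Q p) = d' (arr k Q p)) :
    d = d' :=
  LinearMap.ext fun a => sub_eq_zero.1 <|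
    (h.sub h').eq_zero (fun s => sub_eq_zero.2 (idem s)) (fun p => sub_eq_zero.2 (arr p)) a

end IsDer

variable {I E : Type*} [Fintype I] {Q : FinQuiver I E}
variable {M : Type*} [Ring M] [Algebra k M]

-- A derivation into a bimodule is the second component of a section of its trivial square-zero
-- extension, and such a section is given by the universal property of `A_Q`.
theorem exists_isDer (l r : AQ k Q →ₐ[k] M) {v : E ⊕ E → M}
    (hv : ∀ p, l (idem k Q (Q.double.t p)) * v p * r (idem k Q (Q.double.t p.swap)) = v p) :
    ∃ d : AQ k Q →ₗ[k] M, IsDer l r d ∧ (∀ s, d (idem k Q s) = 0) ∧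
      ∀ p, d (arr k Q p) = v p := by
  let _ : Module (AQ k Q) M := Module.compHom M (l : AQ k Q →+* M)
  let _ : Module (AQ k Q)ᵐᵒᵖ M := Module.compHom M (r : AQ k Q →+* M).op
  have hl (a : AQ k Q) (m : M) : a • m = l a * m := rfl
  have hr (a : AQ k Q) (m : M) : MulOpposite.op a • m = m * r a := rfl
  have : SMulCommClass (AQ k Q) (AQ k Q)ᵐᵒᵖ M := ⟨fun a b m => (mul_assoc (l a) m _).symm⟩
  have : IsScalarTower k (AQ k Q) M := ⟨fun c a m => by simp [hl]⟩
  have : IsScalarTower k (AQ k Q)ᵐᵒᵖ M := ⟨fun c a m => by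
    induction a using MulOpposite.rec' with | _ a => simp [← MulOpposite.op_smul, hr]⟩
  obtain ⟨f, hfs, hfp⟩ := AQ.exists_lift (k := k) (Q := Q)
    (e := fun s => TrivSqZeroExt.inl (idem k Q s))
    (x := fun p => TrivSqZeroExt.inl (arr k Q p) + TrivSqZeroExt.inr (v p))
    ((completeOrthogonalIdempotents_idem k Q).map (TrivSqZeroExt.inlHom (AQ k Q) M))
    (fun p => TrivSqZeroExt.ext (by simp [idem_mul_arr_mul_idem])
      (by simp [hl, hr, hv]))
    (fun p => TrivSqZeroExt.isUnit_iff_isUnit_fst.2 (by simp [← coe_zUnit]))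
  have hfst (a : AQ k Q) : (f a).fst = a :=
    DFunLike.congr_fun (AQ.algHom_ext (φ := (TrivSqZeroExt.fstHom k (AQ k Q) M).comp f)
      (ψ := AlgHom.id k _) (fun s => by simp [hfs]) (fun p => by simp [hfp])) a
  refine ⟨TrivSqZeroExt.sndHom (AQ k Q) M ∘ₗ f.toLinearMap, fun a b => ?_, fun s => ?_, fun p => ?_⟩
  · simp [hfst, hl, hr, add_comm]
  · simp [hfs]
  · simp [hfp]

theorem exists_isDer_family {N : Type*} [AddCommGroup N] [Module k N] (l r : AQ k Q →ₐ[k] M)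
    {v : E ⊕ E → N →ₗ[k] M} (hv : ∀ p n,
      l (idem k Q (Q.double.t p)) * v p n * r (idem k Q (Q.double.t p.swap)) = v p n) :
    ∃ F : N →ₗ[k] AQ k Q →ₗ[k] M, (∀ n, IsDer l r (F n)) ∧ (∀ n s, F n (idem k Q s) = 0) ∧
      ∀ n p, F n (arr k Q p) = v p n := by
  choose F hF hFs hFp using fun n => exists_isDer l r fun p => hv p n
  refine ⟨⟨⟨F, fun n n' => ?_⟩, fun c n => ?_⟩, hF, hFs, hFp⟩
  · exact (hF _).ext ((hF n).add (hF n')) (fun s => by simp [hFs]) (fun p => by simp [hFp])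
  · exact (hF _).ext ((hF n).smul c) (fun s => by simp [hFs]) (fun p => by simp [hFp])

end Derivations

section DoubleBracketDerivations

variable {k : Type*} [Field k] {A : Type*} [Ring A] [Algebra k A]
variable {br : A →ₗ[k] A →ₗ[k] A ⊗[k] A}

theorem comm_mul (x y : A ⊗[k] A) : TensorProduct.comm k A A (x * y) =
    TensorProduct.comm k A A x * TensorProduct.comm k A A y :=
  map_mul (Algebra.TensorProduct.comm k A A) x y

theorem commute_tmul_one_one_tmul (a b : A) :
    Commute (a ⊗ₜ[k] 1 : A ⊗[k] A) (1 ⊗ₜ[k] b) := by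
  simp [Commute, SemiconjBy]

theorem IsDer.neg_comm {d : A →ₗ[k] A ⊗[k] A} (h : IsDer includeLeft includeRight d) :
    IsDer includeRight includeLeft (-((TensorProduct.comm k A A).toLinearMap ∘ₗ d)) := by
  have := (h.algHom_comp (Algebra.TensorProduct.comm k A A).toAlgHom).neg
  rwa [Algebra.TensorProduct.comm_comp_includeLeft,
    Algebra.TensorProduct.comm_comp_includeRight] at this

namespace IsDoubleBracket

theorem isDer_right (h : IsDoubleBracket br) (a : A) :
    IsDer includeLeft includeRight (br a) :=
  h.deriv a

theorem isDer_left (h : IsDoubleBracket br) (b : A) :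
    IsDer includeRight includeLeft (br.flip b) := by
  have : br.flip b = -((TensorProduct.comm k A A).toLinearMap ∘ₗ br b) :=
    LinearMap.ext fun a => h.antisymm a b
  exact this ▸ (h.isDer_right b).neg_comm

end IsDoubleBracket

end DoubleBracketDerivations

section Existence

variable {k : Type*} [Field k] {I E : Type*} [Fintype I] {Q : FinQuiver I E}
variable {br br' : AQ k Q →ₗ[k] AQ k Q →ₗ[k] AQ k Q ⊗[k] AQ k Q}

theorem IsDoubleBracket.ext (h : IsDoubleBracket br) (h' : IsDoubleBracket br')
    (hB : IsBLinear (idem k Q) br) (hB' : IsBLinear (idem k Q) br')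
    (arr : ∀ p q, br (arr k Q p) (arr k Q q) = br' (arr k Q p) (arr k Q q)) : br = br' := by
  have hflip : br.flip = br'.flip := LinearMap.ext fun b =>
    (h.isDer_left b).ext (h'.isDer_left b) (fun s => by simp [(hB s b).1, (hB' s b).1]) fun p =>
      DFunLike.congr_fun ((h.isDer_right _).ext (h'.isDer_right _)
        (fun s => by simp [(hB s _).2, (hB' s _).2]) (arr p)) b
  rw [← br.flip_flip, hflip, br'.flip_flip]

-- The inner derivation rule holds by construction; the outer one in general follows from the
-- one for `br p`, `p` an arrow, because its two sides are inner derivations of the first entry.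
theorem isDer_right_of_arr (hl : ∀ b, IsDer includeRight includeLeft (br.flip b))
    (hB : IsBLinear (idem k Q) br) (arr : ∀ p, IsDer includeLeft includeRight (br (arr k Q p)))
    (a : AQ k Q) : IsDer includeLeft includeRight (br a) := fun b c => by
  have hder : IsDer includeRight includeLeft
      (LinearMap.mulRight k ((1 : AQ k Q) ⊗ₜ[k] c) ∘ₗ br.flip b +
        LinearMap.mulLeft k (b ⊗ₜ[k] (1 : AQ k Q)) ∘ₗ br.flip c) :=
    ((hl b).mulRight fun _ => (commute_tmul_one_one_tmul _ _).symm).add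
      ((hl c).mulLeft fun _ => commute_tmul_one_one_tmul _ _)
  exact DFunLike.congr_fun ((hl (b * c)).ext hder (fun s => by simp [(hB s _).1])
    fun p => arr p b c) a

theorem antisymm_of_arr (hl : ∀ b, IsDer includeRight includeLeft (br.flip b))
    (hr : ∀ a, IsDer includeLeft includeRight (br a)) (hB : IsBLinear (idem k Q) br)
    (arr : ∀ p q, br (arr k Q p) (arr k Q q) =
      -TensorProduct.comm k _ _ (br (arr k Q q) (arr k Q p)))
    (a b : AQ k Q) : br a b = -TensorProduct.comm k _ _ (br b a) := by
  have hcomm (b) (h : ∀ p, br (VdB.arr k Q p) b =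
      -TensorProduct.comm k _ _ (br b (VdB.arr k Q p))) (a) :
      br a b = -TensorProduct.comm k _ _ (br b a) :=
    DFunLike.congr_fun ((hl b).ext (hr b).neg_comm (fun s => by simp [hB s b]) h) a
  refine hcomm b (fun p => ?_) a
  rw [hcomm (VdB.arr k Q p) (fun q => arr q p) b, map_neg, TensorProduct.comm_comm, neg_neg]

theorem exists_isDer_isDer {v : E ⊕ E → E ⊕ E → AQ k Q ⊗[k] AQ k Q}
    (houter : ∀ p q, (idem k Q (Q.double.t q) ⊗ₜ[k] (1 : AQ k Q)) * v p q *
      ((1 : AQ k Q) ⊗ₜ[k] idem k Q (Q.double.t q.swap)) = v p q)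
    (hinner : ∀ p q, ((1 : AQ k Q) ⊗ₜ[k] idem k Q (Q.double.t p)) * v p q *
      (idem k Q (Q.double.t p.swap) ⊗ₜ[k] (1 : AQ k Q)) = v p q) :
    ∃ br : AQ k Q →ₗ[k] AQ k Q →ₗ[k] AQ k Q ⊗[k] AQ k Q,
      (∀ b, IsDer includeRight includeLeft (br.flip b)) ∧
      (∀ p, IsDer includeLeft includeRight (br (arr k Q p))) ∧
      IsBLinear (idem k Q) br ∧ ∀ p q, br (arr k Q p) (arr k Q q) = v p q := by
  choose D hD hDs hDp using fun p => exists_isDer includeLeft includeRight (houter p)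
  have hcorner (p b) : ((1 : AQ k Q) ⊗ₜ[k] idem k Q (Q.double.t p)) * D p b *
      (idem k Q (Q.double.t p.swap) ⊗ₜ[k] (1 : AQ k Q)) = D p b :=
    DFunLike.congr_fun ((((hD p).mulLeft fun _ =>
      (commute_tmul_one_one_tmul _ _).symm).mulRight fun _ =>
      commute_tmul_one_one_tmul _ _).ext (hD p) (fun s => by simp [hDs])
      fun q => by simpa [hDp] using hinner p q) b
  obtain ⟨F, hF, hFs, hFp⟩ := exists_isDer_family includeRight includeLeft hcorner
  have hflip (p) : F.flip (arr k Q p) = D p := LinearMap.ext fun b => hFp b p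
  refine ⟨F.flip, hF, fun p => hflip p ▸ hD p, fun s a => ⟨hFs a s, ?_⟩, fun p q => ?_⟩
  · exact (hF (idem k Q s)).eq_zero (hFs _) (fun p => by rw [hFp, hDs]) a
  · rw [hflip, hDp]

theorem exists_isDoubleBracket {v : E ⊕ E → E ⊕ E → AQ k Q ⊗[k] AQ k Q}
    (houter : ∀ p q, (idem k Q (Q.double.t q) ⊗ₜ[k] (1 : AQ k Q)) * v p q *
      ((1 : AQ k Q) ⊗ₜ[k] idem k Q (Q.double.t q.swap)) = v p q)
    (hanti : ∀ p q, v p q = -TensorProduct.comm k _ _ (v q p)) :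
    ∃ br : AQ k Q →ₗ[k] AQ k Q →ₗ[k] AQ k Q ⊗[k] AQ k Q,
      IsDoubleBracket br ∧ IsBLinear (idem k Q) br ∧
      ∀ p q, br (arr k Q p) (arr k Q q) = v p q := by
  have hinner (p q) : ((1 : AQ k Q) ⊗ₜ[k] idem k Q (Q.double.t p)) * v p q *
      (idem k Q (Q.double.t p.swap) ⊗ₜ[k] (1 : AQ k Q)) = v p q := by
    have hcomm := congrArg (TensorProduct.comm k _ _) (houter q p)
    simp only [comm_mul, TensorProduct.comm_tmul] at hcomm
    rw [hanti p q, mul_neg, neg_mul, hcomm]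
  obtain ⟨br, hl, harr, hB, hv⟩ := exists_isDer_isDer houter hinner
  have hr := isDer_right_of_arr hl hB harr
  exact ⟨br, ⟨antisymm_of_arr hl hr hB fun p q => by rw [hv, hv, hanti], hr⟩, hB, hv⟩

end Existence

/-! ### Brackets defined by a form on the arrows -/

section FormBracket

variable {k : Type*} [Field k] {I E : Type*} (Q : FinQuiver I E)

/-- An alternating function on pairs of arrows of the double quiver which vanishes on pairs with
different tails. The ordering functions `o_s` together make up such a form. -/
structure IsTailForm (O : E ⊕ E → E ⊕ E → k) : Prop where
  self : ∀ p, O p p = 0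
  antisymm : ∀ p q, O p q = -O q p
  eq_zero : ∀ p q, Q.double.t p ≠ Q.double.t q → O p q = 0

variable {Q} {O : E ⊕ E → E ⊕ E → k}

theorem IsTailForm.smul_congr {M : Type*} [AddCommMonoid M] [Module k M] (hO : IsTailForm Q O)
    {p q : E ⊕ E} {x y : M} (h : Q.double.t p = Q.double.t q → x = y) : O p q • x = O p q • y := by
  by_cases hpq : Q.double.t p = Q.double.t q
  · rw [h hpq]
  · rw [hO.eq_zero p q hpq, zero_smul, zero_smul]

variable [Fintype I]

variable (Q)

/-- The element `½ (O(c, p) c ⊗ e_{t(c)} - O(c^*, p) e_{h(c)} ⊗ c)`, the contribution of the end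
`p` of an arrow to the values of `{{c, -}}`. -/
def gaugeTerm (O : E ⊕ E → E ⊕ E → k) (c p : E ⊕ E) : AQ k Q ⊗[k] AQ k Q :=
  (1 / 2 : k) • (O c p • (arr k Q c ⊗ₜ[k] idem k Q (Q.double.t c))
    - O c.swap p • (idem k Q (Q.double.t c.swap) ⊗ₜ[k] arr k Q c))

variable (k) in
/-- The element `e_{h(c)} ⊗ e_{t(c)} + ½ c^* c ⊗ e_{t(c)} + ½ e_{h(c)} ⊗ c c^*`, the part of
`{{c, c^*}}` which does not depend on the orderings. -/
def pairTerm (c : E ⊕ E) : AQ k Q ⊗[k] AQ k Q :=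
  idem k Q (Q.double.t c.swap) ⊗ₜ[k] idem k Q (Q.double.t c)
    + (1 / 2 : k) • ((arr k Q c.swap * arr k Q c) ⊗ₜ[k] idem k Q (Q.double.t c))
    + (1 / 2 : k) • (idem k Q (Q.double.t c.swap) ⊗ₜ[k] (arr k Q c * arr k Q c.swap))

open Classical in
/-- The value `{{c, b}}` on arrows of the bracket defined by the form `O` and the signs `η`. For
the form `o_{t(c)}(c, b)` and the signs `1` on `Q`, `-1` on the opposite arrows, it is Van den
Bergh's value. -/
def arrowBracket (O : E ⊕ E → E ⊕ E → k) (η : E ⊕ E → k) (c b : E ⊕ E) : AQ k Q ⊗[k] AQ k Q :=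
  (arr k Q b ⊗ₜ[k] (1 : AQ k Q)) * gaugeTerm Q O c b.swap
    - gaugeTerm Q O c b * ((1 : AQ k Q) ⊗ₜ[k] arr k Q b)
    + if b = c.swap then η c • pairTerm k Q c else 0

variable {Q} {η : E ⊕ E → k}

theorem idem_mul_gaugeTerm (hO : IsTailForm Q O) (c p : E ⊕ E) :
    (idem k Q (Q.double.t p) ⊗ₜ[k] (1 : AQ k Q)) * gaugeTerm Q O c p = gaugeTerm Q O c p := by
  simp only [gaugeTerm, mul_smul_comm, mul_sub, Algebra.TensorProduct.tmul_mul_tmul, one_mul]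
  congr 2 <;> refine hO.smul_congr fun h => ?_
  · rw [← h, idem_mul_arr]
  · rw [← h, idem_mul_self]

theorem gaugeTerm_mul_idem (hO : IsTailForm Q O) (c p : E ⊕ E) :
    gaugeTerm Q O c p * ((1 : AQ k Q) ⊗ₜ[k] idem k Q (Q.double.t p)) = gaugeTerm Q O c p := by
  simp only [gaugeTerm, smul_mul_assoc, sub_mul, Algebra.TensorProduct.tmul_mul_tmul, mul_one]
  congr 2 <;> refine hO.smul_congr fun h => ?_
  · rw [← h, idem_mul_self]
  · rw [← h, arr_mul_idem]

theorem arr_mul_gaugeTerm (hO : IsTailForm Q O) (c b : E ⊕ E) :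
    (arr k Q b ⊗ₜ[k] (1 : AQ k Q)) * gaugeTerm Q O c b.swap =
      (1 / 2 : k) • (O c b.swap • ((arr k Q b * arr k Q c) ⊗ₜ[k] idem k Q (Q.double.t c))
        - O c.swap b.swap • (arr k Q b ⊗ₜ[k] arr k Q c)) := by
  simp only [gaugeTerm, mul_smul_comm, mul_sub, Algebra.TensorProduct.tmul_mul_tmul, one_mul]
  congr 2
  exact hO.smul_congr fun h => by rw [h, arr_mul_idem]

theorem gaugeTerm_mul_arr (hO : IsTailForm Q O) (c b : E ⊕ E) :
    gaugeTerm Q O c b * ((1 : AQ k Q) ⊗ₜ[k] arr k Q b) =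
      (1 / 2 : k) • (O c b • (arr k Q c ⊗ₜ[k] arr k Q b)
        - O c.swap b • (idem k Q (Q.double.t c.swap) ⊗ₜ[k] (arr k Q c * arr k Q b))) := by
  simp only [gaugeTerm, smul_mul_assoc, sub_mul, Algebra.TensorProduct.tmul_mul_tmul, mul_one]
  congr 2
  exact hO.smul_congr fun h => by rw [h, idem_mul_arr]

theorem idem_mul_pairTerm_mul_idem (c : E ⊕ E) :
    (idem k Q (Q.double.t c.swap) ⊗ₜ[k] (1 : AQ k Q)) * pairTerm k Q c *
      ((1 : AQ k Q) ⊗ₜ[k] idem k Q (Q.double.t c)) = pairTerm k Q c := by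
  simp only [pairTerm, mul_add, add_mul, mul_smul_comm, smul_mul_assoc,
    Algebra.TensorProduct.tmul_mul_tmul, one_mul, mul_one, ← mul_assoc (idem k Q _), idem_mul_arr,
    idem_mul_self]
  rw [mul_assoc, arr_swap_mul_idem]

theorem comm_pairTerm (c : E ⊕ E) :
    TensorProduct.comm k _ _ (pairTerm k Q c.swap) = pairTerm k Q c := by
  simp only [pairTerm, map_add, map_smul, TensorProduct.comm_tmul, Sum.swap_swap]
  abel

open Classical in
theorem arrowBracket_eq (hO : IsTailForm Q O) (c b : E ⊕ E) : arrowBracket Q O η c b =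
    (1 / 2 : k) • (O c b.swap • ((arr k Q b * arr k Q c) ⊗ₜ[k] idem k Q (Q.double.t c)))
    - (1 / 2 : k) • (O c.swap b.swap • (arr k Q b ⊗ₜ[k] arr k Q c))
    - (1 / 2 : k) • (O c b • (arr k Q c ⊗ₜ[k] arr k Q b))
    + (1 / 2 : k) • (O c.swap b •
        (idem k Q (Q.double.t c.swap) ⊗ₜ[k] (arr k Q c * arr k Q b)))
    + if b = c.swap then η c • pairTerm k Q c else 0 := by
  rw [arrowBracket, arr_mul_gaugeTerm hO, gaugeTerm_mul_arr hO]
  module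

theorem arrowBracket_self (hO : IsTailForm Q O) (c : E ⊕ E) :
    arrowBracket Q O η c c = ((1 / 2 : k) * O c c.swap) •
      ((arr k Q c * arr k Q c) ⊗ₜ[k] idem k Q (Q.double.t c)
        - idem k Q (Q.double.t c.swap) ⊗ₜ[k] (arr k Q c * arr k Q c)) := by
  rw [arrowBracket_eq hO, if_neg (by cases c <;> simp), hO.self, hO.self, hO.antisymm c.swap c]
  module

theorem arrowBracket_swap (hO : IsTailForm Q O) (c : E ⊕ E) :
    arrowBracket Q O η c c.swap = η c • pairTerm k Q c + ((1 / 2 : k) * O c c.swap) •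
      (arr k Q c.swap ⊗ₜ[k] arr k Q c - arr k Q c ⊗ₜ[k] arr k Q c.swap) := by
  rw [arrowBracket_eq hO, if_pos rfl, Sum.swap_swap, hO.self, hO.self, hO.antisymm c.swap c]
  module

theorem arrowBracket_of_ne (hO : IsTailForm Q O) {c b : E ⊕ E} (h : b ≠ c.swap) :
    arrowBracket Q O η c b = -(((1 / 2 : k) * O c b) • (arr k Q c ⊗ₜ[k] arr k Q b))
      - ((1 / 2 : k) * O c.swap b.swap) • (arr k Q b ⊗ₜ[k] arr k Q c)
      + ((1 / 2 : k) * O c b.swap) • ((arr k Q b * arr k Q c) ⊗ₜ[k] idem k Q (Q.double.t c))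
      + ((1 / 2 : k) * O c.swap b) •
        (idem k Q (Q.double.t c.swap) ⊗ₜ[k] (arr k Q c * arr k Q b)) := by
  rw [arrowBracket_eq hO, if_neg h]
  module

theorem idem_mul_arrowBracket_mul_idem (hO : IsTailForm Q O) (c b : E ⊕ E) :
    (idem k Q (Q.double.t b) ⊗ₜ[k] (1 : AQ k Q)) * arrowBracket Q O η c b *
      ((1 : AQ k Q) ⊗ₜ[k] idem k Q (Q.double.t b.swap)) = arrowBracket Q O η c b := by
  rw [arrowBracket, mul_add, add_mul, mul_sub, sub_mul]
  congr 2
  · rw [← mul_assoc, Algebra.TensorProduct.tmul_mul_tmul, idem_mul_arr, one_mul, mul_assoc,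
      gaugeTerm_mul_idem hO]
  · rw [← mul_assoc, idem_mul_gaugeTerm hO, mul_assoc, Algebra.TensorProduct.tmul_mul_tmul,
      arr_mul_idem, one_mul]
  · split_ifs with h
    · rw [h, Sum.swap_swap, mul_smul_comm, smul_mul_assoc, idem_mul_pairTerm_mul_idem]
    · rw [mul_zero, zero_mul]

open Classical in
theorem arrowBracket_antisymm (hO : IsTailForm Q O) (hη : ∀ p, η p.swap = -η p) (c b : E ⊕ E) :
    arrowBracket Q O η c b = -TensorProduct.comm k _ _ (arrowBracket Q O η b c) := by
  have hleft : O c b.swap • ((arr k Q b * arr k Q c) ⊗ₜ[k] idem k Q (Q.double.t c)) =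
      -(O b.swap c • ((arr k Q b * arr k Q c) ⊗ₜ[k] idem k Q (Q.double.t b.swap))) := by
    rw [hO.antisymm b.swap c, neg_smul, neg_neg]
    exact hO.smul_congr fun h => by rw [h]
  have hright : O c.swap b • (idem k Q (Q.double.t c.swap) ⊗ₜ[k] (arr k Q c * arr k Q b)) =
      -(O b c.swap • (idem k Q (Q.double.t b) ⊗ₜ[k] (arr k Q c * arr k Q b))) := by
    rw [hO.antisymm b c.swap, neg_smul, neg_neg]
    exact hO.smul_congr fun h => by rw [h]
  have hpair : (if b = c.swap then η c • pairTerm k Q c else 0) =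
      -TensorProduct.comm k _ _ (if c = b.swap then η b • pairTerm k Q b else 0) := by
    by_cases h : b = c.swap
    · rw [h, if_pos rfl, if_pos c.swap_swap.symm, map_smul, comm_pairTerm, hη, neg_smul, neg_neg]
    · rw [if_neg h, if_neg fun h' => h (by rw [h', Sum.swap_swap]), map_zero, neg_zero]
  rw [arrowBracket_eq hO, arrowBracket_eq hO, hleft, hright, hpair, hO.antisymm c.swap b.swap,
    hO.antisymm c b]
  simp only [map_add, map_sub, map_smul, TensorProduct.comm_tmul]
  module

/-- `br` is the `B`-linear double bracket on `A_Q` defined by the form `O` and the signs `η`. -/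
structure IsFormBracket (Q : FinQuiver I E) (O : E ⊕ E → E ⊕ E → k) (η : E ⊕ E → k)
    (br : AQ k Q →ₗ[k] AQ k Q →ₗ[k] AQ k Q ⊗[k] AQ k Q) : Prop where
  isDoubleBracket : IsDoubleBracket br
  isBLinear : IsBLinear (idem k Q) br
  arr_arr : ∀ p q, br (arr k Q p) (arr k Q q) = arrowBracket Q O η p q

theorem exists_isFormBracket (hO : IsTailForm Q O) (hη : ∀ p, η p.swap = -η p) :
    ∃ br, IsFormBracket Q O η br := by
  obtain ⟨br, isDoubleBracket, isBLinear, arr_arr⟩ := exists_isDoubleBracket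
    (idem_mul_arrowBracket_mul_idem hO) (arrowBracket_antisymm hO hη)
  exact ⟨br, isDoubleBracket, isBLinear, arr_arr⟩

theorem IsFormBracket.unique {br br' : AQ k Q →ₗ[k] AQ k Q →ₗ[k] AQ k Q ⊗[k] AQ k Q}
    (h : IsFormBracket Q O η br) (h' : IsFormBracket Q O η br') : br = br' :=
  h.isDoubleBracket.ext h'.isDoubleBracket h.isBLinear h'.isBLinear
    fun p q => by rw [h.arr_arr, h'.arr_arr]

end FormBracket

section VanDenBergh

variable (k : Type*) [Field k] {I E : Type*} (Q : FinQuiver I E)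

/-- The ordering functions `o_s`, put together to a form on pairs of arrows. -/
def ordForm [DecidableEq I] (o : Q.Ordering) (p q : E ⊕ E) : k :=
  (Q.ordFun o (Q.double.t p) p q : k)

/-- The sign `ε`: it is `1` on arrows of `Q` and `-1` on the opposite arrows. -/
def stdSign : E ⊕ E → ℤˣ := Sum.elim (fun _ => 1) fun _ => -1

theorem stdSign_swap (p : E ⊕ E) : stdSign p.swap = -stdSign p := by
  cases p <;> simp [stdSign]

variable [DecidableEq I] {Q}

theorem ordFun_antisymm (o : Q.Ordering) (p q : E ⊕ E) :
    Q.ordFun o (Q.double.t p) p q = -Q.ordFun o (Q.double.t q) q p := by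
  by_cases h : Q.double.t q = Q.double.t p
  · rw [h, FinQuiver.ordFun, FinQuiver.ordFun, dif_pos ⟨rfl, h⟩, dif_pos ⟨h, rfl⟩]
    let := o (Q.double.t p)
    rcases lt_trichotomy (⟨p, rfl⟩ : Q.T (Q.double.t p)) ⟨q, h⟩ with hlt | heq | hgt
    · rw [if_pos hlt, if_neg hlt.asymm, if_pos hlt]
      rfl
    · simp [heq]
    · rw [if_neg hgt.asymm, if_pos hgt, if_pos hgt]
  · rw [FinQuiver.ordFun, FinQuiver.ordFun, dif_neg fun h' => h h'.2,
      dif_neg fun h' => h h'.2.symm, neg_zero]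

theorem ordForm_isTailForm (o : Q.Ordering) : IsTailForm Q (ordForm k Q o) where
  self p := by simp [ordForm, FinQuiver.ordFun]
  antisymm p q := by rw [ordForm, ordFun_antisymm, Int.cast_neg, ordForm]
  eq_zero p q h := by
    rw [ordForm, FinQuiver.ordFun, dif_neg fun h' => h h'.2.symm, Int.cast_zero]

theorem isVdBBracket_iff [Fintype I] (o : Q.Ordering)
    (br : AQ k Q →ₗ[k] AQ k Q →ₗ[k] AQ k Q ⊗[k] AQ k Q) : IsVdBBracket k Q o br ↔
      IsFormBracket Q (ordForm k Q o) (fun p => ((stdSign p : ℤ) : k)) br := by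
  have hO := ordForm_isTailForm k o
  have hstar (a : E) : arrowBracket Q (ordForm k Q o) (fun p => ((stdSign p : ℤ) : k))
        (Sum.inl a) (Sum.inr a) =
      idem k Q (Q.h a) ⊗ₜ[k] idem k Q (Q.t a)
        + (1 / 2 : k) •
          ((arr k Q (Sum.inr a) * arr k Q (Sum.inl a)) ⊗ₜ[k] idem k Q (Q.t a))
        + (1 / 2 : k) •
          (idem k Q (Q.h a) ⊗ₜ[k] (arr k Q (Sum.inl a) * arr k Q (Sum.inr a)))
        + ((1 / 2 : k) * (Q.ordFun o (Q.t a) (Sum.inl a) (Sum.inr a) : k)) •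
          (arr k Q (Sum.inr a) ⊗ₜ[k] arr k Q (Sum.inl a)
            - arr k Q (Sum.inl a) ⊗ₜ[k] arr k Q (Sum.inr a)) := by
    refine (arrowBracket_swap hO (Sum.inl a)).trans ?_
    simp only [stdSign, Sum.elim_inl, Units.val_one, Int.cast_one, one_smul]
    rfl
  refine ⟨fun h => ⟨h.isDoubleBracket, h.isBLinear, fun p q => ?_⟩, fun h => ⟨h.isDoubleBracket,
    h.isBLinear, fun a => ?_, fun a => (h.arr_arr _ _).trans (hstar a), fun b c _ hc => ?_⟩⟩
  · obtain rfl | hself := eq_or_ne q p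
    · rw [h.self, arrowBracket_self hO, ordForm, Q.double_h]
    obtain rfl | hswap := eq_or_ne q p.swap
    · rcases p with a | a
      · exact (h.star a).trans (hstar a).symm
      · rw [h.isDoubleBracket.antisymm, arrowBracket_antisymm hO fun p => by simp [stdSign_swap]]
        exact congrArg (fun x => -TensorProduct.comm k _ _ x) ((h.star a).trans (hstar a).symm)
    · rw [h.other p q hself hswap, arrowBracket_of_ne hO hswap, Q.double_h]
      rfl
  · rw [h.arr_arr, arrowBracket_self hO, ordForm, Q.double_h]
  · rw [h.arr_arr, arrowBracket_of_ne hO hc, Q.double_h]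
    rfl

end VanDenBergh

/-! ### Triple brackets -/

section TripleTensor

variable {k : Type*} [Field k] {A : Type*} [Ring A] [Algebra k A]

@[simp]
theorem tau_tmul (x y z : A) : tau (x ⊗ₜ[k] y ⊗ₜ[k] z) = z ⊗ₜ[k] x ⊗ₜ[k] y := by
  simp [tau]

theorem tau_tau_tau (x : A ⊗[k] A ⊗[k] A) : tau (tau (tau x)) = x := by
  have : tau ∘ₗ tau ∘ₗ tau = (LinearMap.id : A ⊗[k] A ⊗[k] A →ₗ[k] A ⊗[k] A ⊗[k] A) :=
    TensorProduct.ext_threefold fun x y z => by simp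
  exact DFunLike.congr_fun this x

theorem tau_mul (x y : A ⊗[k] A ⊗[k] A) : tau (x * y) = tau x * tau y :=
  map_mul ((Algebra.TensorProduct.comm k (A ⊗[k] A) A).trans
    (Algebra.TensorProduct.assoc k k k A A A).symm) x y

/-- The algebra map `x ⊗ y ↦ 1 ⊗ x ⊗ y`. -/
def incl23 : A ⊗[k] A →ₐ[k] A ⊗[k] A ⊗[k] A :=
  Algebra.TensorProduct.map includeRight (AlgHom.id k A)

@[simp]
theorem incl23_tmul (x y : A) : incl23 (x ⊗ₜ[k] y) = (1 : A) ⊗ₜ[k] x ⊗ₜ[k] y := by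
  simp [incl23]

theorem tau_tmul_one (x : A ⊗[k] A) : tau (x ⊗ₜ[k] (1 : A)) = incl23 x := by
  induction x using TensorProduct.induction_on with
  | zero => simp
  | add x y hx hy => rw [TensorProduct.add_tmul, map_add, map_add, hx, hy]
  | tmul x y => simp

end TripleTensor

section TripleBracket

variable {k : Type*} [Field k] {A : Type*} [Ring A] [Algebra k A]

/-- The cyclic sum defining the triple bracket, with `br` as outer and `br'` as inner bracket. -/
def mixedTriple (br br' : A →ₗ[k] A →ₗ[k] A ⊗[k] A) (a b c : A) : A ⊗[k] A ⊗[k] A :=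
  (br a).rTensor A (br' b c) + tau ((br b).rTensor A (br' c a)) +
    tau (tau ((br c).rTensor A (br' a b)))

theorem tripleBracket_add (br br' : A →ₗ[k] A →ₗ[k] A ⊗[k] A) (a b c : A) :
    tripleBracket (br + br') a b c = tripleBracket br a b c + tripleBracket br' a b c
      + (mixedTriple br br' a b c + mixedTriple br' br a b c) := by
  simp only [tripleBracket, mixedTriple, LinearMap.add_apply, LinearMap.rTensor_add, map_add]
  abel

theorem tripleBracket_rotate (br : A →ₗ[k] A →ₗ[k] A ⊗[k] A) (a b c : A) :
    tripleBracket br a b c = tau (tripleBracket br b c a) := by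
  simp only [tripleBracket, map_add, tau_tau_tau]
  abel

/-- The triple bracket as a linear map in its last argument. -/
def tripleLin (br : A →ₗ[k] A →ₗ[k] A ⊗[k] A) (a b : A) : A →ₗ[k] A ⊗[k] A ⊗[k] A :=
  (br a).rTensor A ∘ₗ br b + tau ∘ₗ (br b).rTensor A ∘ₗ br.flip a
    + tau ∘ₗ tau ∘ₗ (LinearMap.rTensorHom A ∘ₗ br).flip (br a b)

theorem tripleLin_apply (br : A →ₗ[k] A →ₗ[k] A ⊗[k] A) (a b c : A) :
    tripleLin br a b c = tripleBracket br a b c :=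
  rfl

theorem rTensor_mul_one_tmul (f : A →ₗ[k] A ⊗[k] A) (m : A ⊗[k] A) (d : A) :
    f.rTensor A (m * ((1 : A) ⊗ₜ[k] d)) = f.rTensor A m * ((1 : A ⊗[k] A) ⊗ₜ[k] d) := by
  induction m using TensorProduct.induction_on with
  | zero => simp
  | add x y hx hy => rw [add_mul, map_add, hx, hy, map_add, add_mul]
  | tmul x y => simp

theorem rTensor_one_tmul_mul (f : A →ₗ[k] A ⊗[k] A) (d : A) (m : A ⊗[k] A) :
    f.rTensor A (((1 : A) ⊗ₜ[k] d) * m) = ((1 : A ⊗[k] A) ⊗ₜ[k] d) * f.rTensor A m := by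
  induction m using TensorProduct.induction_on with
  | zero => simp
  | add x y hx hy => rw [mul_add, map_add, hx, hy, map_add, mul_add]
  | tmul x y => simp

namespace IsDoubleBracket

variable {br : A →ₗ[k] A →ₗ[k] A ⊗[k] A}

theorem map_mul_left (h : IsDoubleBracket br) (a b c : A) :
    br (a * b) c = br a c * (b ⊗ₜ[k] (1 : A)) + ((1 : A) ⊗ₜ[k] a) * br b c :=
  h.isDer_left c a b

theorem rTensor_tmul_one_mul (h : IsDoubleBracket br) (a c : A) (m : A ⊗[k] A) :
    (br a).rTensor A ((c ⊗ₜ[k] (1 : A)) * m) =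
      (br a c ⊗ₜ[k] (1 : A)) * incl23 m
        + (c ⊗ₜ[k] (1 : A) ⊗ₜ[k] (1 : A)) * (br a).rTensor A m := by
  induction m using TensorProduct.induction_on with
  | zero => simp
  | add x y hx hy =>
    simp only [mul_add, map_add, hx, hy]
    abel
  | tmul x y => simp [h.deriv, TensorProduct.add_tmul]

theorem tau_rTensor_mul_tmul_one (h : IsDoubleBracket br) (a d : A) (m : A ⊗[k] A) :
    tau ((br a).rTensor A (m * (d ⊗ₜ[k] (1 : A)))) =
      tau ((br a).rTensor A m) * ((1 : A) ⊗ₜ[k] (1 : A) ⊗ₜ[k] d)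
        + (TensorProduct.comm k A A m ⊗ₜ[k] (1 : A)) * incl23 (br a d) := by
  induction m using TensorProduct.induction_on with
  | zero => simp
  | add x y hx hy =>
    simp only [add_mul, map_add, hx, hy, TensorProduct.add_tmul]
    abel
  | tmul x y =>
    have hright : (br a x * ((1 : A) ⊗ₜ[k] d)) ⊗ₜ[k] y =
      (br a x ⊗ₜ[k] y) * ((1 : A) ⊗ₜ[k] d ⊗ₜ[k] (1 : A)) := by simp
    have hleft : ((x ⊗ₜ[k] (1 : A)) * br a d) ⊗ₜ[k] y =
      (x ⊗ₜ[k] (1 : A) ⊗ₜ[k] y) * (br a d ⊗ₜ[k] (1 : A)) := by simp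
    rw [Algebra.TensorProduct.tmul_mul_tmul, mul_one, LinearMap.rTensor_tmul, h.deriv,
      TensorProduct.add_tmul, map_add, hright, hleft, tau_mul, tau_mul, tau_tmul, tau_tmul,
      tau_tmul_one, TensorProduct.comm_tmul, LinearMap.rTensor_tmul]

theorem rTensor_mul (h : IsDoubleBracket br) (c d : A) (m : A ⊗[k] A) :
    (br (c * d)).rTensor A m = (br c).rTensor A m * (d ⊗ₜ[k] (1 : A) ⊗ₜ[k] (1 : A))
      + ((1 : A) ⊗ₜ[k] c ⊗ₜ[k] (1 : A)) * (br d).rTensor A m := by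
  induction m using TensorProduct.induction_on with
  | zero => simp
  | add x y hx hy =>
    simp only [mul_add, add_mul, map_add, hx, hy]
    abel
  | tmul x y => simp [h.map_mul_left, TensorProduct.add_tmul]

-- The inner terms produced by the three cyclic summands cancel in pairs, by antisymmetry.
theorem isDer_tripleLin (h : IsDoubleBracket br) (a b : A) :
    IsDer ((includeLeft : A ⊗[k] A →ₐ[k] A ⊗[k] A ⊗[k] A).comp includeLeft)
      (includeRight : A →ₐ[k] A ⊗[k] A ⊗[k] A) (tripleLin br a b) := by
  intro c d
  have hcancel : (TensorProduct.comm k A A (br c a) ⊗ₜ[k] (1 : A)) * incl23 (br b d) =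
      -((br a c ⊗ₜ[k] (1 : A)) * incl23 (br b d)) := by
    refine eq_neg_of_add_eq_zero_left ?_
    rw [← add_mul, ← TensorProduct.add_tmul, h.antisymm a c, add_neg_cancel,
      TensorProduct.zero_tmul, zero_mul]
  simp only [tripleLin_apply, tripleBracket, h.deriv, h.map_mul_left, map_add,
    h.rTensor_tmul_one_mul, h.tau_rTensor_mul_tmul_one, h.rTensor_mul, rTensor_mul_one_tmul,
    rTensor_one_tmul_mul, tau_mul, tau_tmul, Algebra.TensorProduct.one_def,
    AlgHom.comp_apply, Algebra.TensorProduct.includeLeft_apply,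
    Algebra.TensorProduct.includeRight_apply, hcancel, mul_add, add_mul]
  abel

end IsDoubleBracket

end TripleBracket

section QuasiPoisson

variable {k : Type*} [Field k]

section General

variable {A : Type*} [Ring A] [Algebra k A]

/-- The inner derivation `a ↦ l a * m - m * r a` defined by `m`. -/
def innerDer {M : Type*} [Ring M] [Algebra k M] (l r : A →ₐ[k] M) (m : M) : A →ₗ[k] M :=
  LinearMap.mulRight k m ∘ₗ l.toLinearMap - LinearMap.mulLeft k m ∘ₗ r.toLinearMap

theorem isDer_innerDer {M : Type*} [Ring M] [Algebra k M] (l r : A →ₐ[k] M) (m : M) :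
    IsDer l r (innerDer l r m) := fun a b => by
  simp only [innerDer, LinearMap.sub_apply, LinearMap.comp_apply, AlgHom.toLinearMap_apply,
    LinearMap.mulRight_apply, LinearMap.mulLeft_apply, map_mul]
  noncomm_ring

/-- The inner double derivation `a ↦ (a ⊗ 1) m - m (1 ⊗ a)`. -/
abbrev innerDoubleDer (m : A ⊗[k] A) : A →ₗ[k] A ⊗[k] A :=
  innerDer includeLeft includeRight m

theorem innerDoubleDer_apply (m : A ⊗[k] A) (a : A) :
    innerDoubleDer m a = (a ⊗ₜ[k] (1 : A)) * m - m * ((1 : A) ⊗ₜ[k] a) := rfl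

/-- The summand for the idempotent `e` in the quasi-Poisson property. -/
def qpSummand (a b c e : A) : A ⊗[k] A ⊗[k] A :=
  (c * e * a) ⊗ₜ[k] (e * b) ⊗ₜ[k] e
      - (c * e * a) ⊗ₜ[k] e ⊗ₜ[k] (b * e)
      - (c * e) ⊗ₜ[k] (a * e * b) ⊗ₜ[k] e
      + (c * e) ⊗ₜ[k] (a * e) ⊗ₜ[k] (b * e)
      - (e * a) ⊗ₜ[k] (e * b) ⊗ₜ[k] (e * c)
      + (e * a) ⊗ₜ[k] e ⊗ₜ[k] (b * e * c)
      + e ⊗ₜ[k] (a * e * b) ⊗ₜ[k] (e * c)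
      - e ⊗ₜ[k] (a * e) ⊗ₜ[k] (b * e * c)

theorem qpSummand_rotate (a b c e : A) :
    qpSummand (k := k) a b c e = tau (qpSummand b c a e) := by
  simp only [qpSummand, map_add, map_sub, tau_tmul]
  abel

/-- The element `m` for which `qpSummand a b c e` is the commutator of `c` with `m`, for the outer
bimodule structure. -/
def qpHalf (a b e : A) : A ⊗[k] A ⊗[k] A :=
  (e * a) ⊗ₜ[k] (e * b) ⊗ₜ[k] e - (e * a) ⊗ₜ[k] e ⊗ₜ[k] (b * e)
    - e ⊗ₜ[k] (a * e * b) ⊗ₜ[k] e + e ⊗ₜ[k] (a * e) ⊗ₜ[k] (b * e)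

theorem qpSummand_eq (a b c e : A) : qpSummand (k := k) a b c e =
    (c ⊗ₜ[k] (1 : A) ⊗ₜ[k] (1 : A)) * qpHalf a b e
      - qpHalf a b e * ((1 : A) ⊗ₜ[k] (1 : A) ⊗ₜ[k] c) := by
  simp only [qpSummand, qpHalf, mul_add, mul_sub, add_mul, sub_mul,
    Algebra.TensorProduct.tmul_mul_tmul, one_mul, mul_one, mul_assoc]
  abel

/-- The right-hand side of the quasi-Poisson property, as a linear map in its last argument. -/
def qpLin {I : Type*} [Fintype I] (e : I → A) (a b : A) : A →ₗ[k] A ⊗[k] A ⊗[k] A :=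
  (1 / 4 : k) • innerDer (includeLeft.comp includeLeft) includeRight (∑ s, qpHalf a b (e s))

theorem qpLin_apply {I : Type*} [Fintype I] (e : I → A) (a b c : A) :
    qpLin (k := k) e a b c = (1 / 4 : k) • ∑ s, qpSummand a b c (e s) := by
  simp [qpLin, innerDer, qpSummand_eq, Algebra.TensorProduct.one_def, Finset.mul_sum,
    Finset.sum_mul]

theorem qpLin_rotate {I : Type*} [Fintype I] (e : I → A) (a b c : A) :
    qpLin (k := k) e a b c = tau (qpLin e b c a) := by
  simp only [qpLin_apply, map_smul, map_sum, ← qpSummand_rotate]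

theorem qpSummand_self (a b : A) {e : A} (he : IsIdempotentElem e) :
    qpSummand (k := k) a b e e = 0 := by
  simp only [qpSummand, mul_assoc, he.eq]
  abel

theorem qpSummand_of_mul_eq_zero (a b : A) {c e : A} (hce : c * e = 0) (hec : e * c = 0) :
    qpSummand (k := k) a b c e = 0 := by
  simp [qpSummand, mul_assoc b, hce, hec]

end General

variable {I E : Type*} [Fintype I] {Q : FinQuiver I E}

theorem qpLin_idem (a b : AQ k Q) (s : I) : qpLin (k := k) (idem k Q) a b (idem k Q s) = 0 := by
  rw [qpLin_apply, Finset.sum_eq_zero, smul_zero]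
  intro s' _
  rcases eq_or_ne s s' with rfl | hs
  · exact qpSummand_self a b (idem_mul_self s)
  · exact qpSummand_of_mul_eq_zero a b (idem_mul_of_ne hs) (idem_mul_of_ne hs.symm)

-- Both sides are derivations in the last argument, and invariant under cyclic rotation of the
-- three arguments.
theorem isDoubleQuasiPoisson_of_arr {br : AQ k Q →ₗ[k] AQ k Q →ₗ[k] AQ k Q ⊗[k] AQ k Q}
    (h : IsDoubleBracket br) (hB : IsBLinear (idem k Q) br)
    (harr : ∀ a b c, tripleBracket br (arr k Q a) (arr k Q b) (arr k Q c) =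
      (1 / 4 : k) • ∑ s, qpSummand (arr k Q a) (arr k Q b) (arr k Q c) (idem k Q s)) :
    IsDoubleQuasiPoisson (idem k Q) br := by
  have hidem (a b s) : tripleLin br a b (idem k Q s) = 0 := by
    have : br (idem k Q s) = 0 := LinearMap.ext fun x => (hB s x).1
    simp [tripleLin_apply, tripleBracket, (hB s _).2, this]
  have hext (a b) (hp : ∀ p, tripleLin br a b (arr k Q p) = qpLin (idem k Q) a b (arr k Q p)) :
      tripleLin br a b = qpLin (idem k Q) a b :=
    (h.isDer_tripleLin a b).ext ((isDer_innerDer _ _ _).smul _)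
      (fun s => (hidem a b s).trans (qpLin_idem a b s).symm) hp
  have hrotate (a b c) (heq : tripleLin br a b = qpLin (idem k Q) a b) :
      tripleLin br c a b = qpLin (idem k Q) c a b := by
    rw [tripleLin_apply, tripleBracket_rotate, ← tripleLin_apply, heq, ← qpLin_rotate]
  have arr_arr (p q) : tripleLin br (arr k Q p) (arr k Q q) = qpLin (idem k Q) _ _ :=
    hext _ _ fun r => by rw [tripleLin_apply, qpLin_apply, harr]
  have any_arr (a p) : tripleLin br a (arr k Q p) = qpLin (idem k Q) _ _ :=
    hext _ _ fun q => hrotate _ _ _ (arr_arr p q)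
  have any_any (a b) : tripleLin br a b = qpLin (idem k Q) _ _ :=
    hext _ _ fun p => hrotate _ _ _ (any_arr b p)
  exact ⟨h, hB, fun a b c => by rw [← tripleLin_apply, any_any, qpLin_apply]; rfl⟩

end QuasiPoisson

/-! ### The quasi-Poisson property on arrows -/

section ArrowEnds

variable {E : Type*}

/-- The two ends of an arrow of the double quiver, both encoded as an arrow which starts there:
`true` is the tail of `p`, `false` is its head. -/
def arrowEnd (p : E ⊕ E) : Bool → E ⊕ E
  | true => p
  | false => p.swap

/-- The sign of an end of an arrow. -/
def endSign (k : Type*) [Field k] : Bool → k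
  | true => 1
  | false => -1

variable {A : Type*} [Ring A]

/-- The part of the arrow `x` which one meets before its end `i`. -/
def beforeEnd (x : A) : Bool → A
  | true => 1
  | false => x

/-- The part of the arrow `x` which one meets after its end `i`. -/
def afterEnd (x : A) : Bool → A
  | true => x
  | false => 1

variable {k : Type*} [Field k] [Algebra k A]

/-- The term of `qpSummand a b c e` which belongs to the ends `i`, `j`, `l` of `a`, `b`, `c`. -/
def endTerm (a b c : A) (i j l : Bool) (e : A) : A ⊗[k] A ⊗[k] A :=
  -(endSign k i * endSign k j * endSign k l) •
    ((beforeEnd c l * e * afterEnd a i) ⊗ₜ[k] (beforeEnd a i * e * afterEnd b j)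
      ⊗ₜ[k] (beforeEnd b j * e * afterEnd c l))

theorem qpSummand_eq_sum_endTerm (a b c e : A) :
    qpSummand (k := k) a b c e = ∑ i, ∑ j, ∑ l, endTerm a b c i j l e := by
  simp only [Fintype.sum_bool, endTerm, endSign, beforeEnd, afterEnd, one_mul, mul_one, qpSummand]
  module

theorem tau_endTerm (a b c : A) (i j l : Bool) (e : A) :
    tau (endTerm (k := k) b c a j l i e) = endTerm a b c i j l e := by
  simp only [endTerm, map_smul, tau_tmul]
  congr 2
  ring

end ArrowEnds

section FormPart

variable {k : Type*} [Field k] {I E : Type*} [Fintype I] {Q : FinQuiver I E}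
variable {O : E ⊕ E → E ⊕ E → k}
variable {br U : AQ k Q →ₗ[k] AQ k Q →ₗ[k] AQ k Q ⊗[k] AQ k Q}

local notation "𝐞" => idem k Q
local notation "𝐱" => arr k Q
local notation "𝐭" => FinQuiver.t (FinQuiver.double Q)

theorem beforeEnd_mul_idem_eq_zero_or {p : E ⊕ E} {i : Bool} {s : I}
    (h : s ≠ 𝐭 (arrowEnd p i)) :
    beforeEnd (𝐱 p) i * 𝐞 s = 0 ∨ 𝐞 s * afterEnd (𝐱 p) i = 0 :=
  match i with
  | false => .inl (arr_mul_idem_of_ne h)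
  | true => .inr (idem_mul_arr_of_ne h)

theorem endTerm_idem_of_ne (b c : AQ k Q) {p : E ⊕ E} {i : Bool} {s : I}
    (h : s ≠ 𝐭 (arrowEnd p i)) (j l : Bool) : endTerm (k := k) (𝐱 p) b c i j l (𝐞 s) = 0 := by
  rcases beforeEnd_mul_idem_eq_zero_or (k := k) h with h | h <;> simp [endTerm, mul_assoc, h]

/-- The contribution of `x = {{a, b}}` to the value of `{{a, -}} ⊗ 1` on the bracket of `b` and `c`
defined by the form `O`. -/
def formTermFst (O : E ⊕ E → E ⊕ E → k) (b c : E ⊕ E) (x : AQ k Q ⊗[k] AQ k Q) :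
    AQ k Q ⊗[k] AQ k Q ⊗[k] AQ k Q :=
  (1 / 2 : k) • (O b c.swap • (((𝐱 c ⊗ₜ[k] (1 : AQ k Q)) * x) ⊗ₜ[k] 𝐞 (𝐭 b))
    - O b c • (x ⊗ₜ[k] (𝐞 (𝐭 b) * 𝐱 c)))

/-- The contribution of `x = {{a, c}}` to the value of `{{a, -}} ⊗ 1` on the bracket of `b` and `c`
defined by the form `O`. -/
def formTermSnd (O : E ⊕ E → E ⊕ E → k) (b c : E ⊕ E) (x : AQ k Q ⊗[k] AQ k Q) :
    AQ k Q ⊗[k] AQ k Q ⊗[k] AQ k Q :=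
  (1 / 2 : k) • (O b c.swap • ((x * ((1 : AQ k Q) ⊗ₜ[k] 𝐱 b)) ⊗ₜ[k] 𝐞 (𝐭 c.swap))
    - O b.swap c.swap • (x ⊗ₜ[k] (𝐱 b * 𝐞 (𝐭 c.swap))))

theorem arrowBracket_zero (hO : IsTailForm Q O) (a b : E ⊕ E) : arrowBracket Q O 0 a b =
    (1 / 2 : k) • (O a b.swap • ((𝐱 b * 𝐱 a) ⊗ₜ[k] 𝐞 (𝐭 b.swap))
      - O a.swap b.swap • (𝐱 b ⊗ₜ[k] (𝐱 a * 𝐞 (𝐭 b.swap)))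
      - O a b • ((𝐞 (𝐭 b) * 𝐱 a) ⊗ₜ[k] 𝐱 b)
      + O a.swap b • (𝐞 (𝐭 b) ⊗ₜ[k] (𝐱 a * 𝐱 b))) := by
  have tail_head : O a b.swap • ((𝐱 b * 𝐱 a) ⊗ₜ[k] 𝐞 (𝐭 b.swap)) =
      O a b.swap • ((𝐱 b * 𝐱 a) ⊗ₜ[k] 𝐞 (𝐭 a)) := hO.smul_congr fun h => by rw [h]
  have head_head : O a.swap b.swap • (𝐱 b ⊗ₜ[k] (𝐱 a * 𝐞 (𝐭 b.swap))) =
      O a.swap b.swap • (𝐱 b ⊗ₜ[k] 𝐱 a) := hO.smul_congr fun h => by rw [← h, arr_mul_idem]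
  have tail_tail : O a b • ((𝐞 (𝐭 b) * 𝐱 a) ⊗ₜ[k] 𝐱 b) = O a b • (𝐱 a ⊗ₜ[k] 𝐱 b) :=
    hO.smul_congr fun h => by rw [← h, idem_mul_arr]
  have head_tail : O a.swap b • (𝐞 (𝐭 b) ⊗ₜ[k] (𝐱 a * 𝐱 b)) =
      O a.swap b • (𝐞 (𝐭 a.swap) ⊗ₜ[k] (𝐱 a * 𝐱 b)) := hO.smul_congr fun h => by rw [h]
  rw [tail_head, head_head, tail_tail, head_tail, arrowBracket_eq hO]
  simp only [Pi.zero_apply, zero_smul, ite_self, add_zero]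
  module

theorem rTensor_form (hO : IsTailForm Q O) (hU : IsFormBracket Q O 0 U)
    (hb : IsDoubleBracket br) (hB : IsBLinear (idem k Q) br) (a b c : E ⊕ E) :
    (br (𝐱 a)).rTensor _ (U (𝐱 b) (𝐱 c)) =
      formTermSnd O b c (br (𝐱 a) (𝐱 c)) + formTermFst O b c (br (𝐱 a) (𝐱 b)) := by
  have tail_head (x : AQ k Q ⊗[k] AQ k Q) :
      O b c.swap • (x ⊗ₜ[k] 𝐞 (𝐭 c.swap)) = O b c.swap • (x ⊗ₜ[k] 𝐞 (𝐭 b)) :=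
    hO.smul_congr fun h => by rw [h]
  have head_head (x : AQ k Q ⊗[k] AQ k Q) : O b.swap c.swap • (x ⊗ₜ[k] (𝐱 b * 𝐞 (𝐭 c.swap))) =
      O b.swap c.swap • (x ⊗ₜ[k] 𝐱 b) := hO.smul_congr fun h => by rw [← h, arr_mul_idem]
  have tail_tail (x : AQ k Q ⊗[k] AQ k Q) :
      O b c • (x ⊗ₜ[k] (𝐞 (𝐭 b) * 𝐱 c)) = O b c • (x ⊗ₜ[k] 𝐱 c) :=
    hO.smul_congr fun h => by rw [h, idem_mul_arr]
  rw [hU.arr_arr, arrowBracket_eq hO, formTermSnd, formTermFst, tail_head, head_head, tail_tail]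
  simp only [Pi.zero_apply, zero_smul, ite_self, add_zero, map_add, map_sub, map_smul,
    LinearMap.rTensor_tmul, hb.deriv, (hB _ _).2, TensorProduct.zero_tmul, smul_zero,
    TensorProduct.add_tmul]
  module

theorem formTermSnd_add_tau_formTermFst (hO : IsTailForm Q O) (hU : IsFormBracket Q O 0 U)
    (a b c : E ⊕ E) :
    formTermSnd O b c (U (𝐱 a) (𝐱 c)) + tau (formTermFst O c a (U (𝐱 b) (𝐱 c))) =
      -(1 / 4 : k) • ∑ i, ∑ j, ∑ l,
        (O (arrowEnd b j) (arrowEnd c l) * O (arrowEnd c l) (arrowEnd a i)) •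
          endTerm (𝐱 a) (𝐱 b) (𝐱 c) i j l (𝐞 (𝐭 (arrowEnd c l))) := by
  have hquarter : (1 / 4 : k) = 1 / 2 * (1 / 2) := by rw [div_mul_div_comm]; norm_num
  rw [hU.arr_arr, hU.arr_arr, arrowBracket_zero hO, arrowBracket_zero hO, formTermSnd, formTermFst,
    hO.antisymm a, hO.antisymm a.swap, hO.antisymm a c, hO.antisymm a.swap c, hquarter]
  simp only [Fintype.sum_bool, arrowEnd, endTerm, endSign, beforeEnd, afterEnd]
  simp only [mul_add, add_mul, mul_sub, sub_mul, mul_smul_comm, smul_mul_assoc,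
    Algebra.TensorProduct.tmul_mul_tmul, one_mul, mul_one, TensorProduct.add_tmul,
    TensorProduct.sub_tmul, ← TensorProduct.smul_tmul', map_add, map_sub, map_smul, tau_tmul,
    arr_mul_idem, idem_mul_arr, mul_assoc]
  module

/-- A form with the quadratic relation satisfied by the ordering function of a total order. -/
structure IsOrderForm (Q : FinQuiver I E) (O : E ⊕ E → E ⊕ E → k) : Prop extends
    IsTailForm Q O where
  quadratic : ∀ p q r, Q.double.t p = Q.double.t q → Q.double.t q = Q.double.t r →
    ¬(p = q ∧ q = r) → O p q * O q r + O q r * O r p + O r p * O p q = -1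

open Classical in
theorem IsOrderForm.smul_add_smul_add_smul {M : Type*} [AddCommGroup M] [Module k M]
    (hO : IsOrderForm Q O) (p q r : E ⊕ E) (f : I → M)
    (hp : ∀ s, s ≠ 𝐭 p → f s = 0) (hq : ∀ s, s ≠ 𝐭 q → f s = 0) (hr : ∀ s, s ≠ 𝐭 r → f s = 0) :
    (O q r * O r p) • f (𝐭 r) + (O r p * O p q) • f (𝐭 p) + (O p q * O q r) • f (𝐭 q) =
      -∑ s, f s + if p = q ∧ q = r then f (𝐭 p) else 0 := by
  by_cases h : 𝐭 p = 𝐭 q ∧ 𝐭 q = 𝐭 r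
  · rw [Finset.sum_eq_single (𝐭 p) (fun s _ => hp s) (by simp), ← h.2, ← h.1, ← add_smul,
      ← add_smul]
    by_cases hpqr : p = q ∧ q = r
    · obtain ⟨rfl, rfl⟩ := hpqr
      simp [hO.self]
    · have hquadratic : O q r * O r p + O r p * O p q + O p q * O q r = -1 := by
        linear_combination hO.quadratic p q r h.1 h.2 hpqr
      rw [if_neg hpqr, hquadratic, neg_one_smul, add_zero]
  · have hf (s) : f s = 0 := by
      by_contra hs
      have htp := not_imp_comm.1 (hp s) hs
      have htq := not_imp_comm.1 (hq s) hs
      have htr := not_imp_comm.1 (hr s) hs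
      exact h ⟨htp.symm.trans htq, htq.symm.trans htr⟩
    simp [hf]

variable (k Q) in
open Classical in
/-- The terms of the quasi-Poisson property for the arrows `a`, `b`, `c` where three of their ends
coincide. -/
def diagonalTerm (a b c : E ⊕ E) : AQ k Q ⊗[k] AQ k Q ⊗[k] AQ k Q :=
  ∑ i, ∑ j, ∑ l, if arrowEnd a i = arrowEnd b j ∧ arrowEnd b j = arrowEnd c l then
    endTerm (𝐱 a) (𝐱 b) (𝐱 c) i j l (𝐞 (𝐭 (arrowEnd a i))) else 0

theorem diagonalTerm_rotate (a b c : E ⊕ E) :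
    diagonalTerm k Q a b c = tau (diagonalTerm k Q b c a) := by
  classical
  simp only [diagonalTerm, map_sum, apply_ite tau, map_zero, tau_endTerm]
  refine Eq.trans ?_ Finset.sum_comm_cycle.symm
  refine Fintype.sum_congr _ _ fun i => Fintype.sum_congr _ _ fun j => Fintype.sum_congr _ _
    fun l => if_ctx_congr ⟨fun h => ⟨h.2, by rw [h.1, h.2]⟩, fun h => ⟨by rw [h.1, h.2], h.1⟩⟩
      (fun h => ?_) fun _ => rfl
  rw [h.1, h.2]

theorem tripleBracket_form_eq_sum (hO : IsTailForm Q O) (hU : IsFormBracket Q O 0 U)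
    (a b c : E ⊕ E) : tripleBracket U (𝐱 a) (𝐱 b) (𝐱 c) =
      -(1 / 4 : k) • ∑ i, ∑ j, ∑ l,
        ((O (arrowEnd b j) (arrowEnd c l) * O (arrowEnd c l) (arrowEnd a i)) •
          endTerm (𝐱 a) (𝐱 b) (𝐱 c) i j l (𝐞 (𝐭 (arrowEnd c l)))
        + (O (arrowEnd c l) (arrowEnd a i) * O (arrowEnd a i) (arrowEnd b j)) •
          endTerm (𝐱 a) (𝐱 b) (𝐱 c) i j l (𝐞 (𝐭 (arrowEnd a i)))
        + (O (arrowEnd a i) (arrowEnd b j) * O (arrowEnd b j) (arrowEnd c l)) •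
          endTerm (𝐱 a) (𝐱 b) (𝐱 c) i j l (𝐞 (𝐭 (arrowEnd b j)))) := by
  have hr := rTensor_form hO hU hU.isDoubleBracket hU.isBLinear
  have h := formTermSnd_add_tau_formTermFst hO hU
  calc tripleBracket U (𝐱 a) (𝐱 b) (𝐱 c) =
        (formTermSnd O b c (U (𝐱 a) (𝐱 c)) + tau (formTermFst O c a (U (𝐱 b) (𝐱 c))))
        + tau (formTermSnd O c a (U (𝐱 b) (𝐱 a)) + tau (formTermFst O a b (U (𝐱 c) (𝐱 a))))
        + tau (tau (formTermSnd O a b (U (𝐱 c) (𝐱 b))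
          + tau (formTermFst O b c (U (𝐱 a) (𝐱 b))))) := by
          simp only [tripleBracket, hr a b c, hr b c a, hr c a b, map_add, tau_tau_tau]
          abel
    _ = _ := by
          rw [h a b c, h b c a, h c a b]
          simp only [map_smul, tau_endTerm, Fintype.sum_bool, map_add]
          module

theorem tripleBracket_form (hO : IsOrderForm Q O) (hU : IsFormBracket Q O 0 U)
    (a b c : E ⊕ E) : tripleBracket U (𝐱 a) (𝐱 b) (𝐱 c) =
      (1 / 4 : k) • ∑ s, qpSummand (𝐱 a) (𝐱 b) (𝐱 c) (𝐞 s)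
        - (1 / 4 : k) • diagonalTerm k Q a b c := by
  have hsum (i j l) := hO.smul_add_smul_add_smul (arrowEnd a i) (arrowEnd b j) (arrowEnd c l)
    (fun s => endTerm (𝐱 a) (𝐱 b) (𝐱 c) i j l (𝐞 s)) (fun s h => endTerm_idem_of_ne _ _ h _ _)
    (fun s h => by rw [← tau_endTerm, endTerm_idem_of_ne _ _ h, map_zero])
    (fun s h => by rw [← tau_endTerm, ← tau_endTerm, endTerm_idem_of_ne _ _ h, map_zero, map_zero])
  rw [tripleBracket_form_eq_sum hO.toIsTailForm hU, diagonalTerm]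
  have hqp : ∑ s, qpSummand (𝐱 a) (𝐱 b) (𝐱 c) (𝐞 s) =
      ∑ i, ∑ j, ∑ l, ∑ s, endTerm (k := k) (𝐱 a) (𝐱 b) (𝐱 c) i j l (𝐞 s) := by
    simp only [qpSummand_eq_sum_endTerm]
    rw [Finset.sum_comm]
    exact Finset.sum_congr rfl fun i _ => Finset.sum_comm_cycle.symm
  simp only [hsum, Finset.sum_add_distrib, Finset.sum_neg_distrib, hqp]
  module

end FormPart

section PairPart

variable {k : Type*} [Field k] {I E : Type*} {Q : FinQuiver I E}

variable (k Q) in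
theorem isTailForm_zero : IsTailForm Q (0 : E ⊕ E → E ⊕ E → k) :=
  ⟨fun _ => rfl, fun _ _ => neg_zero.symm, fun _ _ _ => rfl⟩

theorem swap_ne (p : E ⊕ E) : p.swap ≠ p := by
  cases p <;> simp

theorem swap_eq_iff {p q : E ⊕ E} : p.swap = q ↔ p = q.swap :=
  Function.Involutive.eq_iff Sum.swap_swap

theorem eq_or_eq_swap_of_arrowEnd_eq {p q : E ⊕ E} {i j : Bool} (h : arrowEnd p i = arrowEnd q j) :
    q = p ∨ q = p.swap := by
  cases i <;> cases j <;> cases p <;> cases q <;> simp_all [arrowEnd]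

variable [Fintype I] {O : E ⊕ E → E ⊕ E → k} {η : E ⊕ E → k}
variable {br U V : AQ k Q →ₗ[k] AQ k Q →ₗ[k] AQ k Q ⊗[k] AQ k Q}

local notation "𝐞" => idem k Q
local notation "𝐱" => arr k Q
local notation "𝐭" => FinQuiver.t (FinQuiver.double Q)

theorem arr_swap_mul_idem_mul (p : E ⊕ E) (y : AQ k Q) :
    𝐱 p.swap * (𝐞 (𝐭 p) * y) = 𝐱 p.swap * y := by
  rw [← mul_assoc, arr_swap_mul_idem]

theorem gaugeTerm_add (O O' : E ⊕ E → E ⊕ E → k) (c p : E ⊕ E) :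
    gaugeTerm Q (O + O') c p = gaugeTerm Q O c p + gaugeTerm Q O' c p := by
  simp only [gaugeTerm, Pi.add_apply]
  module

theorem arrowBracket_add (O O' : E ⊕ E → E ⊕ E → k) (η η' : E ⊕ E → k) (c b : E ⊕ E) :
    arrowBracket Q (O + O') (η + η') c b = arrowBracket Q O η c b + arrowBracket Q O' η' c b := by
  simp only [arrowBracket, gaugeTerm_add, mul_add, add_mul, Pi.add_apply]
  split_ifs <;> module

theorem IsFormBracket.add {O' : E ⊕ E → E ⊕ E → k} {η' : E ⊕ E → k}
    (hU : IsFormBracket Q O η U) (hV : IsFormBracket Q O' η' V) :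
    IsFormBracket Q (O + O') (η + η') (U + V) where
  isDoubleBracket :=
    { antisymm a b := by
        rw [LinearMap.add_apply, LinearMap.add_apply, hU.isDoubleBracket.antisymm a b,
          hV.isDoubleBracket.antisymm a b, LinearMap.add_apply, LinearMap.add_apply, map_add,
          neg_add]
      deriv a b c := by
        simp only [LinearMap.add_apply, hU.isDoubleBracket.deriv, hV.isDoubleBracket.deriv,
          mul_add, add_mul]
        abel }
  isBLinear s a := by
    simp [(hU.isBLinear s a).1, (hV.isBLinear s a).1, (hU.isBLinear s a).2, (hV.isBLinear s a).2]
  arr_arr p q := by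
    rw [LinearMap.add_apply, LinearMap.add_apply, hU.arr_arr, hV.arr_arr, arrowBracket_add]

open Classical in
theorem IsFormBracket.pair_arr_arr (hV : IsFormBracket Q 0 η V) (b c : E ⊕ E) :
    V (𝐱 b) (𝐱 c) = if c = b.swap then η b • pairTerm k Q b else 0 := by
  rw [hV.arr_arr, arrowBracket_eq (isTailForm_zero k Q)]
  simp

theorem rTensor_pairTerm (hb : IsDoubleBracket br) (hB : IsBLinear (idem k Q) br) (a : AQ k Q)
    (b : E ⊕ E) : (br a).rTensor _ (pairTerm k Q b) = (1 / 2 : k) •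
      ((br a (𝐱 b.swap) * ((1 : AQ k Q) ⊗ₜ[k] 𝐱 b)
        + (𝐱 b.swap ⊗ₜ[k] (1 : AQ k Q)) * br a (𝐱 b)) ⊗ₜ[k] 𝐞 (𝐭 b)) := by
  simp only [pairTerm, map_add, map_smul, LinearMap.rTensor_tmul, (hB _ _).2, hb.deriv,
    TensorProduct.zero_tmul, smul_zero, add_zero, zero_add]

-- The part of the mixed triple bracket where the arrows `b` and `c` are paired by `V`.
theorem rTensor_add_tau_formTermFst_add_tau_tau_formTermSnd (hO : IsTailForm Q O)
    (hη : ∀ p, η p.swap = -η p) (hU : IsFormBracket Q O 0 U) (hV : IsFormBracket Q 0 η V)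
    (a b c : E ⊕ E) :
    (U (𝐱 a)).rTensor _ (V (𝐱 b) (𝐱 c)) + tau (formTermFst O c a (V (𝐱 b) (𝐱 c)))
      + tau (tau (formTermSnd O a b (V (𝐱 c) (𝐱 b)))) = 0 := by
  classical
  rw [hV.pair_arr_arr, hV.pair_arr_arr, formTermFst, formTermSnd]
  obtain rfl | h := eq_or_ne c b.swap
  · rw [if_pos rfl, if_pos b.swap_swap.symm, hη, map_smul,
      rTensor_pairTerm hU.isDoubleBracket hU.isBLinear, hU.arr_arr, hU.arr_arr,
      arrowBracket_zero hO, arrowBracket_zero hO, hO.antisymm b.swap a, hO.antisymm b.swap a.swap]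
    simp only [pairTerm, Sum.swap_swap, mul_add, add_mul, mul_sub, sub_mul, mul_smul_comm,
      smul_mul_assoc, Algebra.TensorProduct.tmul_mul_tmul, one_mul, mul_one,
      TensorProduct.add_tmul, smul_add, smul_sub,
      TensorProduct.sub_tmul, ← TensorProduct.smul_tmul', map_add, map_sub, map_smul, tau_tmul,
      idem_mul_arr, arr_swap_mul_idem, arr_swap_mul_idem_mul, mul_assoc]
    module
  · rw [if_neg h, if_neg fun h' => h (by rw [h', Sum.swap_swap])]
    simp

theorem mixedTriple_add_mixedTriple_eq_zero (hO : IsTailForm Q O) (hη : ∀ p, η p.swap = -η p)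
    (hU : IsFormBracket Q O 0 U) (hV : IsFormBracket Q 0 η V) (a b c : E ⊕ E) :
    mixedTriple U V (𝐱 a) (𝐱 b) (𝐱 c) + mixedTriple V U (𝐱 a) (𝐱 b) (𝐱 c) = 0 := by
  have hV_form := rTensor_form hO hU hV.isDoubleBracket hV.isBLinear
  have hpaired := rTensor_add_tau_formTermFst_add_tau_tau_formTermSnd hO hη hU hV
  calc mixedTriple U V (𝐱 a) (𝐱 b) (𝐱 c) + mixedTriple V U (𝐱 a) (𝐱 b) (𝐱 c) =
        ((U (𝐱 a)).rTensor _ (V (𝐱 b) (𝐱 c)) + tau (formTermFst O c a (V (𝐱 b) (𝐱 c)))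
          + tau (tau (formTermSnd O a b (V (𝐱 c) (𝐱 b)))))
        + tau ((U (𝐱 b)).rTensor _ (V (𝐱 c) (𝐱 a)) + tau (formTermFst O a b (V (𝐱 c) (𝐱 a)))
          + tau (tau (formTermSnd O b c (V (𝐱 a) (𝐱 c)))))
        + tau (tau ((U (𝐱 c)).rTensor _ (V (𝐱 a) (𝐱 b))
          + tau (formTermFst O b c (V (𝐱 a) (𝐱 b)))
          + tau (tau (formTermSnd O c a (V (𝐱 b) (𝐱 a)))))) := by
          simp only [mixedTriple, hV_form a b c, hV_form b c a, hV_form c a b, map_add,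
            tau_tau_tau]
          abel
    _ = 0 := by rw [hpaired, hpaired, hpaired, map_zero, map_zero, add_zero, add_zero]

open Classical in
theorem rTensor_pair (hη : ∀ p, η p.swap = -η p) (hη_sq : ∀ p, η p * η p = 1)
    (hV : IsFormBracket Q 0 η V) (a b c : E ⊕ E) :
    (V (𝐱 a)).rTensor _ (V (𝐱 b) (𝐱 c)) = if c = b.swap then
      ((if a = b then (1 / 2 : k) • ((pairTerm k Q b * ((1 : AQ k Q) ⊗ₜ[k] 𝐱 b)) ⊗ₜ[k] 𝐞 (𝐭 b))
        else 0)
      - if a = b.swap then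
        (1 / 2 : k) • (((𝐱 b.swap ⊗ₜ[k] (1 : AQ k Q)) * pairTerm k Q b.swap) ⊗ₜ[k] 𝐞 (𝐭 b))
        else 0) else 0 := by
  rw [hV.pair_arr_arr]
  obtain rfl | h := eq_or_ne c b.swap
  · rw [if_pos rfl, if_pos rfl, map_smul, rTensor_pairTerm hV.isDoubleBracket hV.isBLinear,
      hV.pair_arr_arr, hV.pair_arr_arr]
    obtain rfl | hab := eq_or_ne a b
    · rw [if_pos rfl, if_neg (swap_ne a).symm, if_pos rfl, if_neg (swap_ne a).symm, mul_zero,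
        add_zero, sub_zero, smul_mul_assoc, ← TensorProduct.smul_tmul',
        smul_comm (η a), smul_smul (η a), hη_sq, one_smul]
    obtain rfl | hab' := eq_or_ne a b.swap
    · rw [if_neg fun h => hab (by simpa using h), if_pos b.swap_swap.symm, if_neg hab, if_pos rfl,
        zero_mul, zero_add, zero_sub, mul_smul_comm, ← TensorProduct.smul_tmul', hη,
        smul_comm (η b), smul_smul (η b), mul_neg, hη_sq, neg_one_smul, smul_neg]
    · rw [if_neg fun h => hab (by rw [← Sum.swap_swap b, h, Sum.swap_swap]),
        if_neg fun h => hab' (by rw [h, Sum.swap_swap]), if_neg hab, if_neg hab']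
      simp
  · rw [if_neg h, if_neg h, map_zero]

theorem diagonalTerm_self (p : E ⊕ E) : diagonalTerm k Q p p p = 0 := by
  classical
  simp only [diagonalTerm, Fintype.sum_bool, arrowEnd, swap_ne, (swap_ne p).symm, and_true,
    and_false, if_true, if_false, endTerm, endSign, beforeEnd, afterEnd, idem_mul_arr,
    arr_mul_idem, one_mul, mul_one]
  module

theorem diagonalTerm_self_self_swap (p : E ⊕ E) : diagonalTerm k Q p p p.swap =
    (𝐱 p.swap * 𝐱 p) ⊗ₜ[k] 𝐱 p ⊗ₜ[k] 𝐞 (𝐭 p)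
      - 𝐞 (𝐭 p.swap) ⊗ₜ[k] 𝐱 p ⊗ₜ[k] (𝐱 p * 𝐱 p.swap) := by
  classical
  simp only [diagonalTerm, Fintype.sum_bool, arrowEnd, Sum.swap_swap, swap_ne, (swap_ne p).symm,
    and_true, and_false, if_true, if_false, endTerm, endSign, beforeEnd, afterEnd, idem_mul_arr,
    arr_mul_idem, arr_swap_mul_idem, one_mul, mul_one]
  module

theorem tripleBracket_pair_self_self_swap (hη : ∀ p, η p.swap = -η p) (hη_sq : ∀ p, η p * η p = 1)
    (hV : IsFormBracket Q 0 η V) (p : E ⊕ E) :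
    tripleBracket V (𝐱 p) (𝐱 p) (𝐱 p.swap) = (1 / 4 : k) • diagonalTerm k Q p p p.swap := by
  have hquarter : (1 / 4 : k) = 1 / 2 * (1 / 2) := by rw [div_mul_div_comm]; norm_num
  rw [diagonalTerm_self_self_swap, tripleBracket, rTensor_pair hη hη_sq hV,
    rTensor_pair hη hη_sq hV, rTensor_pair hη hη_sq hV, hquarter]
  simp only [pairTerm, Sum.swap_swap, swap_ne, (swap_ne p).symm, if_true, if_false,
    mul_add, add_mul, mul_smul_comm, smul_mul_assoc, Algebra.TensorProduct.tmul_mul_tmul,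
    one_mul, mul_one, TensorProduct.add_tmul, smul_add, map_zero, ← TensorProduct.smul_tmul',
    map_add, map_sub, map_smul, tau_tmul, arr_mul_idem, idem_mul_arr, arr_swap_mul_idem, mul_assoc]
  module

theorem diagonalTerm_eq_zero {a b c : E ⊕ E} (h : ¬((b = a ∨ b = a.swap) ∧ (c = a ∨ c = a.swap))) :
    diagonalTerm k Q a b c = 0 := by
  rw [diagonalTerm]
  refine Finset.sum_eq_zero fun i _ => Finset.sum_eq_zero fun j _ => Finset.sum_eq_zero fun l _ =>
    if_neg fun ⟨hij, hjl⟩ => h ⟨eq_or_eq_swap_of_arrowEnd_eq hij,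
      eq_or_eq_swap_of_arrowEnd_eq (hij.trans hjl)⟩

theorem tripleBracket_pair_eq_zero (hη : ∀ p, η p.swap = -η p) (hη_sq : ∀ p, η p * η p = 1)
    (hV : IsFormBracket Q 0 η V) {a b c : E ⊕ E}
    (h : ¬((b = a ∨ b = a.swap) ∧ (c = a ∨ c = a.swap))) :
    tripleBracket V (𝐱 a) (𝐱 b) (𝐱 c) = 0 := by
  classical
  have hswap (p q : E ⊕ E) : p = q.swap ↔ q = p.swap :=
    swap_eq_iff.symm.trans eq_comm
  rw [tripleBracket, rTensor_pair hη hη_sq hV, rTensor_pair hη hη_sq hV, rTensor_pair hη hη_sq hV]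
  grind

theorem tripleBracket_pair (hη : ∀ p, η p.swap = -η p) (hη_sq : ∀ p, η p * η p = 1)
    (hV : IsFormBracket Q 0 η V) (a b c : E ⊕ E) :
    tripleBracket V (𝐱 a) (𝐱 b) (𝐱 c) = (1 / 4 : k) • diagonalTerm k Q a b c := by
  have hbase := tripleBracket_pair_self_self_swap hη hη_sq hV
  have hrotate {a b c : E ⊕ E}
      (h : tripleBracket V (𝐱 b) (𝐱 c) (𝐱 a) = (1 / 4 : k) • diagonalTerm k Q b c a) :
      tripleBracket V (𝐱 a) (𝐱 b) (𝐱 c) = (1 / 4 : k) • diagonalTerm k Q a b c := by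
    rw [tripleBracket_rotate, h, map_smul, ← diagonalTerm_rotate]
  by_cases h : (b = a ∨ b = a.swap) ∧ (c = a ∨ c = a.swap)
  · obtain ⟨rfl | rfl, rfl | rfl⟩ := h
    · simp [diagonalTerm_self, tripleBracket, rTensor_pair hη hη_sq hV, (swap_ne _).symm]
    · exact hbase _
    · exact hrotate (hrotate (hbase _))
    · refine hrotate ?_
      have := hbase a.swap
      rwa [Sum.swap_swap] at this
  · rw [diagonalTerm_eq_zero h, smul_zero, tripleBracket_pair_eq_zero hη hη_sq hV h]

theorem IsFormBracket.isDoubleQuasiPoisson (hO : IsOrderForm Q O)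
    (hη : ∀ p, η p.swap = -η p) (hη_sq : ∀ p, η p * η p = 1) (h : IsFormBracket Q O η br) :
    IsDoubleQuasiPoisson (idem k Q) br := by
  refine isDoubleQuasiPoisson_of_arr h.isDoubleBracket h.isBLinear fun a b c => ?_
  obtain ⟨U, hU⟩ := exists_isFormBracket (η := 0) hO.toIsTailForm fun _ => neg_zero.symm
  obtain ⟨V, hV⟩ := exists_isFormBracket (isTailForm_zero k Q) hη
  have hUV := hU.add hV
  rw [add_zero, zero_add] at hUV
  rw [h.unique hUV, tripleBracket_add, tripleBracket_form hO hU, tripleBracket_pair hη hη_sq hV,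
    mixedTriple_add_mixedTriple_eq_zero hO.toIsTailForm hη hU hV]
  abel

end PairPart

/-! ### Ordered factors and the moment map -/

section OrderDatum

variable (k : Type*) [Field k] {I E : Type*}

/-- The data which define a quasi-Hamiltonian structure on `A_Q`: signs of the arrows of the double
quiver, and for each vertex `s` a list of the arrows with tail `s`, together with the ordering
form of these lists. -/
@[ext]
structure OrderDatum (Q : FinQuiver I E) where
  form : E ⊕ E → E ⊕ E → k
  sign : E ⊕ E → ℤˣ
  list : I → List (E ⊕ E)
  isTailForm : IsTailForm Q form
  sign_swap : ∀ p, sign p.swap = -sign p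
  mem_list : ∀ s p, p ∈ list s ↔ Q.double.t p = s
  pairwise : ∀ s, (list s).Pairwise fun p q => form p q = 1

open Classical in
/-- The form which is `1` on the diagonal and `0` elsewhere. -/
def diagForm (q p : E ⊕ E) : k := if q = p then 1 else 0

open Classical in
/-- The form of a cut of the list at the vertex `s`, after the elements of `pre`. -/
def cutForm (Q : FinQuiver I E) (s : I) (pre : List (E ⊕ E)) (q _p : E ⊕ E) : k :=
  if Q.double.t q = s then if q ∈ pre then 1 else -1 else 0

variable {k} {Q : FinQuiver I E}

namespace OrderDatum

variable (D : OrderDatum k Q)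

/-- The sign as a scalar. -/
def scalar (p : E ⊕ E) : k := ((D.sign p : ℤ) : k)

theorem scalar_swap (p : E ⊕ E) : D.scalar p.swap = -D.scalar p := by
  simp [scalar, D.sign_swap]

theorem scalar_mul_self (p : E ⊕ E) : D.scalar p * D.scalar p = 1 := by
  rcases Int.units_eq_one_or (D.sign p) with h | h <;> simp [scalar, h]

variable {D} {s : I} {pre l : List (E ⊕ E)} {p q : E ⊕ E}

theorem form_eq_one_of_mem_left (h : D.list s = pre ++ p :: l) (hq : q ∈ pre) :
    D.form q p = 1 := by
  have hpairwise := D.pairwise s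
  rw [h, List.pairwise_append] at hpairwise
  exact hpairwise.2.2 q hq p List.mem_cons_self

theorem form_eq_one_of_mem_right (h : D.list s = pre ++ p :: l) (hq : q ∈ l) :
    D.form p q = 1 := by
  have hpairwise := D.pairwise s
  rw [h, List.pairwise_append, List.pairwise_cons] at hpairwise
  exact hpairwise.2.1.1 q hq

theorem ne_of_form (h : D.form p q = 1) : p ≠ q := by
  rintro rfl
  rw [D.isTailForm.self] at h
  exact zero_ne_one h

variable (D) in
theorem nodup (s : I) : (D.list s).Nodup := (D.pairwise s).imp fun h => ne_of_form h

theorem form_sub_diagForm (h : D.list s = pre ++ p :: l) (q p' : E ⊕ E) :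
    D.form q p - diagForm k q p = cutForm k Q s pre q p' := by
  have hp : Q.double.t p = s := (D.mem_list s p).1 (by simp [h])
  have hp_pre : p ∉ pre := fun hmem => ne_of_form (form_eq_one_of_mem_left h hmem) rfl
  rw [cutForm, diagForm]
  split_ifs with hqp hq hq_pre hq hq_pre
  · exact absurd (hqp ▸ hq_pre) hp_pre
  · rw [hqp, D.isTailForm.self, zero_sub]
  · exact absurd (hqp ▸ hp) hq
  · rw [form_eq_one_of_mem_left h hq_pre, sub_zero]
  · have hq_mem := (D.mem_list s q).2 hq
    rw [h, List.mem_append, List.mem_cons] at hq_mem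
    have hql : q ∈ l := (hq_mem.resolve_left hq_pre).resolve_left hqp
    rw [D.isTailForm.antisymm, form_eq_one_of_mem_right h hql, sub_zero]
  · rw [D.isTailForm.eq_zero q p (by rwa [hp]), sub_zero]

theorem form_add_diagForm (h : D.list s = pre ++ p :: l) (q p' : E ⊕ E) :
    D.form q p + diagForm k q p = cutForm k Q s (pre ++ [p]) q p' := by
  classical
  have hp : Q.double.t p = s := (D.mem_list s p).1 (by simp [h])
  by_cases hqp : q = p
  · rw [hqp, D.isTailForm.self]
    simp [cutForm, diagForm, hp]
  · have hsub := form_sub_diagForm h q p'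
    rw [diagForm, if_neg hqp, sub_zero] at hsub
    rw [diagForm, if_neg hqp, add_zero, hsub, cutForm, cutForm]
    exact if_congr Iff.rfl (if_congr (by simp [hqp]) rfl rfl) rfl

end OrderDatum

variable [Fintype I]

local notation "𝐞" => idem k Q
local notation "𝐱" => arr k Q
local notation "𝐭" => FinQuiver.t (FinQuiver.double Q)

theorem isUnit_sum_mul_of_commute {R : Type*} [Ring R] {e : I → R}
    (he : CompleteOrthogonalIdempotents e) {u : I → Rˣ} (hu : ∀ s, Commute (e s) (u s)) :
    IsUnit (∑ s, e s * u s) := by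
  have hsum (v w : I → R) (hv : ∀ s, Commute (e s) (v s)) (hvw : ∀ s, v s * w s = 1) :
      (∑ s, e s * v s) * ∑ s, e s * w s = 1 := by
    rw [Finset.sum_mul_sum, ← he.complete]
    refine Finset.sum_congr rfl fun s _ => ?_
    have hterm (s') : e s * v s * (e s' * w s') = v s * (e s * e s') * w s' := by
      rw [(hv s).eq]
      simp only [mul_assoc]
    rw [Finset.sum_eq_single s (fun s' _ h => by rw [hterm, he.ortho h.symm, mul_zero, zero_mul])
      (by simp), hterm, he.idem s, ← (hv s).eq, mul_assoc, hvw, mul_one]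
  exact isUnit_iff_exists.2 ⟨∑ s, e s * ↑(u s)⁻¹,
    hsum _ (fun s => ↑(u s)⁻¹) hu fun s => (u s).mul_inv,
    hsum (fun s => ↑(u s)⁻¹) _ (fun s => (hu s).units_inv_right) fun s => (u s).inv_mul⟩

theorem commute_idem_zUnit (p : E ⊕ E) : Commute (𝐞 (𝐭 p)) (zUnit k Q p).val := by
  rw [coe_zUnit, commute_iff_eq, mul_add, add_mul, ← mul_assoc, idem_mul_arr, mul_assoc,
    arr_swap_mul_idem, one_mul, mul_one]

theorem gaugeTerm_congr {O O' : E ⊕ E → E ⊕ E → k} {c p p' : E ⊕ E} (h : O c p = O' c p')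
    (h' : O c.swap p = O' c.swap p') : gaugeTerm Q O c p = gaugeTerm Q O' c p' := by
  rw [gaugeTerm, gaugeTerm, h, h']

theorem gaugeTerm_neg (O : E ⊕ E → E ⊕ E → k) (c p : E ⊕ E) :
    gaugeTerm Q (-O) c p = -gaugeTerm Q O c p := by
  simp only [gaugeTerm, Pi.neg_apply]
  module

theorem gaugeTerm_diagForm_self (c : E ⊕ E) :
    gaugeTerm Q (diagForm k) c c = (1 / 2 : k) • (𝐱 c ⊗ₜ[k] 𝐞 (𝐭 c)) := by
  simp [gaugeTerm, diagForm, swap_ne]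

theorem gaugeTerm_diagForm_swap (c : E ⊕ E) :
    gaugeTerm Q (diagForm k) c c.swap = -((1 / 2 : k) • (𝐞 (𝐭 c.swap) ⊗ₜ[k] 𝐱 c)) := by
  simp [gaugeTerm, diagForm, (swap_ne c).symm]

theorem gaugeTerm_diagForm_of_ne {c p : E ⊕ E} (h : c ≠ p) (h' : c.swap ≠ p) :
    gaugeTerm Q (diagForm k) c p = 0 := by
  simp [gaugeTerm, diagForm, h, h']

theorem arr_mul_pairTerm [NeZero (2 : k)] (c : E ⊕ E) :
    (𝐱 c ⊗ₜ[k] (1 : AQ k Q)) * pairTerm k Q c =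
      ((zUnit k Q c).val ⊗ₜ[k] (1 : AQ k Q)) * gaugeTerm Q (diagForm k) c c
        + gaugeTerm Q (diagForm k) c c * ((1 : AQ k Q) ⊗ₜ[k] (zUnit k Q c).val) := by
  simp only [gaugeTerm_diagForm_self, coe_zUnit, pairTerm, mul_add, add_mul, mul_smul_comm,
    smul_mul_assoc, Algebra.TensorProduct.tmul_mul_tmul, one_mul, mul_one, TensorProduct.add_tmul,
    TensorProduct.tmul_add, arr_mul_idem, idem_mul_arr, ← mul_assoc]
  linear_combination (norm := module) (-add_halves (1 : k)) • (𝐱 c ⊗ₜ[k] 𝐞 (𝐭 c))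

theorem pairTerm_mul_arr [NeZero (2 : k)] (c : E ⊕ E) :
    pairTerm k Q c * ((1 : AQ k Q) ⊗ₜ[k] 𝐱 c) =
      -(((zUnit k Q c.swap).val ⊗ₜ[k] (1 : AQ k Q)) * gaugeTerm Q (diagForm k) c c.swap
        + gaugeTerm Q (diagForm k) c c.swap *
          ((1 : AQ k Q) ⊗ₜ[k] (zUnit k Q c.swap).val)) := by
  simp only [gaugeTerm_diagForm_swap, coe_zUnit, pairTerm, Sum.swap_swap, mul_add, add_mul,
    mul_smul_comm, smul_mul_assoc, Algebra.TensorProduct.tmul_mul_tmul, one_mul, mul_one,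
    TensorProduct.add_tmul, TensorProduct.tmul_add, arr_mul_idem, idem_mul_arr,
    mul_assoc, mul_neg, neg_mul]
  linear_combination (norm := module) (-add_halves (1 : k)) • (𝐞 (𝐭 c.swap) ⊗ₜ[k] 𝐱 c)

variable {br : AQ k Q →ₗ[k] AQ k Q →ₗ[k] AQ k Q ⊗[k] AQ k Q} {O : E ⊕ E → E ⊕ E → k}
variable {η : E ⊕ E → k}

open Classical in
theorem ite_pairTerm_mul_arr_add_arr_mul_ite_pairTerm [NeZero (2 : k)]
    (hη : ∀ p, η p.swap = -η p) (c p : E ⊕ E) :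
    (if p = c.swap then η c • pairTerm k Q c else 0) * ((1 : AQ k Q) ⊗ₜ[k] 𝐱 p.swap)
      + (𝐱 p ⊗ₜ[k] (1 : AQ k Q)) * (if p.swap = c.swap then η c • pairTerm k Q c else 0) =
      η p • (((zUnit k Q p).val ⊗ₜ[k] (1 : AQ k Q)) * gaugeTerm Q (diagForm k) c p
        + gaugeTerm Q (diagForm k) c p * ((1 : AQ k Q) ⊗ₜ[k] (zUnit k Q p).val)) := by
  obtain rfl | hp := eq_or_ne p c
  · rw [if_neg (swap_ne p).symm, if_pos rfl, zero_mul, zero_add, mul_smul_comm, arr_mul_pairTerm]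
  obtain rfl | hp' := eq_or_ne p c.swap
  · rw [if_pos rfl, if_neg (by simpa using hp.symm), mul_zero, add_zero, Sum.swap_swap,
      smul_mul_assoc, pairTerm_mul_arr, hη, neg_smul, smul_neg]
  · rw [if_neg hp', if_neg fun h => hp (Sum.swap_leftInverse.injective h),
      gaugeTerm_diagForm_of_ne hp.symm hp'.symm]
    simp

theorem IsFormBracket.arr_zUnit [NeZero (2 : k)] (h : IsFormBracket Q O η br)
    (hη : ∀ p, η p.swap = -η p) (c p : E ⊕ E) :
    br (𝐱 c) (zUnit k Q p).val =
      ((zUnit k Q p).val ⊗ₜ[k] (1 : AQ k Q)) *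
          (gaugeTerm Q O c p + η p • gaugeTerm Q (diagForm k) c p)
        - (gaugeTerm Q O c p - η p • gaugeTerm Q (diagForm k) c p) *
          ((1 : AQ k Q) ⊗ₜ[k] (zUnit k Q p).val) := by
  classical
  have hpair := ite_pairTerm_mul_arr_add_arr_mul_ite_pairTerm (Q := Q) hη c p
  have hleft : (zUnit k Q p).val ⊗ₜ[k] (1 : AQ k Q) =
      1 + (𝐱 p ⊗ₜ[k] (1 : AQ k Q)) * (𝐱 p.swap ⊗ₜ[k] (1 : AQ k Q)) := by
    rw [coe_zUnit, TensorProduct.add_tmul, Algebra.TensorProduct.one_def,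
      Algebra.TensorProduct.tmul_mul_tmul, one_mul]
  have hright : (1 : AQ k Q) ⊗ₜ[k] (zUnit k Q p).val =
      1 + ((1 : AQ k Q) ⊗ₜ[k] 𝐱 p) * ((1 : AQ k Q) ⊗ₜ[k] 𝐱 p.swap) := by
    rw [coe_zUnit, TensorProduct.tmul_add, Algebra.TensorProduct.one_def,
      Algebra.TensorProduct.tmul_mul_tmul, one_mul]
  have hderiv : br (𝐱 c) (zUnit k Q p).val = br (𝐱 c) (𝐱 p) * ((1 : AQ k Q) ⊗ₜ[k] 𝐱 p.swap)
      + (𝐱 p ⊗ₜ[k] (1 : AQ k Q)) * br (𝐱 c) (𝐱 p.swap) := by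
    rw [coe_zUnit, map_add, (h.isDoubleBracket.isDer_right _).map_one, zero_add,
      h.isDoubleBracket.deriv]
  rw [hderiv, h.arr_arr, h.arr_arr, arrowBracket, arrowBracket, Sum.swap_swap]
  rw [hleft, hright] at hpair ⊢
  simp only [mul_add, add_mul, mul_sub, sub_mul, mul_smul_comm, smul_mul_assoc, one_mul, mul_one,
    mul_assoc, smul_add] at hpair ⊢
  linear_combination (norm := abel) hpair

namespace OrderDatum

variable (D : OrderDatum k Q)

/-- The factor `(1 + p p^*)^{ε(p)}` as a unit of `A_Q`. -/
def factor (p : E ⊕ E) : (AQ k Q)ˣ := zUnit k Q p ^ (D.sign p : ℤ)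

/-- The product of the factors at the vertex `s`. -/
def factorProd (s : I) : (AQ k Q)ˣ := ((D.list s).map D.factor).prod

/-- The component `Φ_s` of the moment map. -/
def moment (s : I) : AQ k Q := 𝐞 s * D.factorProd s

theorem factor_eq_or (p : E ⊕ E) : D.factor p = zUnit k Q p ∧ D.scalar p = 1 ∨
    D.factor p = (zUnit k Q p)⁻¹ ∧ D.scalar p = -1 := by
  rcases Int.units_eq_one_or (D.sign p) with h | h <;> simp [factor, scalar, h]

variable {D}

theorem arr_factor [NeZero (2 : k)] (h : IsFormBracket Q D.form D.scalar br) (c p : E ⊕ E) :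
    br (𝐱 c) (D.factor p).val =
      ((D.factor p).val ⊗ₜ[k] (1 : AQ k Q)) *
          (gaugeTerm Q D.form c p + gaugeTerm Q (diagForm k) c p)
        - (gaugeTerm Q D.form c p - gaugeTerm Q (diagForm k) c p) *
          ((1 : AQ k Q) ⊗ₜ[k] (D.factor p).val) := by
  have hz := h.arr_zUnit D.scalar_swap c p
  obtain ⟨hfactor, hscalar⟩ | ⟨hfactor, hscalar⟩ := D.factor_eq_or p
  · rw [hfactor, hz, hscalar, one_smul]
  · rw [hscalar, neg_one_smul, sub_neg_eq_add, ← sub_eq_add_neg] at hz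
    rw [hfactor]
    exact (h.isDoubleBracket.isDer_right _).map_inv_of_eq hz

theorem arr_factor_of_list_eq [NeZero (2 : k)] (h : IsFormBracket Q D.form D.scalar br) {s : I}
    {pre l : List (E ⊕ E)} {p : E ⊕ E} (hlist : D.list s = pre ++ p :: l) (c : E ⊕ E) :
    br (𝐱 c) (D.factor p).val =
      ((D.factor p).val ⊗ₜ[k] (1 : AQ k Q)) * gaugeTerm Q (cutForm k Q s (pre ++ [p])) c c
        - gaugeTerm Q (cutForm k Q s pre) c c * ((1 : AQ k Q) ⊗ₜ[k] (D.factor p).val) := by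
  have hadd : gaugeTerm Q (D.form + diagForm k) c p =
      gaugeTerm Q (cutForm k Q s (pre ++ [p])) c c :=
    gaugeTerm_congr (form_add_diagForm hlist c c) (form_add_diagForm hlist c.swap c)
  have hsub : gaugeTerm Q (D.form + -diagForm k) c p = gaugeTerm Q (cutForm k Q s pre) c c :=
    gaugeTerm_congr ((sub_eq_add_neg _ _).symm.trans (form_sub_diagForm hlist c c))
      ((sub_eq_add_neg _ _).symm.trans (form_sub_diagForm hlist c.swap c))
  rw [arr_factor h, ← hadd, ← hsub, gaugeTerm_add, gaugeTerm_add, gaugeTerm_neg,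
    sub_eq_add_neg (gaugeTerm Q D.form c p)]

theorem arr_prod_factor [NeZero (2 : k)] (h : IsFormBracket Q D.form D.scalar br) (c : E ⊕ E)
    {s : I} {pre l : List (E ⊕ E)} (hlist : D.list s = pre ++ l) :
    br (𝐱 c) ((l.map D.factor).prod).val =
      (((l.map D.factor).prod).val ⊗ₜ[k] (1 : AQ k Q)) *
          gaugeTerm Q (cutForm k Q s (D.list s)) c c
        - gaugeTerm Q (cutForm k Q s pre) c c *
          ((1 : AQ k Q) ⊗ₜ[k] ((l.map D.factor).prod).val) := by
  induction l generalizing pre with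
  | nil =>
    rw [hlist, List.append_nil, List.map_nil, List.prod_nil, Units.val_one,
      (h.isDoubleBracket.isDer_right _).map_one, ← Algebra.TensorProduct.one_def, one_mul, mul_one,
      sub_self]
  | cons p l ih =>
    rw [List.map_cons, List.prod_cons, Units.val_mul]
    exact (h.isDoubleBracket.isDer_right _).map_mul_of_eq (arr_factor_of_list_eq h hlist c)
      (ih (by rw [hlist]; simp))

variable (D)

theorem commute_idem_factorProd (s : I) : Commute (𝐞 s) (D.factorProd s).val := by
  have hcommute (l : List (E ⊕ E)) (hl : ∀ p ∈ l, 𝐭 p = s) :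
      Commute (𝐞 s) ((l.map D.factor).prod).val := by
    induction l with
    | nil => exact Commute.one_right _
    | cons p l ih =>
      rw [List.map_cons, List.prod_cons, Units.val_mul]
      obtain rfl := hl p List.mem_cons_self
      exact ((commute_idem_zUnit p).units_zpow_right _).mul_right
        (ih fun q hq => hl q (List.mem_cons_of_mem p hq))
  exact hcommute _ fun p => (D.mem_list s p).1

theorem idem_mul_moment (s : I) : 𝐞 s * D.moment s = D.moment s := by
  rw [moment, ← mul_assoc, idem_mul_self]

theorem moment_mul_idem (s : I) : D.moment s * 𝐞 s = D.moment s := by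
  rw [moment, (D.commute_idem_factorProd s).eq, mul_assoc, idem_mul_self]

theorem isUnit_sum_moment : IsUnit (∑ s, D.moment s) :=
  isUnit_sum_mul_of_commute (completeOrthogonalIdempotents_idem k Q) D.commute_idem_factorProd

variable {D}

theorem gaugeTerm_cutForm_list (s : I) (c p : E ⊕ E) :
    gaugeTerm Q (cutForm k Q s (D.list s)) c p =
      (1 / 2 : k) • ((𝐞 s * 𝐱 c) ⊗ₜ[k] 𝐞 s - 𝐞 s ⊗ₜ[k] (𝐱 c * 𝐞 s)) := by
  have hleft : cutForm k Q s (D.list s) c p • (𝐱 c ⊗ₜ[k] 𝐞 (𝐭 c)) = (𝐞 s * 𝐱 c) ⊗ₜ[k] 𝐞 s := by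
    rw [cutForm, D.mem_list]
    split_ifs with h
    · rw [one_smul, ← h, idem_mul_arr]
    · rw [idem_mul_arr_of_ne (Ne.symm h), zero_smul, TensorProduct.zero_tmul]
  have hright : cutForm k Q s (D.list s) c.swap p • (𝐞 (𝐭 c.swap) ⊗ₜ[k] 𝐱 c) =
      𝐞 s ⊗ₜ[k] (𝐱 c * 𝐞 s) := by
    rw [cutForm, D.mem_list]
    split_ifs with h
    · rw [one_smul, ← h, arr_mul_idem]
    · rw [arr_mul_idem_of_ne (Ne.symm h), zero_smul, TensorProduct.tmul_zero]
  rw [gaugeTerm, hleft, hright]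

theorem gaugeTerm_cutForm_nil (s : I) (c p : E ⊕ E) :
    gaugeTerm Q (cutForm k Q s []) c p = -gaugeTerm Q (cutForm k Q s (D.list s)) c p := by
  rw [← gaugeTerm_neg]
  have hcut (q : E ⊕ E) : cutForm k Q s [] q p = -cutForm k Q s (D.list s) q p := by
    rw [cutForm, cutForm, D.mem_list]
    split_ifs <;> simp_all
  exact gaugeTerm_congr (hcut c) (hcut c.swap)

theorem arr_moment [NeZero (2 : k)] (h : IsFormBracket Q D.form D.scalar br) (c : E ⊕ E) (s : I) :
    br (𝐱 c) (D.moment s) = (1 / 2 : k) •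
      ((D.moment s * 𝐱 c) ⊗ₜ[k] 𝐞 s - D.moment s ⊗ₜ[k] (𝐱 c * 𝐞 s)
        + (𝐞 s * 𝐱 c) ⊗ₜ[k] D.moment s - 𝐞 s ⊗ₜ[k] (𝐱 c * D.moment s)) := by
  have hprod := arr_prod_factor h c (pre := []) (D.list s).nil_append.symm
  rw [← factorProd, gaugeTerm_cutForm_nil, gaugeTerm_cutForm_list] at hprod
  have hmoment : 𝐞 s * (D.factorProd s).val = D.moment s := rfl
  rw [← hmoment, h.isDoubleBracket.deriv, (h.isBLinear s _).2, zero_mul, zero_add, hprod]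
  simp only [mul_smul_comm, smul_mul_assoc, mul_sub, sub_mul, neg_mul, mul_neg,
    Algebra.TensorProduct.tmul_mul_tmul, one_mul, mul_one, ← mul_assoc, idem_mul_self, hmoment,
    moment_mul_idem]
  simp only [mul_assoc, hmoment]
  module

theorem isMultMomentMap [NeZero (2 : k)] (h : IsFormBracket Q D.form D.scalar br) :
    IsMultMomentMap (idem k Q) br D.moment := by
  refine ⟨fun s => by rw [idem_mul_moment, moment_mul_idem], D.isUnit_sum_moment, fun s a => ?_⟩
  let d : AQ k Q →ₗ[k] AQ k Q ⊗[k] AQ k Q := innerDoubleDer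
    ((1 / 2 : k) • (𝐞 s ⊗ₜ[k] D.moment s + D.moment s ⊗ₜ[k] 𝐞 s))
  have hd (a : AQ k Q) : d a = (1 / 2 : k) • ((a * 𝐞 s) ⊗ₜ[k] D.moment s
      - 𝐞 s ⊗ₜ[k] (D.moment s * a) + (a * D.moment s) ⊗ₜ[k] 𝐞 s - D.moment s ⊗ₜ[k] (𝐞 s * a)) := by
    simp only [d, innerDoubleDer_apply, mul_smul_comm, smul_mul_assoc, mul_add, add_mul,
      Algebra.TensorProduct.tmul_mul_tmul, one_mul, mul_one]
    module
  rw [← hd]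
  refine DFunLike.congr_fun ((h.isDoubleBracket.isDer_right _).ext (isDer_innerDer _ _ _)
    (fun s' => ?_) fun c => ?_) a
  · rw [(h.isBLinear s' _).2, hd]
    obtain rfl | hs := eq_or_ne s' s
    · rw [idem_mul_self, idem_mul_moment, moment_mul_idem]
      module
    · have hleft : 𝐞 s' * D.moment s = 0 := by
        rw [← idem_mul_moment, ← mul_assoc, idem_mul_of_ne hs, zero_mul]
      have hright : D.moment s * 𝐞 s' = 0 := by
        rw [← moment_mul_idem, mul_assoc, idem_mul_of_ne hs.symm, mul_zero]
      simp [hleft, hright, idem_mul_of_ne hs, idem_mul_of_ne hs.symm]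
  · rw [h.isDoubleBracket.antisymm, arr_moment h, hd]
    simp only [map_smul, map_add, map_sub, TensorProduct.comm_tmul]
    module

end OrderDatum

end OrderDatum

section StdDatum

variable (k : Type*) [Field k] {I E : Type*} [DecidableEq I] {Q : FinQuiver I E} (o : Q.Ordering)

theorem ordForm_coe {s : I} (p q : Q.T s) : ordForm k Q o p q =
    (let := o s; if p < q then 1 else if q < p then -1 else 0) := by
  obtain ⟨p, rfl⟩ := p
  rw [ordForm, FinQuiver.ordFun, dif_pos ⟨rfl, q.2⟩]
  dsimp only
  split_ifs <;> simp

theorem ordForm_quadratic {s : I} {p q r : Q.T s} (h : ¬(p = q ∧ q = r)) :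
    ordForm k Q o p q * ordForm k Q o q r + ordForm k Q o q r * ordForm k Q o r p
      + ordForm k Q o r p * ordForm k Q o p q = -1 := by
  rw [ordForm_coe, ordForm_coe, ordForm_coe]
  let := o s
  rcases lt_trichotomy p q with hpq | hpq | hpq <;>
    rcases lt_trichotomy q r with hqr | hqr | hqr <;>
      rcases lt_trichotomy r p with hrp | hrp | hrp <;>
  first
  | (exfalso; order)
  | (exfalso; exact h ⟨hpq, hqr⟩)
  | simp [hpq, hqr, hrp, hpq.not_gt, hqr.not_gt, hrp.not_gt]

theorem ordForm_isOrderForm : IsOrderForm Q (ordForm k Q o) where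
  toIsTailForm := ordForm_isTailForm k o
  quadratic p q r hpq hqr hne :=
    ordForm_quadratic k o (s := Q.double.t p) (p := ⟨p, rfl⟩) (q := ⟨q, hpq.symm⟩)
      (r := ⟨r, (hpq.trans hqr).symm⟩) (by simpa only [Subtype.ext_iff] using hne)

variable [Fintype E]

/-- The datum of a quiver with orderings, which gives Van den Bergh's structure. -/
def stdDatum : OrderDatum k Q where
  form := ordForm k Q o
  sign := stdSign
  list s := (Q.sortedT o s).map Subtype.val
  isTailForm := ordForm_isTailForm k o
  sign_swap := stdSign_swap
  mem_list s p := by simp [FinQuiver.sortedT]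
  pairwise s := by
    rw [List.pairwise_map]
    let := o s
    refine (Finset.sortedLT_sort (Finset.univ : Finset (Q.T s))).pairwise.imp fun {p q} h => ?_
    rw [ordForm_coe]
    exact if_pos h

theorem mul_prod_map_eq_mul_prod_map {M ι : Type*} [Monoid M] {e : M} (he : IsIdempotentElem e)
    {f g : ι → M} (hg : ∀ i, Commute e (g i)) (hf : ∀ i, f i = e * g i) (l : List ι) :
    e * (l.map f).prod = e * (l.map g).prod := by
  induction l with
  | nil => rfl
  | cons i l ih =>
    rw [List.map_cons, List.map_cons, List.prod_cons, List.prod_cons, hf, ← mul_assoc,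
      ← mul_assoc, he.eq, (hg i).eq, mul_assoc, ih, ← mul_assoc, ← (hg i).eq, mul_assoc]

variable [Fintype I]

theorem momentFactor_eq (p : E ⊕ E) :
    momentFactor k Q (Q.double.t p) p = idem k Q (Q.double.t p) * (stdDatum k o).factor p := by
  rcases p with a | a
  · have hfactor : (stdDatum k o).factor (Sum.inl a) = zUnit k Q (Sum.inl a) := zpow_one _
    rw [hfactor, coe_zUnit, mul_add, mul_one, ← mul_assoc, idem_mul_arr]
    rfl
  · have hfactor : (stdDatum k o).factor (Sum.inr a) = (zUnit k Q (Sum.inr a))⁻¹ := zpow_neg_one _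
    calc idem k Q (Q.double.t (Sum.inr a)) * ((zUnit k Q (Sum.inr a))⁻¹).val *
          idem k Q (Q.double.t (Sum.inr a))
        = idem k Q (Q.double.t (Sum.inr a)) * ((zUnit k Q (Sum.inr a))⁻¹).val := by
          rw [(commute_idem_zUnit (Sum.inr a)).units_inv_right.eq, mul_assoc, idem_mul_self]
      _ = _ := by rw [hfactor]

theorem momentMap_eq : momentMap k Q o = (stdDatum k o).moment := by
  funext s
  have hlist := mul_prod_map_eq_mul_prod_map (idem_mul_self (k := k) (Q := Q) s)
    (f := fun p : Q.T s => momentFactor k Q s p)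
    (g := fun p : Q.T s => ((stdDatum k o).factor p : AQ k Q))
    (by rintro ⟨p, rfl⟩; exact (commute_idem_zUnit p).units_zpow_right _)
    (by rintro ⟨p, rfl⟩; exact momentFactor_eq k o p) (Q.sortedT o s)
  rw [momentMap, hlist, OrderDatum.moment, OrderDatum.factorProd, ← Units.coeHom_apply,
    map_list_prod, List.map_map]
  simp only [stdDatum, List.map_map, Function.comp_def, Units.coeHom_apply]

end StdDatum

/-! ### Isomorphisms -/

section Equivalence

variable {k : Type*} [Field k] {I : Type*} [Fintype I]

namespace IsQHIso

variable {A A' A'' : Type*} [Ring A] [Algebra k A] [Ring A'] [Algebra k A'] [Ring A'']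
  [Algebra k A''] {e : I → A} {e' : I → A'} {e'' : I → A''}
  {br : A →ₗ[k] A →ₗ[k] A ⊗[k] A} {br' : A' →ₗ[k] A' →ₗ[k] A' ⊗[k] A'}
  {br'' : A'' →ₗ[k] A'' →ₗ[k] A'' ⊗[k] A''} {Φ : I → A} {Φ' : I → A'} {Φ'' : I → A''}

theorem refl : IsQHIso e br Φ e br Φ (AlgEquiv.refl : A ≃ₐ[k] A) where
  map_idem _ := rfl
  map_bracket a b := (LinearMap.congr_fun TensorProduct.map_id (br a b)).symm
  map_moment := rfl

theorem trans {ψ : A ≃ₐ[k] A'} {ψ' : A' ≃ₐ[k] A''} (h : IsQHIso e br Φ e' br' Φ' ψ)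
    (h' : IsQHIso e' br' Φ' e'' br'' Φ'' ψ') : IsQHIso e br Φ e'' br'' Φ'' (ψ.trans ψ') where
  map_idem s := (congrArg ψ' (h.map_idem s)).trans (h'.map_idem s)
  map_bracket a b := by
    have hcomp : (ψ.trans ψ').toLinearMap = ψ'.toLinearMap ∘ₗ ψ.toLinearMap := rfl
    rw [hcomp, TensorProduct.map_comp, LinearMap.comp_apply, ← h.map_bracket, ← h'.map_bracket]
    rfl
  map_moment := (congrArg ψ' h.map_moment).trans h'.map_moment

end IsQHIso

variable {E E' : Type*} {Q : FinQuiver I E} {Q' : FinQuiver I E'}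

/-- The algebra map `ψ ⊗ ψ`. -/
abbrev tensorSq (ψ : AQ k Q →ₐ[k] AQ k Q') : AQ k Q ⊗[k] AQ k Q →ₐ[k] AQ k Q' ⊗[k] AQ k Q' :=
  Algebra.TensorProduct.map ψ ψ

theorem tensorSq_comm (ψ : AQ k Q →ₐ[k] AQ k Q') (x : AQ k Q ⊗[k] AQ k Q) :
    tensorSq ψ (TensorProduct.comm k _ _ x) = TensorProduct.comm k _ _ (tensorSq ψ x) :=
  TensorProduct.map_comm ψ.toLinearMap ψ.toLinearMap x

section BracketMap

variable {br : AQ k Q →ₗ[k] AQ k Q →ₗ[k] AQ k Q ⊗[k] AQ k Q}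
  {br' : AQ k Q' →ₗ[k] AQ k Q' →ₗ[k] AQ k Q' ⊗[k] AQ k Q'} {ψ : AQ k Q →ₐ[k] AQ k Q'}

theorem bracket_map_symm (hb : IsDoubleBracket br) (hb' : IsDoubleBracket br') {a b : AQ k Q}
    (h : br' (ψ a) (ψ b) = tensorSq ψ (br a b)) : br' (ψ b) (ψ a) = tensorSq ψ (br b a) := by
  rw [hb'.antisymm, h, hb.antisymm b a, map_neg, tensorSq_comm]

theorem isDer_bracketDefect (hb : IsDoubleBracket br) (hb' : IsDoubleBracket br')
    (ψ : AQ k Q →ₐ[k] AQ k Q') (a : AQ k Q) :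
    IsDer ((includeLeft : AQ k Q' →ₐ[k] AQ k Q' ⊗[k] AQ k Q').comp ψ) (includeRight.comp ψ)
      (br' (ψ a) ∘ₗ ψ.toLinearMap - (tensorSq ψ).toLinearMap ∘ₗ br a) := by
  refine IsDer.sub (fun b c => ?_) fun b c => ?_
  · simpa using hb'.isDer_right (ψ a) (ψ b) (ψ c)
  · simp only [LinearMap.comp_apply, AlgHom.toLinearMap_apply, hb.deriv, map_add, map_mul, map_one,
      Algebra.TensorProduct.map_tmul, AlgHom.comp_apply,
      Algebra.TensorProduct.includeLeft_apply, Algebra.TensorProduct.includeRight_apply]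

theorem bracket_map_of_arr_right (hb : IsDoubleBracket br) (hb' : IsDoubleBracket br')
    (hB : IsBLinear (idem k Q) br) (hB' : IsBLinear (idem k Q') br')
    (he : ∀ s, ψ (idem k Q s) = idem k Q' s) {a : AQ k Q}
    (harr : ∀ q, br' (ψ a) (ψ (arr k Q q)) = tensorSq ψ (br a (arr k Q q))) (b : AQ k Q) :
    br' (ψ a) (ψ b) = tensorSq ψ (br a b) := by
  refine sub_eq_zero.1 ((isDer_bracketDefect hb hb' ψ a).eq_zero (fun s => ?_)
    (fun q => sub_eq_zero.2 (harr q)) b)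
  rw [LinearMap.sub_apply, LinearMap.comp_apply, LinearMap.comp_apply, (hB s a).2, map_zero,
    AlgHom.toLinearMap_apply, he, (hB' s _).2, sub_zero]

theorem bracket_map_of_arr (hb : IsDoubleBracket br) (hb' : IsDoubleBracket br')
    (hB : IsBLinear (idem k Q) br) (hB' : IsBLinear (idem k Q') br')
    (he : ∀ s, ψ (idem k Q s) = idem k Q' s)
    (harr : ∀ p q, br' (ψ (arr k Q p)) (ψ (arr k Q q)) = tensorSq ψ (br (arr k Q p) (arr k Q q)))
    (a b : AQ k Q) : br' (ψ a) (ψ b) = tensorSq ψ (br a b) :=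
  bracket_map_of_arr_right hb hb' hB hB' he (fun q => bracket_map_symm hb hb' <|
    bracket_map_of_arr_right hb hb' hB hB' he (harr q) a) b

end BracketMap

namespace OrderDatum

variable {E'' : Type*} {Q'' : FinQuiver I E''}

/-- The double bracket defined by a datum. -/
def br (D : OrderDatum k Q) : AQ k Q →ₗ[k] AQ k Q →ₗ[k] AQ k Q ⊗[k] AQ k Q :=
  (exists_isFormBracket D.isTailForm D.scalar_swap).choose

theorem isFormBracket_br (D : OrderDatum k Q) : IsFormBracket Q D.form D.scalar D.br :=
  (exists_isFormBracket D.isTailForm D.scalar_swap).choose_spec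

/-- The quasi-Hamiltonian structures of two data are isomorphic over `B`. -/
def Equivalent (D : OrderDatum k Q) (D' : OrderDatum k Q') : Prop :=
  ∃ ψ, IsQHIso (idem k Q) D.br D.moment (idem k Q') D'.br D'.moment ψ

theorem Equivalent.refl (D : OrderDatum k Q) : D.Equivalent D :=
  ⟨_, IsQHIso.refl⟩

theorem Equivalent.trans {D : OrderDatum k Q} {D' : OrderDatum k Q'} {D'' : OrderDatum k Q''}
    (h : D.Equivalent D') (h' : D'.Equivalent D'') : D.Equivalent D'' :=
  let ⟨_, h⟩ := h
  let ⟨_, h'⟩ := h'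
  ⟨_, h.trans h'⟩

theorem equivalent_of_arr {D : OrderDatum k Q} {D' : OrderDatum k Q'}
    (ψ : AQ k Q →ₐ[k] AQ k Q') (ψ' : AQ k Q' →ₐ[k] AQ k Q) (hψ : ψ.comp ψ' = AlgHom.id k _)
    (hψ' : ψ'.comp ψ = AlgHom.id k _) (he : ∀ s, ψ (idem k Q s) = idem k Q' s)
    (harr : ∀ p q, D'.br (ψ (arr k Q p)) (ψ (arr k Q q)) =
      tensorSq ψ (arrowBracket Q D.form D.scalar p q))
    (hmoment : ∀ s, ψ (D.moment s) = D'.moment s) : D.Equivalent D' :=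
  have h := D.isFormBracket_br
  have h' := D'.isFormBracket_br
  ⟨AlgEquiv.ofAlgHom ψ ψ' hψ hψ', he,
    bracket_map_of_arr h.isDoubleBracket h'.isDoubleBracket h.isBLinear h'.isBLinear he
      fun p q => by rw [harr, h.arr_arr],
    (map_sum ψ _ _).trans (Finset.sum_congr rfl fun s _ => hmoment s)⟩

theorem map_factor (D : OrderDatum k Q) {ψ : AQ k Q →ₐ[k] AQ k Q'} {p : E ⊕ E} {u : (AQ k Q')ˣ}
    (hu : ψ (zUnit k Q p).val = u) :
    Units.map (ψ : AQ k Q →* AQ k Q') (D.factor p) = u ^ (D.sign p : ℤ) := by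
  rw [factor, map_zpow]
  exact congrArg (· ^ (D.sign p : ℤ)) (Units.ext hu)

theorem map_moment {D : OrderDatum k Q} {D' : OrderDatum k Q'} {ψ : AQ k Q →ₐ[k] AQ k Q'}
    (he : ∀ s, ψ (idem k Q s) = idem k Q' s) {s : I} (f : E ⊕ E → E' ⊕ E')
    (hlist : D'.list s = (D.list s).map f)
    (hfactor : ∀ p ∈ D.list s, Units.map (ψ : AQ k Q →* AQ k Q') (D.factor p) = D'.factor (f p)) :
    ψ (D.moment s) = D'.moment s := by
  have hprod : Units.map (ψ : AQ k Q →* AQ k Q') (D.factorProd s) = D'.factorProd s := by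
    rw [factorProd, factorProd, map_list_prod, List.map_map, hlist, List.map_map]
    exact congrArg List.prod (List.map_congr_left hfactor)
  rw [moment, moment, map_mul, he, ← hprod]
  rfl

end OrderDatum

end Equivalence

section Relabel

variable {k : Type*} [Field k] {I E E' : Type*} {Q : FinQuiver I E} {Q' : FinQuiver I E'}

/-- The transport of a datum along a bijection of arrows compatible with the involution. -/
def OrderDatum.relabel (D : OrderDatum k Q) (φ : E ⊕ E ≃ E' ⊕ E') (hφ : ∀ p, φ p.swap = (φ p).swap)
    (ht : ∀ p, Q'.double.t (φ p) = Q.double.t p) : OrderDatum k Q' where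
  form p q := D.form (φ.symm p) (φ.symm q)
  sign p := D.sign (φ.symm p)
  list s := (D.list s).map φ
  isTailForm.self _ := D.isTailForm.self _
  isTailForm.antisymm _ _ := D.isTailForm.antisymm _ _
  isTailForm.eq_zero p q h :=
    D.isTailForm.eq_zero _ _ (by rwa [← ht, ← ht, φ.apply_symm_apply, φ.apply_symm_apply])
  sign_swap p := by
    rw [← D.sign_swap, φ.symm_apply_eq.2 (show p.swap = _ by rw [hφ, φ.apply_symm_apply])]
  mem_list s p := by
    obtain ⟨p, rfl⟩ := φ.surjective p
    simp [D.mem_list, ht]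
  pairwise s := by
    rw [List.pairwise_map]
    simpa only [φ.symm_apply_apply] using D.pairwise s

variable [Fintype I] {φ : E ⊕ E ≃ E' ⊕ E'}

theorem exists_relabel_algHom (k : Type*) [Field k] (hφ : ∀ p, φ p.swap = (φ p).swap)
    (ht : ∀ p, Q'.double.t (φ p) = Q.double.t p) : ∃ ψ : AQ k Q →ₐ[k] AQ k Q',
      (∀ s, ψ (idem k Q s) = idem k Q' s) ∧ ∀ p, ψ (arr k Q p) = arr k Q' (φ p) := by
  refine AQ.exists_lift (completeOrthogonalIdempotents_idem k Q') (fun p => ?_) (fun p => ?_)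
  · rw [← ht, ← ht, hφ, idem_mul_arr, arr_mul_idem]
  · rw [hφ, ← coe_zUnit]
    exact (zUnit k Q' (φ p)).isUnit

variable {ψ : AQ k Q →ₐ[k] AQ k Q'}

open Classical in
theorem tensorSq_arrowBracket_of_relabel (he : ∀ s, ψ (idem k Q s) = idem k Q' s)
    (ha : ∀ p, ψ (arr k Q p) = arr k Q' (φ p)) (hφ : ∀ p, φ p.swap = (φ p).swap)
    (ht : ∀ p, Q'.double.t (φ p) = Q.double.t p) {O : E ⊕ E → E ⊕ E → k} {η : E ⊕ E → k}
    (p q : E ⊕ E) : tensorSq ψ (arrowBracket Q O η p q) =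
      arrowBracket Q' (fun p q => O (φ.symm p) (φ.symm q)) (fun p => η (φ.symm p)) (φ p) (φ q) := by
  have hgauge (c p : E ⊕ E) : tensorSq ψ (gaugeTerm Q O c p) =
      gaugeTerm Q' (fun p q => O (φ.symm p) (φ.symm q)) (φ c) (φ p) := by
    simp only [gaugeTerm, map_smul, map_sub, Algebra.TensorProduct.map_tmul, he, ha, ← hφ, ht,
      Equiv.symm_apply_apply]
  have hpair : tensorSq ψ (pairTerm k Q p) = pairTerm k Q' (φ p) := by
    simp only [pairTerm, map_smul, map_add, map_mul, Algebra.TensorProduct.map_tmul, he, ha, ← hφ,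
      ht]
  have hite : tensorSq ψ (if q = p.swap then η p • pairTerm k Q p else 0) =
      if φ q = φ p.swap then η p • pairTerm k Q' (φ p) else 0 := by
    simp only [apply_ite (tensorSq ψ), φ.injective.eq_iff, map_smul, map_zero, hpair]
  rw [arrowBracket, arrowBracket, ← hφ, ← hφ, map_add, map_sub, map_mul, map_mul, hgauge, hgauge,
    hite, φ.symm_apply_apply]
  simp only [Algebra.TensorProduct.map_tmul, ha, map_one]

theorem OrderDatum.equivalent_relabel (D : OrderDatum k Q) (hφ : ∀ p, φ p.swap = (φ p).swap)
    (ht : ∀ p, Q'.double.t (φ p) = Q.double.t p) : D.Equivalent (D.relabel φ hφ ht) := by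
  obtain ⟨ψ, he, ha⟩ := exists_relabel_algHom k hφ ht
  obtain ⟨ψ', he', ha'⟩ := exists_relabel_algHom (Q := Q') (Q' := Q) (φ := φ.symm) k
    (fun p => by rw [φ.symm_apply_eq, hφ, φ.apply_symm_apply])
    (fun p => by rw [← ht, φ.apply_symm_apply])
  refine equivalent_of_arr ψ ψ' (AQ.algHom_ext (by simp [he, he']) (by simp [ha, ha']))
    (AQ.algHom_ext (by simp [he, he']) (by simp [ha, ha'])) he (fun p q => ?_) (fun s => ?_)
  · rw [ha, ha, (isFormBracket_br _).arr_arr, tensorSq_arrowBracket_of_relabel he ha hφ ht]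
    rfl
  · refine map_moment he φ rfl fun p _ => ?_
    have hz : ψ (zUnit k Q p).val = (zUnit k Q' (φ p)).val := by
      simp only [coe_zUnit, map_add, map_one, map_mul, ha, hφ]
    rw [D.map_factor hz, factor]
    simp only [relabel, φ.symm_apply_apply]

end Relabel

/-! ### Reversing an arrow -/

section Flip

variable {k : Type*} [Field k] {I E : Type*} {Q : FinQuiver I E}

namespace OrderDatum

open Classical in
/-- The datum with the opposite signs at `a` and `a^*`. -/
def flip (D : OrderDatum k Q) (a : E ⊕ E) : OrderDatum k Q where
  form := D.form
  sign p := if p = a ∨ p = a.swap then -D.sign p else D.sign p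
  list := D.list
  isTailForm := D.isTailForm
  sign_swap p := by
    have hswap : p.swap = a ∨ p.swap = a.swap ↔ p = a ∨ p = a.swap := by
      rw [swap_eq_iff, Sum.swap_leftInverse.injective.eq_iff, or_comm]
    simp only [hswap, D.sign_swap]
    split_ifs <;> rfl
  mem_list := D.mem_list
  pairwise := D.pairwise

variable (D : OrderDatum k Q) {a p : E ⊕ E}

theorem flip_sign_self : (D.flip a).sign a = -D.sign a := by
  simp [flip]

theorem flip_sign_swap : (D.flip a).sign a.swap = -D.sign a.swap := by
  simp [flip]

theorem flip_sign_of_ne (h : p ≠ a) (h' : p ≠ a.swap) : (D.flip a).sign p = D.sign p := by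
  simp [flip, h, h']

theorem flip_scalar_self : (D.flip a).scalar a = -D.scalar a := by
  simp [scalar, D.flip_sign_self]

theorem flip_scalar_of_ne (h : p ≠ a) (h' : p ≠ a.swap) :
    (D.flip a).scalar p = D.scalar p := by
  rw [scalar, scalar, D.flip_sign_of_ne h h']

end OrderDatum

variable [Fintype I] {a : E ⊕ E}

local notation "𝐞" => idem k Q
local notation "𝐱" => arr k Q
local notation "𝐭" => FinQuiver.t (FinQuiver.double Q)

variable (k Q a) in
/-- The element `-(1 + a a^*)⁻¹ a`, the image of `a` under the isomorphism which exchanges the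
roles of `a` and `a^*`. -/
def flipArr : AQ k Q := -(((zUnit k Q a)⁻¹).val * 𝐱 a)

theorem zUnit_mul_flipArr : (zUnit k Q a).val * flipArr k Q a = -𝐱 a := by
  rw [flipArr, mul_neg, Units.mul_inv_cancel_left]

theorem zUnit_inv_mul_arr : ((zUnit k Q a)⁻¹).val * 𝐱 a = -flipArr k Q a := by
  rw [flipArr, neg_neg]

theorem arr_mul_arr_swap_mul_flipArr :
    𝐱 a * (𝐱 a.swap * flipArr k Q a) = -𝐱 a - flipArr k Q a := by
  rw [← zUnit_mul_flipArr, coe_zUnit]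
  noncomm_ring

theorem flipArr_mul_zUnit : flipArr k Q a * (zUnit k Q a.swap).val = -𝐱 a := by
  have hcomm : 𝐱 a * (zUnit k Q a.swap).val = (zUnit k Q a).val * 𝐱 a := by
    rw [coe_zUnit, coe_zUnit, Sum.swap_swap]
    noncomm_ring
  rw [flipArr, neg_mul, mul_assoc, hcomm, Units.inv_mul_cancel_left]

theorem idem_mul_flipArr : 𝐞 (𝐭 a) * flipArr k Q a = flipArr k Q a := by
  rw [flipArr, mul_neg, ← mul_assoc, (commute_idem_zUnit a).units_inv_right.eq, mul_assoc,
    idem_mul_arr]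

theorem flipArr_mul_idem : flipArr k Q a * 𝐞 (𝐭 a.swap) = flipArr k Q a := by
  rw [flipArr, neg_mul, mul_assoc, arr_mul_idem]

theorem one_add_flipArr_mul_arr_swap :
    1 + flipArr k Q a * 𝐱 a.swap = ((zUnit k Q a)⁻¹).val := by
  have harr : 𝐱 a * 𝐱 a.swap = (zUnit k Q a).val - 1 := by rw [coe_zUnit, add_sub_cancel_left]
  rw [flipArr, neg_mul, mul_assoc, harr, mul_sub, Units.inv_mul, mul_one, neg_sub, add_sub_cancel]

theorem one_add_arr_swap_mul_flipArr :
    1 + 𝐱 a.swap * flipArr k Q a = ((zUnit k Q a.swap)⁻¹).val := by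
  refine Units.eq_inv_of_mul_eq_one_right ?_
  rw [add_mul, mul_assoc, flipArr_mul_zUnit, one_mul, coe_zUnit, Sum.swap_swap, mul_neg,
    add_neg_cancel_right]

theorem isUnit_zUnit_tmul_one : IsUnit ((zUnit k Q a).val ⊗ₜ[k] (1 : AQ k Q)) :=
  (zUnit k Q a).isUnit.map (includeLeft : AQ k Q →ₐ[k] AQ k Q ⊗[k] AQ k Q)

variable {O : E ⊕ E → E ⊕ E → k}

theorem smul_zUnit_tmul_one_mul_flipArr (hO : IsTailForm Q O) :
    O a a.swap • (((zUnit k Q a).val ⊗ₜ[k] (1 : AQ k Q)) *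
        ((flipArr k Q a * flipArr k Q a) ⊗ₜ[k] 𝐞 (𝐭 a)
          - 𝐞 (𝐭 a.swap) ⊗ₜ[k] (flipArr k Q a * flipArr k Q a))) =
      O a a.swap • -((𝐱 a * flipArr k Q a) ⊗ₜ[k] 𝐞 (𝐭 a.swap)
        + (𝐞 (𝐭 a) + 𝐱 a * 𝐱 a.swap) ⊗ₜ[k] (flipArr k Q a * flipArr k Q a)) := by
  refine hO.smul_congr fun ht => ?_
  rw [← ht, mul_sub, Algebra.TensorProduct.tmul_mul_tmul, Algebra.TensorProduct.tmul_mul_tmul,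
    ← mul_assoc (zUnit k Q a).val, zUnit_mul_flipArr, coe_zUnit, add_mul, mul_assoc,
    arr_swap_mul_idem, one_mul, one_mul, neg_mul, TensorProduct.neg_tmul]
  abel

namespace IsFormBracket

variable [NeZero (2 : k)] {η : E ⊕ E → k}
  {br : AQ k Q →ₗ[k] AQ k Q →ₗ[k] AQ k Q ⊗[k] AQ k Q}

open Classical in
theorem arr_flipArr (h : IsFormBracket Q O η br) (hη : ∀ p, η p.swap = -η p) (c : E ⊕ E) :
    br (𝐱 c) (flipArr k Q a) = (flipArr k Q a ⊗ₜ[k] (1 : AQ k Q)) * gaugeTerm Q O c a.swap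
      - (gaugeTerm Q O c a + η a • gaugeTerm Q (diagForm k) c a) *
        ((1 : AQ k Q) ⊗ₜ[k] flipArr k Q a)
      + (((zUnit k Q a)⁻¹).val ⊗ₜ[k] (1 : AQ k Q)) *
        (η a • (gaugeTerm Q (diagForm k) c a * ((1 : AQ k Q) ⊗ₜ[k] 𝐱 a))
          - if a = c.swap then η c • pairTerm k Q c else 0) := by
  have hderiv := h.isDoubleBracket.deriv (𝐱 c) (zUnit k Q a).val (flipArr k Q a)
  rw [zUnit_mul_flipArr, map_neg, h.arr_zUnit hη, h.arr_arr, arrowBracket] at hderiv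
  have hleft : ((zUnit k Q a).val ⊗ₜ[k] (1 : AQ k Q)) * (flipArr k Q a ⊗ₜ[k] (1 : AQ k Q)) =
      -(𝐱 a ⊗ₜ[k] (1 : AQ k Q)) := by
    rw [Algebra.TensorProduct.tmul_mul_tmul, zUnit_mul_flipArr, one_mul, TensorProduct.neg_tmul]
  have hinv : ((zUnit k Q a).val ⊗ₜ[k] (1 : AQ k Q)) *
      (((zUnit k Q a)⁻¹).val ⊗ₜ[k] (1 : AQ k Q)) = 1 := by
    rw [Algebra.TensorProduct.tmul_mul_tmul, Units.mul_inv, one_mul, Algebra.TensorProduct.one_def]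
  have hright : ((1 : AQ k Q) ⊗ₜ[k] (zUnit k Q a).val) * ((1 : AQ k Q) ⊗ₜ[k] flipArr k Q a) =
      -((1 : AQ k Q) ⊗ₜ[k] 𝐱 a) := by
    rw [Algebra.TensorProduct.tmul_mul_tmul, zUnit_mul_flipArr, one_mul, TensorProduct.tmul_neg]
  refine (isUnit_zUnit_tmul_one (k := k) (Q := Q) (a := a)).mul_left_cancel ?_
  simp only [sub_mul, mul_assoc, hright] at hderiv
  rw [mul_add, mul_sub, ← mul_assoc, ← mul_assoc _ (((zUnit k Q a)⁻¹).val ⊗ₜ[k] 1), hleft, hinv]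
  simp only [mul_add, add_mul, mul_neg, neg_mul, one_mul, smul_mul_assoc] at hderiv ⊢
  linear_combination (norm := module) -hderiv

theorem arr_self_flipArr (h : IsFormBracket Q O η br) (hO : IsTailForm Q O)
    (hη : ∀ p, η p.swap = -η p) : br (𝐱 a) (flipArr k Q a) =
      ((1 / 2 : k) * O a a.swap) • ((flipArr k Q a * 𝐱 a) ⊗ₜ[k] 𝐞 (𝐭 a)
          - 𝐞 (𝐭 a.swap) ⊗ₜ[k] (𝐱 a * flipArr k Q a))
        - ((1 / 2 : k) * η a) • (𝐱 a ⊗ₜ[k] flipArr k Q a + flipArr k Q a ⊗ₜ[k] 𝐱 a) := by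
  rw [h.arr_flipArr hη, if_neg (swap_ne a).symm, gaugeTerm_diagForm_self, gaugeTerm, gaugeTerm,
    hO.self, hO.self, hO.antisymm a.swap a]
  simp only [sub_mul, add_mul, smul_mul_assoc, mul_smul_comm, sub_zero, zero_smul, zero_mul,
    Algebra.TensorProduct.tmul_mul_tmul, one_mul, mul_one, idem_mul_arr,
    idem_mul_flipArr, zUnit_inv_mul_arr, TensorProduct.neg_tmul]
  module

theorem arr_swap_flipArr (h : IsFormBracket Q O η br) (hO : IsTailForm Q O)
    (hη : ∀ p, η p.swap = -η p) : br (𝐱 a.swap) (flipArr k Q a) =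
      η a • (𝐞 (𝐭 a) ⊗ₜ[k] 𝐞 (𝐭 a.swap)
          + (1 / 2 : k) • ((flipArr k Q a * 𝐱 a.swap) ⊗ₜ[k] 𝐞 (𝐭 a.swap))
          + (1 / 2 : k) • (𝐞 (𝐭 a) ⊗ₜ[k] (𝐱 a.swap * flipArr k Q a)))
        - ((1 / 2 : k) * O a a.swap) •
          (flipArr k Q a ⊗ₜ[k] 𝐱 a.swap - 𝐱 a.swap ⊗ₜ[k] flipArr k Q a) := by
  have hdiag : gaugeTerm Q (diagForm k) a.swap a =
      -((1 / 2 : k) • (𝐞 (𝐭 a) ⊗ₜ[k] 𝐱 a.swap)) := by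
    simpa only [Sum.swap_swap] using gaugeTerm_diagForm_swap (k := k) (Q := Q) a.swap
  have hinv_idem : ((zUnit k Q a)⁻¹).val * 𝐞 (𝐭 a) = 𝐞 (𝐭 a) + flipArr k Q a * 𝐱 a.swap := by
    rw [← one_add_flipArr_mul_arr_swap, add_mul, one_mul, mul_assoc, arr_swap_mul_idem]
  have hinv_arr : ((zUnit k Q a)⁻¹).val * (𝐱 a * 𝐱 a.swap) = -(flipArr k Q a * 𝐱 a.swap) := by
    rw [← mul_assoc, zUnit_inv_mul_arr, neg_mul]
  have hleft : O a a.swap • ((flipArr k Q a * 𝐞 (𝐭 a)) ⊗ₜ[k] 𝐱 a.swap) =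
      O a a.swap • (flipArr k Q a ⊗ₜ[k] 𝐱 a.swap) :=
    hO.smul_congr fun ht => by rw [ht, flipArr_mul_idem]
  have hright : O a a.swap • (𝐱 a.swap ⊗ₜ[k] (𝐞 (𝐭 a.swap) * flipArr k Q a)) =
      O a a.swap • (𝐱 a.swap ⊗ₜ[k] flipArr k Q a) :=
    hO.smul_congr fun ht => by rw [← ht, idem_mul_flipArr]
  rw [h.arr_flipArr hη, if_pos (Sum.swap_swap a).symm, hdiag, gaugeTerm, gaugeTerm, pairTerm,
    Sum.swap_swap, hO.self, hO.self, hO.antisymm a.swap a, hη]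
  simp only [mul_sub, add_mul, mul_add, smul_mul_assoc, mul_smul_comm, zero_sub,
    sub_zero, zero_smul, neg_mul, mul_neg, neg_smul, Algebra.TensorProduct.tmul_mul_tmul, one_mul,
    mul_one, hinv_idem, hinv_arr, hleft, hright, TensorProduct.neg_tmul, TensorProduct.add_tmul]
  linear_combination (norm := module)
    (-(η a * add_halves (1 : k))) • ((flipArr k Q a * 𝐱 a.swap) ⊗ₜ[k] 𝐞 (𝐭 a.swap))

theorem flipArr_flipArr (h : IsFormBracket Q O η br) (hO : IsTailForm Q O)
    (hη : ∀ p, η p.swap = -η p) : br (flipArr k Q a) (flipArr k Q a) =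
      ((1 / 2 : k) * O a a.swap) • ((flipArr k Q a * flipArr k Q a) ⊗ₜ[k] 𝐞 (𝐭 a)
        - 𝐞 (𝐭 a.swap) ⊗ₜ[k] (flipArr k Q a * flipArr k Q a)) := by
  have hb := h.isDoubleBracket
  have hderiv : br (flipArr k Q a) (-𝐱 a) =
      (br (flipArr k Q a) (𝐱 a) * ((1 : AQ k Q) ⊗ₜ[k] 𝐱 a.swap)
        + (𝐱 a ⊗ₜ[k] (1 : AQ k Q)) * br (flipArr k Q a) (𝐱 a.swap))
          * ((1 : AQ k Q) ⊗ₜ[k] flipArr k Q a)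
        + ((zUnit k Q a).val ⊗ₜ[k] (1 : AQ k Q)) * br (flipArr k Q a) (flipArr k Q a) := by
    rw [← zUnit_mul_flipArr, hb.deriv, coe_zUnit, map_add, (hb.isDer_right _).map_one, zero_add,
      hb.deriv]
  rw [map_neg, hb.antisymm _ (𝐱 a), hb.antisymm _ (𝐱 a.swap), h.arr_self_flipArr hO hη,
    h.arr_swap_flipArr hO hη] at hderiv
  have hswap : 𝐞 (𝐭 a.swap) * (𝐱 a.swap * flipArr k Q a) = 𝐱 a.swap * flipArr k Q a := by
    rw [← mul_assoc, idem_mul_arr]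
  refine (isUnit_zUnit_tmul_one (k := k) (Q := Q) (a := a)).mul_left_cancel ?_
  rw [← sub_eq_iff_eq_add'.2 hderiv, mul_smul_comm, mul_smul _ _ (_ * _),
    smul_zUnit_tmul_one_mul_flipArr hO]
  simp only [map_sub, map_add, map_smul, TensorProduct.comm_tmul, mul_smul_comm, smul_mul_assoc,
    mul_sub, sub_mul, add_mul, mul_add, neg_mul, mul_neg, neg_neg, TensorProduct.add_tmul,
    TensorProduct.neg_tmul, TensorProduct.sub_tmul, TensorProduct.tmul_neg, TensorProduct.tmul_sub,
    Algebra.TensorProduct.tmul_mul_tmul, one_mul, mul_one, mul_assoc, arr_mul_arr_swap_mul_flipArr,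
    arr_mul_idem, idem_mul_flipArr, hswap]
  linear_combination (norm := module)
    (-(η a * add_halves (1 : k))) • (𝐱 a ⊗ₜ[k] flipArr k Q a)

end IsFormBracket

variable (a) in
/-- The endomorphism of `AQ k Q` over `B` which sends `a` to `-(1 + a a^*)⁻¹ a` and fixes the other
arrows. -/
structure IsFlip (ψ : AQ k Q →ₐ[k] AQ k Q) : Prop where
  map_idem : ∀ s, ψ (𝐞 s) = 𝐞 s
  map_arr_self : ψ (𝐱 a) = flipArr k Q a
  map_arr_of_ne : ∀ p, p ≠ a → ψ (𝐱 p) = 𝐱 p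

variable (k Q a) in
theorem exists_isFlip : ∃ ψ : AQ k Q →ₐ[k] AQ k Q, IsFlip a ψ := by
  classical
  have hmem (p : E ⊕ E) : 𝐞 (𝐭 p) * Function.update 𝐱 a (flipArr k Q a) p * 𝐞 (𝐭 p.swap) =
      Function.update 𝐱 a (flipArr k Q a) p := by
    rcases eq_or_ne p a with rfl | hp
    · rw [Function.update_self, idem_mul_flipArr, flipArr_mul_idem]
    · rw [Function.update_of_ne hp, idem_mul_arr, arr_mul_idem]
  have hunit (p : E ⊕ E) : IsUnit (1 + Function.update 𝐱 a (flipArr k Q a) p *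
      Function.update 𝐱 a (flipArr k Q a) p.swap) := by
    rcases eq_or_ne p a with rfl | hp
    · rw [Function.update_self, Function.update_of_ne (swap_ne p), one_add_flipArr_mul_arr_swap]
      exact Units.isUnit _
    rw [Function.update_of_ne hp]
    rcases eq_or_ne p a.swap with rfl | hp'
    · rw [Sum.swap_swap, Function.update_self, one_add_arr_swap_mul_flipArr]
      exact Units.isUnit _
    · rw [Function.update_of_ne (fun h => hp' (swap_eq_iff.1 h)), ← coe_zUnit]
      exact Units.isUnit _
  obtain ⟨ψ, hidem, harr⟩ := AQ.exists_lift (k := k) (Q := Q)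
    (completeOrthogonalIdempotents_idem k Q) hmem hunit
  exact ⟨ψ, hidem, by rw [harr, Function.update_self],
    fun p hp => by rw [harr, Function.update_of_ne hp]⟩

namespace IsFlip

variable {ψ : AQ k Q →ₐ[k] AQ k Q} (h : IsFlip a ψ) {p q : E ⊕ E}

include h

theorem map_zUnit : ψ (zUnit k Q a).val = ((zUnit k Q a)⁻¹).val := by
  rw [coe_zUnit, map_add, map_one, map_mul, h.map_arr_self, h.map_arr_of_ne _ (swap_ne a),
    one_add_flipArr_mul_arr_swap]

theorem map_zUnit_swap : ψ (zUnit k Q a.swap).val = ((zUnit k Q a.swap)⁻¹).val := by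
  rw [coe_zUnit, map_add, map_one, map_mul, Sum.swap_swap, h.map_arr_self,
    h.map_arr_of_ne _ (swap_ne a), one_add_arr_swap_mul_flipArr]

theorem map_zUnit_of_ne (hp : p ≠ a) (hp' : p ≠ a.swap) :
    ψ (zUnit k Q p).val = (zUnit k Q p).val := by
  rw [coe_zUnit, map_add, map_one, map_mul, h.map_arr_of_ne p hp,
    h.map_arr_of_ne _ fun heq => hp' (swap_eq_iff.1 heq)]

theorem comp_self : ψ.comp ψ = AlgHom.id k _ := by
  refine AQ.algHom_ext (fun s => by simp [h.map_idem]) (fun p => ?_)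
  rw [AlgHom.comp_apply, AlgHom.id_apply]
  rcases eq_or_ne p a with rfl | hp
  · have hinv : ψ ((zUnit k Q p)⁻¹).val = (zUnit k Q p).val := by
      have hmap : Units.map (ψ : AQ k Q →* AQ k Q) (zUnit k Q p)⁻¹ = zUnit k Q p := by
        rw [map_inv, inv_eq_iff_eq_inv]
        exact Units.ext h.map_zUnit
      exact congrArg Units.val hmap
    rw [h.map_arr_self, flipArr, map_neg, map_mul, hinv, h.map_arr_self, zUnit_mul_flipArr, neg_neg]
  · rw [h.map_arr_of_ne p hp, h.map_arr_of_ne p hp]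

theorem tensorSq_gaugeTerm (hp : p ≠ a) (O : E ⊕ E → E ⊕ E → k) :
    tensorSq ψ (gaugeTerm Q O p q) = gaugeTerm Q O p q := by
  simp only [gaugeTerm, map_smul, map_sub, Algebra.TensorProduct.map_tmul, h.map_idem,
    h.map_arr_of_ne p hp]

theorem tensorSq_pairTerm (hp : p ≠ a) (hp' : p.swap ≠ a) :
    tensorSq ψ (pairTerm k Q p) = pairTerm k Q p := by
  simp only [pairTerm, map_smul, map_add, map_mul, Algebra.TensorProduct.map_tmul, h.map_idem,
    h.map_arr_of_ne p hp, h.map_arr_of_ne _ hp']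

variable [NeZero (2 : k)] (D : OrderDatum k Q)

theorem br_map_self : (D.flip a).br (ψ (𝐱 a)) (ψ (𝐱 a)) =
    tensorSq ψ (arrowBracket Q D.form D.scalar a a) := by
  rw [h.map_arr_self, (D.flip a).isFormBracket_br.flipArr_flipArr D.isTailForm
    (D.flip a).scalar_swap, arrowBracket_self D.isTailForm]
  simp only [map_smul, map_sub, map_mul, Algebra.TensorProduct.map_tmul, h.map_idem,
    h.map_arr_self, OrderDatum.flip]

theorem br_map_swap_self : (D.flip a).br (ψ (𝐱 a.swap)) (ψ (𝐱 a)) =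
    tensorSq ψ (arrowBracket Q D.form D.scalar a.swap a) := by
  have hvalue := arrowBracket_swap (η := D.scalar) D.isTailForm a.swap
  rw [Sum.swap_swap, D.isTailForm.antisymm a.swap a] at hvalue
  rw [h.map_arr_of_ne _ (swap_ne a), h.map_arr_self, hvalue,
    (D.flip a).isFormBracket_br.arr_swap_flipArr D.isTailForm (D.flip a).scalar_swap,
    D.flip_scalar_self, D.scalar_swap]
  simp only [pairTerm, map_smul, map_sub, map_add, map_mul, Algebra.TensorProduct.map_tmul,
    Sum.swap_swap, h.map_idem, h.map_arr_self, h.map_arr_of_ne _ (swap_ne a), OrderDatum.flip]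
  module

theorem br_map_of_ne_of_ne_swap (hp : p ≠ a) (hp' : p ≠ a.swap) :
    (D.flip a).br (ψ (𝐱 p)) (ψ (𝐱 a)) = tensorSq ψ (arrowBracket Q D.form D.scalar p a) := by
  have hne : p.swap ≠ a := fun heq => hp' (swap_eq_iff.1 heq)
  rw [h.map_arr_of_ne p hp, h.map_arr_self,
    (D.flip a).isFormBracket_br.arr_flipArr (D.flip a).scalar_swap,
    gaugeTerm_diagForm_of_ne hp hne, if_neg hne.symm, arrowBracket, if_neg hne.symm]
  simp only [map_sub, map_mul, map_one, Algebra.TensorProduct.map_tmul, h.map_arr_self,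
    h.tensorSq_gaugeTerm hp, smul_zero, zero_mul, add_zero, sub_zero, mul_zero,
    OrderDatum.flip]

omit [NeZero (2 : k)] in
theorem br_map_of_ne_of_ne (hp : p ≠ a) (hq : q ≠ a) :
    (D.flip a).br (ψ (𝐱 p)) (ψ (𝐱 q)) = tensorSq ψ (arrowBracket Q D.form D.scalar p q) := by
  classical
  have hite : tensorSq ψ (if q = p.swap then D.scalar p • pairTerm k Q p else 0) =
      if q = p.swap then (D.flip a).scalar p • pairTerm k Q p else 0 := by
    split_ifs with heq
    · have hp' : p ≠ a.swap := fun h => hq (by rw [heq, h, Sum.swap_swap])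
      rw [map_smul, D.flip_scalar_of_ne hp hp', h.tensorSq_pairTerm hp (heq ▸ hq)]
    · exact map_zero _
  rw [h.map_arr_of_ne p hp, h.map_arr_of_ne q hq, (D.flip a).isFormBracket_br.arr_arr,
    arrowBracket, arrowBracket, map_add, map_sub, map_mul, map_mul, h.tensorSq_gaugeTerm hp,
    h.tensorSq_gaugeTerm hp, hite]
  simp only [Algebra.TensorProduct.map_tmul, map_one, h.map_arr_of_ne q hq, OrderDatum.flip]

theorem br_map : (D.flip a).br (ψ (𝐱 p)) (ψ (𝐱 q)) =
    tensorSq ψ (arrowBracket Q D.form D.scalar p q) := by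
  have hright (p : E ⊕ E) : (D.flip a).br (ψ (𝐱 p)) (ψ (𝐱 a)) =
      tensorSq ψ (arrowBracket Q D.form D.scalar p a) := by
    rcases eq_or_ne p a with rfl | hp
    · exact h.br_map_self D
    rcases eq_or_ne p a.swap with rfl | hp'
    · exact h.br_map_swap_self D
    · exact h.br_map_of_ne_of_ne_swap D hp hp'
  rcases eq_or_ne q a with rfl | hq
  · exact hright p
  rcases eq_or_ne p a with rfl | hp
  · have hq := hright q
    rw [← D.isFormBracket_br.arr_arr] at hq ⊢
    exact bracket_map_symm D.isFormBracket_br.isDoubleBracket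
      (D.flip p).isFormBracket_br.isDoubleBracket hq
  · exact h.br_map_of_ne_of_ne D hp hq

omit [NeZero (2 : k)] in
theorem map_moment (s : I) : ψ (D.moment s) = (D.flip a).moment s := by
  refine OrderDatum.map_moment h.map_idem id (List.map_id _).symm fun p _ => ?_
  rw [id, OrderDatum.factor.eq_def (D.flip a)]
  rcases eq_or_ne p a with rfl | hp
  · rw [D.map_factor h.map_zUnit, D.flip_sign_self, Units.val_neg, inv_zpow, zpow_neg]
  rcases eq_or_ne p a.swap with rfl | hp'
  · rw [D.map_factor h.map_zUnit_swap, D.flip_sign_swap, Units.val_neg, inv_zpow, zpow_neg]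
  · rw [D.flip_sign_of_ne hp hp', D.map_factor (h.map_zUnit_of_ne hp hp')]

end IsFlip

variable [NeZero (2 : k)]

theorem OrderDatum.equivalent_flip (D : OrderDatum k Q) (a : E ⊕ E) : D.Equivalent (D.flip a) :=
  have ⟨ψ, h⟩ := exists_isFlip k Q a
  equivalent_of_arr ψ ψ h.comp_self h.comp_self h.map_idem (fun _ _ => h.br_map D) (h.map_moment D)

theorem OrderDatum.exists_equivalent_sign_eq_on (D : OrderDatum k Q) (σ : E → ℤˣ) (S : Finset E) :
    ∃ D' : OrderDatum k Q, D'.form = D.form ∧ D'.list = D.list ∧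
      (∀ x ∈ S, D'.sign (Sum.inl x) = σ x) ∧ D.Equivalent D' := by
  classical
  induction S using Finset.induction_on with
  | empty => exact ⟨D, rfl, rfl, by simp, .refl D⟩
  | insert x S hx ih =>
    obtain ⟨D', hform, hlist, hsign, hequiv⟩ := ih
    rcases eq_or_ne (D'.sign (Sum.inl x)) (σ x) with h | h
    · exact ⟨D', hform, hlist, Finset.forall_mem_insert .. |>.2 ⟨h, hsign⟩, hequiv⟩
    refine ⟨D'.flip (Sum.inl x), hform, hlist,
      Finset.forall_mem_insert .. |>.2 ⟨?_, fun y hy => ?_⟩, hequiv.trans (D'.equivalent_flip _)⟩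
    · rw [flip_sign_self, Int.units_ne_iff_eq_neg.1 h, neg_neg]
    · rw [D'.flip_sign_of_ne (by rintro ⟨⟩; exact hx hy) (by simp), hsign y hy]

theorem OrderDatum.exists_equivalent_sign_eq [Finite E] (D : OrderDatum k Q) {σ : E ⊕ E → ℤˣ}
    (hσ : ∀ p, σ p.swap = -σ p) : ∃ D' : OrderDatum k Q,
      D'.form = D.form ∧ D'.list = D.list ∧ D'.sign = σ ∧ D.Equivalent D' := by
  have := Fintype.ofFinite E
  obtain ⟨D', hform, hlist, hsign, hequiv⟩ :=
    D.exists_equivalent_sign_eq_on (fun x => σ (Sum.inl x)) Finset.univ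
  refine ⟨D', hform, hlist, funext fun p => ?_, hequiv⟩
  rcases p with x | x
  · exact hsign x (Finset.mem_univ x)
  · exact ((D'.sign_swap (Sum.inl x)).trans (congrArg Neg.neg (hsign x (Finset.mem_univ x)))).trans
      (hσ (Sum.inl x)).symm

end Flip

/-! ### Conjugation by a factor of the moment map -/

section Conj

variable {k : Type*} [Field k] {A : Type*} [Ring A] [Algebra k A]
  {br : A →ₗ[k] A →ₗ[k] A ⊗[k] A} {u : Aˣ} {x s e f : A} {θ η : k}

namespace IsDoubleBracket

theorem conj_self (hb : IsDoubleBracket br) (hθ : θ = 0 ∨ e = f)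
    (hex : e * x = x) (heu : Commute e u.val)
    (hxu : br x u = innerDoubleDer ((1 / 2 : k) • (θ • (f ⊗ₜ[k] x) - x ⊗ₜ[k] e)) u.val)
    (hxx : br x x = ((1 / 2 : k) * θ) • ((x * x) ⊗ₜ[k] e - f ⊗ₜ[k] (x * x)))
    (huxu : br (u * x) u =
      innerDoubleDer ((1 / 2 : k) • ((u * x) ⊗ₜ[k] e + θ • (f ⊗ₜ[k] (u * x)))) u.val) :
    br (u * x) (u * x) = ((1 / 2 : k) * θ) •
      ((u * x * (u * x)) ⊗ₜ[k] e - f ⊗ₜ[k] (u * x * (u * x))) := by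
  rw [hb.deriv, huxu, hb.map_mul_left, hb.antisymm u.val x, hxu, hxx]
  rcases hθ with rfl | rfl <;>
    simp only [innerDoubleDer_apply, mul_add, add_mul, mul_sub, sub_mul, smul_mul_assoc,
      mul_smul_comm, neg_mul, mul_neg, Algebra.TensorProduct.tmul_mul_tmul, one_mul, mul_one,
      map_sub, map_smul, TensorProduct.comm_tmul, mul_assoc, heu.eq, hex, zero_smul, mul_zero,
      zero_mul, map_zero] <;>
    module

theorem conj_swap (hb : IsDoubleBracket br) (hθ : θ = 0 ∨ e = f) (hse : s * e = s)
    (heu : Commute e u.val)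
    (hsu : br s u = innerDoubleDer ((1 / 2 : k) • (e ⊗ₜ[k] s - θ • (s ⊗ₜ[k] f))) u.val)
    (hss : br s s = -((1 / 2 : k) * θ) • ((s * s) ⊗ₜ[k] f - e ⊗ₜ[k] (s * s)))
    (hsuu : br (s * ↑u⁻¹) u = -innerDoubleDer
      ((1 / 2 : k) • (e ⊗ₜ[k] (s * ↑u⁻¹) + θ • ((s * ↑u⁻¹) ⊗ₜ[k] f))) u.val) :
    br (s * ↑u⁻¹) (s * ↑u⁻¹) = -((1 / 2 : k) * θ) •
      ((s * ↑u⁻¹ * (s * ↑u⁻¹)) ⊗ₜ[k] f - e ⊗ₜ[k] (s * ↑u⁻¹ * (s * ↑u⁻¹))) := by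
  have heu' : e * ↑u⁻¹ = ↑u⁻¹ * e := heu.units_inv_right.eq
  have hsu' : s * (↑u⁻¹ * e) = s * ↑u⁻¹ := by rw [← heu', ← mul_assoc, hse]
  rw [hb.deriv, (hb.isDer_right _).map_inv, hsuu, hb.map_mul_left _ _ s,
    hb.antisymm (u⁻¹).val, (hb.isDer_right _).map_inv, hsu, hss]
  rcases hθ with rfl | rfl <;>
    simp only [innerDoubleDer_apply, mul_add, add_mul, mul_sub, sub_mul, smul_mul_assoc,
      mul_smul_comm, neg_mul, mul_neg, Algebra.TensorProduct.includeLeft_apply,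
      Algebra.TensorProduct.includeRight_apply, Algebra.TensorProduct.tmul_mul_tmul, one_mul,
      mul_one, map_sub, map_neg, map_smul, TensorProduct.comm_tmul, mul_assoc, heu.eq,
      heu', hse, hsu', Units.mul_inv, Units.inv_mul, Units.mul_inv_cancel_left,
      Units.inv_mul_cancel_left, zero_smul, mul_zero, zero_mul, map_zero] <;>
    module

theorem conj_pair (hb : IsDoubleBracket br) (hθ : θ = 0 ∨ e = f) (hex : e * x = x)
    (hse : s * e = s) (heu : Commute e u.val)
    (hsu : br s u = innerDoubleDer ((1 / 2 : k) • (e ⊗ₜ[k] s - θ • (s ⊗ₜ[k] f))) u.val)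
    (hxs : br x s = η • (f ⊗ₜ[k] e + (1 / 2 : k) • ((s * x) ⊗ₜ[k] e)
      + (1 / 2 : k) • (f ⊗ₜ[k] (x * s))) + ((1 / 2 : k) * θ) • (s ⊗ₜ[k] x - x ⊗ₜ[k] s))
    (huxu : br (u * x) u =
      innerDoubleDer ((1 / 2 : k) • ((u * x) ⊗ₜ[k] e + θ • (f ⊗ₜ[k] (u * x)))) u.val) :
    br (u * x) (s * ↑u⁻¹) = η • (f ⊗ₜ[k] e + (1 / 2 : k) • ((s * ↑u⁻¹ * (u * x)) ⊗ₜ[k] e)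
        + (1 / 2 : k) • (f ⊗ₜ[k] (u * x * (s * ↑u⁻¹))))
      + ((1 / 2 : k) * θ) • ((s * ↑u⁻¹) ⊗ₜ[k] (u * x) - (u * x) ⊗ₜ[k] (s * ↑u⁻¹)) := by
  have heu' : e * ↑u⁻¹ = ↑u⁻¹ * e := heu.units_inv_right.eq
  have hsu' : s * (↑u⁻¹ * e) = s * ↑u⁻¹ := by rw [← heu', ← mul_assoc, hse]
  rw [hb.deriv, (hb.isDer_right _).map_inv, huxu, hb.map_mul_left _ _ s,
    hb.antisymm u.val s, hsu, hxs]
  rcases hθ with rfl | rfl <;>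
    simp only [innerDoubleDer_apply, mul_add, add_mul, mul_sub, sub_mul, smul_mul_assoc,
      mul_smul_comm, neg_mul, mul_neg, Algebra.TensorProduct.includeLeft_apply,
      Algebra.TensorProduct.includeRight_apply, Algebra.TensorProduct.tmul_mul_tmul, one_mul,
      mul_one, map_sub, map_smul, TensorProduct.comm_tmul, mul_assoc, heu.eq,
      heu', hex, hse, hsu', Units.mul_inv, Units.mul_inv_cancel_left,
      Units.inv_mul_cancel_left, zero_smul, mul_zero, zero_mul, map_zero] <;>
    module

end IsDoubleBracket
end Conj

/-! ### Exchanging two neighbouring factors -/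

section Transpose

variable {k : Type*} [Field k] {I E : Type*} {Q : FinQuiver I E}

namespace OrderDatum

open Classical in
/-- The datum with the arrows `b` and `a` exchanged in the lists and in the form. -/
def transpose (D : OrderDatum k Q) {a b : E ⊕ E} (ht : Q.double.t b = Q.double.t a) :
    OrderDatum k Q where
  form p q := D.form (Equiv.swap b a p) (Equiv.swap b a q)
  sign := D.sign
  list s := (D.list s).map (Equiv.swap b a)
  isTailForm := by
    refine ⟨fun _ => D.isTailForm.self _, fun _ _ => D.isTailForm.antisymm _ _,
      fun p q hpq => D.isTailForm.eq_zero _ _ ?_⟩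
    rwa [Equiv.apply_swap_eq_self ht, Equiv.apply_swap_eq_self ht]
  sign_swap := D.sign_swap
  mem_list s p := by
    rw [← Equiv.apply_swap_eq_self ht p, ← D.mem_list]
    conv_lhs => rw [← Equiv.swap_apply_self b a p]
    exact List.mem_map_of_injective (Equiv.injective _)
  pairwise s := by
    rw [List.pairwise_map]
    simpa only [Equiv.swap_apply_self] using D.pairwise s

/-- The arrow `b` comes directly before the arrow `a`, expressed through the form. -/
structure IsAdjacent (D : OrderDatum k Q) (b a : E ⊕ E) : Prop where
  tail_eq : Q.double.t b = Q.double.t a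
  form_eq_one : D.form b a = 1
  form_eq : ∀ p, p ≠ b → p ≠ a → D.form p b = D.form p a

variable {D : OrderDatum k Q} {a b p q : E ⊕ E}

theorem isAdjacent_of_list {s : I} {pre l : List (E ⊕ E)} (hlist : D.list s = pre ++ b :: a :: l) :
    D.IsAdjacent b a := by
  have hlist' : D.list s = (pre ++ [b]) ++ a :: l := by simp [hlist]
  have hb : Q.double.t b = s := (D.mem_list s b).1 (by simp [hlist])
  have ha : Q.double.t a = s := (D.mem_list s a).1 (by simp [hlist])
  refine ⟨hb.trans ha.symm, form_eq_one_of_mem_right hlist (by simp), fun p hpb hpa => ?_⟩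
  by_cases hp : Q.double.t p = s
  · have hmem := (D.mem_list s p).2 hp
    simp only [hlist, List.mem_append, List.mem_cons, hpa, hpb, false_or] at hmem
    rcases hmem with hmem | hmem
    · rw [form_eq_one_of_mem_left hlist hmem, form_eq_one_of_mem_left hlist' (by simp [hmem])]
    · rw [D.isTailForm.antisymm p b, D.isTailForm.antisymm p a,
        form_eq_one_of_mem_right hlist (by simp [hmem]), form_eq_one_of_mem_right hlist' hmem]
  · rw [D.isTailForm.eq_zero p b (by rwa [hb]), D.isTailForm.eq_zero p a (by rwa [ha])]

namespace IsAdjacent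

variable (h : D.IsAdjacent b a)

include h

theorem ne : b ≠ a := ne_of_form h.form_eq_one

theorem transpose_form_self : (D.transpose h.tail_eq).form b a = -1 := by
  simp [transpose, D.isTailForm.antisymm a b, h.form_eq_one]

theorem transpose_form_left (hp : p ≠ b) (hp' : p ≠ a) :
    (D.transpose h.tail_eq).form p b = D.form p b := by
  classical
  simp [transpose, Equiv.swap_apply_of_ne_of_ne hp hp', h.form_eq p hp hp']

theorem transpose_form_of_ne (hp : p ≠ b) (hq : q ≠ b) :
    (D.transpose h.tail_eq).form p q = D.form p q := by
  classical
  have hright (p : E ⊕ E) (hp : p ≠ b) : (D.transpose h.tail_eq).form p a = D.form p a := by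
    rcases eq_or_ne p a with rfl | hp'
    · rw [(D.transpose h.tail_eq).isTailForm.self, D.isTailForm.self]
    · simp [transpose, Equiv.swap_apply_of_ne_of_ne hp hp', h.form_eq p hp hp']
  rcases eq_or_ne q a with rfl | hq'
  · exact hright p hp
  rcases eq_or_ne p a with rfl | hp'
  · rw [(D.transpose h.tail_eq).isTailForm.antisymm, hright q hq, D.isTailForm.antisymm p]
  · simp [transpose, Equiv.swap_apply_of_ne_of_ne, *]

theorem transpose_form_add_diagForm (hp : p ≠ b) :
    ((D.transpose h.tail_eq).form + diagForm k : E ⊕ E → E ⊕ E → k) p a =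
      (D.transpose h.tail_eq).form p b := by
  rcases eq_or_ne p a with rfl | hp'
  · simp [transpose, diagForm, D.isTailForm.self, h.form_eq_one]
  · simp [h.transpose_form_left hp hp', h.transpose_form_of_ne hp h.ne.symm, diagForm, hp',
      h.form_eq p hp hp']

theorem transpose_form_sub_diagForm (hp : p ≠ b) :
    ((D.transpose h.tail_eq).form + -diagForm k : E ⊕ E → E ⊕ E → k) p a =
      D.form p b := by
  rcases eq_or_ne p a with rfl | hp'
  · simp [transpose, diagForm, D.isTailForm.self, D.isTailForm.antisymm p b, h.form_eq_one]
  · simp [h.transpose_form_of_ne hp h.ne.symm, diagForm, hp', h.form_eq p hp hp']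

theorem transpose_form_swap (hne : b.swap ≠ a) :
    (D.transpose h.tail_eq).form b b.swap = D.form b b.swap := by
  rw [(isTailForm _).antisymm, h.transpose_form_left (swap_ne b) hne, ← D.isTailForm.antisymm]

theorem transpose_form_swap_left (hne : b.swap ≠ a) :
    (D.transpose h.tail_eq).form b.swap a = -D.form b b.swap := by
  rw [h.transpose_form_of_ne (swap_ne b) h.ne.symm, ← h.form_eq _ (swap_ne b) hne,
    D.isTailForm.antisymm]

end IsAdjacent

end OrderDatum

variable [Fintype I]

local notation "𝐞" => idem k Q
local notation "𝐱" => arr k Q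
local notation "𝐭" => FinQuiver.t (FinQuiver.double Q)

/-- The endomorphism of `AQ k Q` over `B` which sends `b` to `u b` and `b^*` to `b^* u⁻¹`, and
fixes the other arrows. -/
structure IsConj (b : E ⊕ E) (u : (AQ k Q)ˣ) (ψ : AQ k Q →ₐ[k] AQ k Q) : Prop where
  map_idem : ∀ s, ψ (𝐞 s) = 𝐞 s
  map_arr_self : ψ (𝐱 b) = u * 𝐱 b
  map_arr_swap : ψ (𝐱 b.swap) = 𝐱 b.swap * ↑u⁻¹
  map_arr_of_ne : ∀ p, p ≠ b → p ≠ b.swap → ψ (𝐱 p) = 𝐱 p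

theorem one_add_conj (b : E ⊕ E) (u : (AQ k Q)ˣ) :
    1 + u * 𝐱 b * (𝐱 b.swap * ↑u⁻¹) = (u * zUnit k Q b * u⁻¹).val := by
  rw [Units.val_mul, Units.val_mul, coe_zUnit, mul_add, add_mul, mul_one, Units.mul_inv]
  noncomm_ring

theorem one_add_conj_swap (b : E ⊕ E) (u : (AQ k Q)ˣ) :
    1 + 𝐱 b.swap * ↑u⁻¹ * (u * 𝐱 b) = (zUnit k Q b.swap).val := by
  rw [mul_assoc, Units.inv_mul_cancel_left, coe_zUnit, Sum.swap_swap]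

theorem exists_isConj {b : E ⊕ E} {u : (AQ k Q)ˣ} (hu : Commute (𝐞 (𝐭 b)) u.val) :
    ∃ ψ : AQ k Q →ₐ[k] AQ k Q, IsConj b u ψ := by
  classical
  let x : E ⊕ E → AQ k Q :=
    Function.update (Function.update 𝐱 b.swap (𝐱 b.swap * ↑u⁻¹)) b (u * 𝐱 b)
  have hself : x b = u * 𝐱 b := Function.update_self ..
  have hswap : x b.swap = 𝐱 b.swap * ↑u⁻¹ := by
    rw [← Function.update_self b.swap (𝐱 b.swap * ↑u⁻¹) 𝐱]
    exact Function.update_of_ne (swap_ne b) ..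
  have hne (p : E ⊕ E) (hp : p ≠ b) (hp' : p ≠ b.swap) : x p = 𝐱 p :=
    (Function.update_of_ne hp ..).trans (Function.update_of_ne hp' ..)
  have hmem (p : E ⊕ E) : 𝐞 (𝐭 p) * x p * 𝐞 (𝐭 p.swap) = x p := by
    rcases eq_or_ne p b with rfl | hp
    · rw [hself, ← mul_assoc, hu.eq, mul_assoc, mul_assoc, arr_mul_idem, idem_mul_arr]
    rcases eq_or_ne p b.swap with rfl | hp'
    · rw [hswap, Sum.swap_swap, mul_assoc, mul_assoc, ← hu.units_inv_right.eq,
        ← mul_assoc (𝐱 b.swap), arr_swap_mul_idem, ← mul_assoc, idem_mul_arr]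
    · rw [hne p hp hp', idem_mul_arr, arr_mul_idem]
  have hunit (p : E ⊕ E) : IsUnit (1 + x p * x p.swap) := by
    rcases eq_or_ne p b with rfl | hp
    · rw [hself, hswap, one_add_conj]
      exact Units.isUnit _
    rcases eq_or_ne p b.swap with rfl | hp'
    · rw [Sum.swap_swap, hself, hswap, one_add_conj_swap]
      exact Units.isUnit _
    · rw [hne p hp hp', hne p.swap (fun h => hp' (swap_eq_iff.1 h))
        (fun h => hp (Sum.swap_leftInverse.injective h)), ← coe_zUnit]
      exact Units.isUnit _
  obtain ⟨ψ, hidem, harr⟩ := AQ.exists_lift (k := k) (Q := Q)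
    (completeOrthogonalIdempotents_idem k Q) hmem hunit
  exact ⟨ψ, hidem, (harr b).trans hself, (harr b.swap).trans hswap,
    fun p hp hp' => (harr p).trans (hne p hp hp')⟩

namespace IsConj

variable {a b : E ⊕ E} {u : (AQ k Q)ˣ} {ψ ψ' : AQ k Q →ₐ[k] AQ k Q} (h : IsConj b u ψ)
  {p q : E ⊕ E} (D : OrderDatum k Q)

include h

theorem map_zUnit_self : ψ (zUnit k Q b).val = (u * zUnit k Q b * u⁻¹).val := by
  rw [coe_zUnit, map_add, map_one, map_mul, h.map_arr_self, h.map_arr_swap, one_add_conj]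

theorem map_zUnit_of_ne (hp : p ≠ b) : ψ (zUnit k Q p).val = (zUnit k Q p).val := by
  rcases eq_or_ne p b.swap with rfl | hp'
  · refine Eq.trans ?_ (one_add_conj_swap b u)
    rw [coe_zUnit, map_add, map_one, map_mul, Sum.swap_swap, h.map_arr_self, h.map_arr_swap]
  · rw [coe_zUnit, map_add, map_one, map_mul, h.map_arr_of_ne p hp hp',
      h.map_arr_of_ne _ (fun heq => hp' (swap_eq_iff.1 heq))
      (fun heq => hp (Sum.swap_leftInverse.injective heq))]

theorem map_factor_of_ne (hp : p ≠ b) :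
    Units.map (ψ : AQ k Q →* AQ k Q) (D.factor p) = D.factor p :=
  D.map_factor (h.map_zUnit_of_ne hp)

theorem map_prod_factor_of_notMem {l : List (E ⊕ E)} (hb : b ∉ l) :
    Units.map (ψ : AQ k Q →* AQ k Q) (l.map D.factor).prod = (l.map D.factor).prod := by
  rw [map_list_prod, List.map_map]
  exact congrArg List.prod (List.map_congr_left fun p hp =>
    h.map_factor_of_ne D (ne_of_mem_of_not_mem hp hb))

theorem map_factor_self :
    Units.map (ψ : AQ k Q →* AQ k Q) (D.factor b) = u * D.factor b * u⁻¹ := by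
  rw [D.map_factor h.map_zUnit_self, conj_zpow]
  rfl

theorem comp_eq_id (h' : IsConj b u⁻¹ ψ')
    (hu : Units.map (ψ' : AQ k Q →* AQ k Q) u = u) : ψ'.comp ψ = AlgHom.id k _ := by
  have hu' : ψ' u.val = u.val := congrArg Units.val hu
  have hu_inv : ψ' ↑u⁻¹ = (u⁻¹).val :=
    congrArg Units.val ((map_inv (Units.map (ψ' : AQ k Q →* AQ k Q)) u).trans (congrArg _ hu))
  refine AQ.algHom_ext (fun s => by simp [h.map_idem, h'.map_idem]) (fun p => ?_)
  rw [AlgHom.comp_apply, AlgHom.id_apply]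
  rcases eq_or_ne p b with rfl | hp
  · rw [h.map_arr_self, map_mul, h'.map_arr_self, hu', Units.mul_inv_cancel_left]
  rcases eq_or_ne p b.swap with rfl | hp'
  · rw [h.map_arr_swap, map_mul, h'.map_arr_swap, hu_inv, inv_inv, Units.mul_inv_cancel_right]
  · rw [h.map_arr_of_ne p hp hp', h'.map_arr_of_ne p hp hp']

theorem tensorSq_gaugeTerm (hp : p ≠ b) (hp' : p ≠ b.swap) (O : E ⊕ E → E ⊕ E → k) :
    tensorSq ψ (gaugeTerm Q O p q) = gaugeTerm Q O p q := by
  simp only [gaugeTerm, map_smul, map_sub, Algebra.TensorProduct.map_tmul, h.map_idem,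
    h.map_arr_of_ne p hp hp']

theorem tensorSq_pairTerm (hp : p ≠ b) (hp' : p ≠ b.swap) :
    tensorSq ψ (pairTerm k Q p) = pairTerm k Q p := by
  simp only [pairTerm, map_smul, map_add, map_mul, Algebra.TensorProduct.map_tmul, h.map_idem,
    h.map_arr_of_ne p hp hp', h.map_arr_of_ne _ (fun heq => hp' (swap_eq_iff.1 heq))
      (fun heq => hp (Sum.swap_leftInverse.injective heq))]

end IsConj

end Transpose

section TransposeBracket

variable {k : Type*} [Field k] {I E : Type*} {Q : FinQuiver I E} [Fintype I]

local notation "𝐞" => idem k Q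
local notation "𝐱" => arr k Q
local notation "𝐭" => FinQuiver.t (FinQuiver.double Q)

theorem tensorSq_innerDoubleDer (ψ : AQ k Q →ₐ[k] AQ k Q) (m : AQ k Q ⊗[k] AQ k Q) (x : AQ k Q) :
    tensorSq ψ (innerDoubleDer m x) = innerDoubleDer (tensorSq ψ m) (ψ x) := by
  simp only [innerDoubleDer_apply, map_sub, map_mul, Algebra.TensorProduct.map_tmul, map_one]

theorem IsDer.map_factor_eq_zero {M : Type*} [Ring M] [Algebra k M] {l r : AQ k Q →ₐ[k] M}
    {d : AQ k Q →ₗ[k] M} (hd : IsDer l r d) (D : OrderDatum k Q) {p : E ⊕ E} (hp : d (𝐱 p) = 0)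
    (hp' : d (𝐱 p.swap) = 0) : d (D.factor p).val = 0 := by
  have hz : d (zUnit k Q p).val = 0 := by
    rw [coe_zUnit, map_add, hd.map_one, hd, hp, hp', zero_mul, mul_zero, add_zero, add_zero]
  obtain ⟨hfactor, -⟩ | ⟨hfactor, -⟩ := D.factor_eq_or p
  · rw [hfactor, hz]
  · rw [hfactor, hd.map_inv, hz, mul_zero, zero_mul, neg_zero]

namespace OrderDatum

theorem form_swap_eq_zero_or (D : OrderDatum k Q) (p : E ⊕ E) :
    D.form p p.swap = 0 ∨ 𝐞 (𝐭 p) = 𝐞 (𝐭 p.swap) := by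
  by_cases hp : 𝐭 p = 𝐭 p.swap
  · exact .inr (congrArg _ hp)
  · exact .inl (D.isTailForm.eq_zero _ _ hp)

variable [NeZero (2 : k)] {D : OrderDatum k Q} {a b p q : E ⊕ E}

theorem arr_factor_of_ne (D : OrderDatum k Q) (hpq : p ≠ q) (hpq' : p.swap ≠ q) :
    D.br (𝐱 p) (D.factor q).val = innerDoubleDer (gaugeTerm Q D.form p q) (D.factor q).val := by
  rw [arr_factor D.isFormBracket_br, gaugeTerm_diagForm_of_ne hpq hpq', add_zero, sub_zero]
  rfl

namespace IsAdjacent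

variable (hadj : D.IsAdjacent b a)

include hadj

omit [NeZero (2 : k)] in
theorem commute_idem_factor : Commute (𝐞 (𝐭 b)) (D.factor a).val :=
  hadj.tail_eq ▸ (commute_idem_zUnit a).units_zpow_right _

omit [NeZero (2 : k)] in
theorem gaugeTerm_transpose_of_ne (hp : p ≠ b) (hp' : p.swap ≠ b) (hq : q ≠ b) :
    gaugeTerm Q (D.transpose hadj.tail_eq).form p q = gaugeTerm Q D.form p q :=
  gaugeTerm_congr (hadj.transpose_form_of_ne hp hq) (hadj.transpose_form_of_ne hp' hq)

theorem transpose_arr_factor (hp : p ≠ b) (hp' : p.swap ≠ b) :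
    (D.transpose hadj.tail_eq).br (𝐱 p) (D.factor a).val =
      ((D.factor a).val ⊗ₜ[k] (1 : AQ k Q)) * gaugeTerm Q (D.transpose hadj.tail_eq).form p b
        - gaugeTerm Q D.form p b * ((1 : AQ k Q) ⊗ₜ[k] (D.factor a).val) := by
  rw [← gaugeTerm_congr (hadj.transpose_form_add_diagForm hp)
      (hadj.transpose_form_add_diagForm hp'), ← gaugeTerm_congr
      (hadj.transpose_form_sub_diagForm hp) (hadj.transpose_form_sub_diagForm hp'),
    gaugeTerm_add, gaugeTerm_add, gaugeTerm_neg, ← sub_eq_add_neg]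
  exact arr_factor (D.transpose hadj.tail_eq).isFormBracket_br p a

end IsAdjacent

end OrderDatum

namespace IsConj

variable [NeZero (2 : k)] {D : OrderDatum k Q} {a b p q : E ⊕ E} {ψ : AQ k Q →ₐ[k] AQ k Q}
  (h : IsConj b (D.factor a) ψ) (hadj : D.IsAdjacent b a)

include h

theorem br_map_of_ne_self (hp : p ≠ b) (hp' : p ≠ b.swap) :
    (D.transpose hadj.tail_eq).br (𝐱 p) (ψ (𝐱 b)) =
      tensorSq ψ (arrowBracket Q D.form D.scalar p b) := by
  have hne : p.swap ≠ b := fun heq => hp' (swap_eq_iff.1 heq)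
  have harr := (D.transpose hadj.tail_eq).isFormBracket_br.arr_arr p b
  rw [arrowBracket, if_neg hne.symm, add_zero,
    hadj.gaugeTerm_transpose_of_ne hp hne (swap_ne b)] at harr
  rw [arrowBracket, if_neg hne.symm, add_zero, map_sub, map_mul, map_mul,
    Algebra.TensorProduct.map_tmul, Algebra.TensorProduct.map_tmul, map_one,
    h.tensorSq_gaugeTerm hp hp', h.tensorSq_gaugeTerm hp hp', h.map_arr_self]
  exact ((D.transpose hadj.tail_eq).isFormBracket_br.isDoubleBracket.isDer_right _).map_mul_of_eq
    (hadj.transpose_arr_factor hp hne) harr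

theorem br_map_of_ne_swap (hp : p ≠ b) (hp' : p ≠ b.swap) :
    (D.transpose hadj.tail_eq).br (𝐱 p) (ψ (𝐱 b.swap)) =
      tensorSq ψ (arrowBracket Q D.form D.scalar p b.swap) := by
  have hne : p.swap ≠ b := fun heq => hp' (swap_eq_iff.1 heq)
  have hne' : b.swap ≠ p.swap := fun heq => hp (Sum.swap_leftInverse.injective heq).symm
  have harr := (D.transpose hadj.tail_eq).isFormBracket_br.arr_arr p b.swap
  rw [arrowBracket, if_neg hne', add_zero, Sum.swap_swap,
    hadj.gaugeTerm_transpose_of_ne hp hne (swap_ne b)] at harr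
  rw [arrowBracket, if_neg hne', add_zero, map_sub, map_mul, map_mul,
    Algebra.TensorProduct.map_tmul, Algebra.TensorProduct.map_tmul, map_one, Sum.swap_swap,
    h.tensorSq_gaugeTerm hp hp', h.tensorSq_gaugeTerm hp hp', h.map_arr_swap]
  have hder := (D.transpose hadj.tail_eq).isFormBracket_br.isDoubleBracket.isDer_right (𝐱 p)
  exact hder.map_mul_of_eq harr (hder.map_inv_of_eq (hadj.transpose_arr_factor hp hne))

theorem br_map_of_ne (hp : p ≠ b) (hp' : p ≠ b.swap) :
    (D.transpose hadj.tail_eq).br (ψ (𝐱 p)) (ψ (𝐱 q)) =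
      tensorSq ψ (arrowBracket Q D.form D.scalar p q) := by
  classical
  rw [h.map_arr_of_ne p hp hp']
  rcases eq_or_ne q b with rfl | hq
  · exact h.br_map_of_ne_self hadj hp hp'
  rcases eq_or_ne q b.swap with rfl | hq'
  · exact h.br_map_of_ne_swap hadj hp hp'
  have hne : p.swap ≠ b := fun heq => hp' (swap_eq_iff.1 heq)
  have hite : tensorSq ψ (if q = p.swap then D.scalar p • pairTerm k Q p else 0) =
      if q = p.swap then D.scalar p • pairTerm k Q p else 0 := by
    rw [apply_ite (tensorSq ψ), map_smul, map_zero, h.tensorSq_pairTerm hp hp']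
  rw [h.map_arr_of_ne q hq hq', (D.transpose hadj.tail_eq).isFormBracket_br.arr_arr, arrowBracket,
    arrowBracket, hadj.gaugeTerm_transpose_of_ne hp hne hq,
    hadj.gaugeTerm_transpose_of_ne hp hne fun heq => hq' (swap_eq_iff.1 heq), map_add, map_sub,
    map_mul, map_mul, hite, h.tensorSq_gaugeTerm hp hp', h.tensorSq_gaugeTerm hp hp']
  simp only [Algebra.TensorProduct.map_tmul, map_one, h.map_arr_of_ne q hq hq']
  rfl

theorem br_map_of_ne_right (hq : q ≠ b) (hq' : q ≠ b.swap) (x : AQ k Q) :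
    (D.transpose hadj.tail_eq).br (ψ x) (ψ (𝐱 q)) = tensorSq ψ (D.br x (𝐱 q)) := by
  have hD := D.isFormBracket_br
  have hD' := (D.transpose hadj.tail_eq).isFormBracket_br
  refine bracket_map_symm hD.isDoubleBracket hD'.isDoubleBracket <|
    bracket_map_of_arr_right hD.isDoubleBracket hD'.isDoubleBracket hD.isBLinear hD'.isBLinear
      h.map_idem (fun p => ?_) x
  rw [h.br_map_of_ne hadj hq hq', hD.arr_arr]

variable (hne : b.swap ≠ a)

include hne

theorem br_map_factor (x : AQ k Q) :
    (D.transpose hadj.tail_eq).br (ψ x) (D.factor a).val =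
      tensorSq ψ (D.br x (D.factor a).val) := by
  have hfactor : ψ (D.factor a).val = (D.factor a).val :=
    congrArg Units.val (h.map_factor_of_ne D hadj.ne.symm)
  have hder := isDer_bracketDefect D.isFormBracket_br.isDoubleBracket
    (D.transpose hadj.tail_eq).isFormBracket_br.isDoubleBracket ψ x
  have hdefect := hder.map_factor_eq_zero D (p := a)
    (sub_eq_zero.2 (h.br_map_of_ne_right hadj hadj.ne.symm hne.symm x))
    (sub_eq_zero.2 (h.br_map_of_ne_right hadj (fun heq => hne (swap_eq_iff.1 heq).symm)
      (fun heq => hadj.ne (Sum.swap_leftInverse.injective heq).symm) x))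
  rw [← sub_eq_zero, ← hdefect]
  exact congrArg (fun y => (D.transpose hadj.tail_eq).br (ψ x) y - _) hfactor.symm

theorem br_map_arr_factor (hp : p ≠ a) (hp' : p.swap ≠ a) :
    (D.transpose hadj.tail_eq).br (ψ (𝐱 p)) (D.factor a).val =
      innerDoubleDer (tensorSq ψ (gaugeTerm Q D.form p a)) (D.factor a).val := by
  rw [h.br_map_factor hadj hne, D.arr_factor_of_ne hp hp', tensorSq_innerDoubleDer]
  exact congrArg _ (congrArg Units.val (h.map_factor_of_ne D hadj.ne.symm))

theorem br_map_self_factor : (D.transpose hadj.tail_eq).br (D.factor a * 𝐱 b) (D.factor a).val =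
    innerDoubleDer ((1 / 2 : k) • ((D.factor a * 𝐱 b) ⊗ₜ[k] 𝐞 (𝐭 b)
      + D.form b b.swap • (𝐞 (𝐭 b.swap) ⊗ₜ[k] (D.factor a * 𝐱 b)))) (D.factor a).val := by
  have hfactor := h.br_map_arr_factor hadj hne hadj.ne hne
  rw [gaugeTerm, hadj.form_eq_one, ← hadj.form_eq _ (swap_ne b) hne, D.isTailForm.antisymm b.swap,
    one_smul, neg_smul, sub_neg_eq_add] at hfactor
  simpa only [map_add, map_smul, Algebra.TensorProduct.map_tmul, h.map_arr_self, h.map_idem]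
    using hfactor

theorem br_map_swap_factor :
    (D.transpose hadj.tail_eq).br (𝐱 b.swap * ↑(D.factor a)⁻¹) (D.factor a).val =
      -innerDoubleDer ((1 / 2 : k) • (𝐞 (𝐭 b) ⊗ₜ[k] (𝐱 b.swap * ↑(D.factor a)⁻¹)
        + D.form b b.swap • ((𝐱 b.swap * ↑(D.factor a)⁻¹) ⊗ₜ[k] 𝐞 (𝐭 b.swap))))
        (D.factor a).val := by
  have hfactor := h.br_map_arr_factor hadj hne hne (by rw [Sum.swap_swap]; exact hadj.ne)
  rw [gaugeTerm, Sum.swap_swap, hadj.form_eq_one, ← hadj.form_eq _ (swap_ne b) hne,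
    D.isTailForm.antisymm b.swap, one_smul, neg_smul, ← neg_add', add_comm, smul_neg,
    map_neg] at hfactor
  have hneg (m : AQ k Q ⊗[k] AQ k Q) (x : AQ k Q) :
      innerDoubleDer (-m) x = -innerDoubleDer m x := by
    simp only [innerDoubleDer_apply, mul_neg, neg_mul, neg_sub_neg, neg_sub]
  simpa only [hneg, map_add, map_smul, Algebra.TensorProduct.map_tmul, h.map_arr_swap, h.map_idem]
    using hfactor

end IsConj

namespace OrderDatum.IsAdjacent

variable [NeZero (2 : k)] {D : OrderDatum k Q} {a b : E ⊕ E} (hadj : D.IsAdjacent b a)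
  (hne : b.swap ≠ a)

include hne

theorem transpose_arr_self_factor : (D.transpose hadj.tail_eq).br (𝐱 b) (D.factor a).val =
    innerDoubleDer ((1 / 2 : k) • (D.form b b.swap • (𝐞 (𝐭 b.swap) ⊗ₜ[k] 𝐱 b)
      - 𝐱 b ⊗ₜ[k] 𝐞 (𝐭 b))) (D.factor a).val := by
  refine ((D.transpose hadj.tail_eq).arr_factor_of_ne hadj.ne hne).trans ?_
  rw [gaugeTerm, hadj.transpose_form_self, hadj.transpose_form_swap_left hne, neg_one_smul,
    neg_smul, neg_sub_neg]
  rfl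

theorem transpose_arr_swap_factor :
    (D.transpose hadj.tail_eq).br (𝐱 b.swap) (D.factor a).val =
    innerDoubleDer ((1 / 2 : k) • (𝐞 (𝐭 b) ⊗ₜ[k] 𝐱 b.swap
      - D.form b b.swap • (𝐱 b.swap ⊗ₜ[k] 𝐞 (𝐭 b.swap)))) (D.factor a).val := by
  refine ((D.transpose hadj.tail_eq).arr_factor_of_ne hne
    (by rw [Sum.swap_swap]; exact hadj.ne)).trans ?_
  rw [gaugeTerm, Sum.swap_swap, hadj.transpose_form_self, hadj.transpose_form_swap_left hne,
    neg_one_smul, neg_smul, neg_sub_neg]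
  rfl

end OrderDatum.IsAdjacent

namespace IsConj

variable [NeZero (2 : k)] {D : OrderDatum k Q} {a b p q : E ⊕ E} {ψ : AQ k Q →ₐ[k] AQ k Q}
  (h : IsConj b (D.factor a) ψ) (hadj : D.IsAdjacent b a) (hne : b.swap ≠ a)

include h hne

theorem br_map_self : (D.transpose hadj.tail_eq).br (ψ (𝐱 b)) (ψ (𝐱 b)) =
    tensorSq ψ (arrowBracket Q D.form D.scalar b b) := by
  have hD' := (D.transpose hadj.tail_eq).isFormBracket_br
  have hbb := hD'.arr_arr b b
  rw [arrowBracket_self (OrderDatum.isTailForm _), hadj.transpose_form_swap hne] at hbb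
  rw [h.map_arr_self, hD'.isDoubleBracket.conj_self (D.form_swap_eq_zero_or b) (idem_mul_arr b)
    hadj.commute_idem_factor (hadj.transpose_arr_self_factor hne) hbb
    (h.br_map_self_factor hadj hne), arrowBracket_self D.isTailForm]
  simp only [map_sub, map_smul, map_mul, Algebra.TensorProduct.map_tmul, h.map_arr_self,
    h.map_idem]

theorem br_map_swap : (D.transpose hadj.tail_eq).br (ψ (𝐱 b.swap)) (ψ (𝐱 b.swap)) =
    tensorSq ψ (arrowBracket Q D.form D.scalar b.swap b.swap) := by
  have hD' := (D.transpose hadj.tail_eq).isFormBracket_br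
  have hss := hD'.arr_arr b.swap b.swap
  rw [arrowBracket_self (OrderDatum.isTailForm _), Sum.swap_swap,
    (OrderDatum.isTailForm _).antisymm b.swap, hadj.transpose_form_swap hne, mul_neg] at hss
  rw [h.map_arr_swap, hD'.isDoubleBracket.conj_swap (D.form_swap_eq_zero_or b)
    (arr_swap_mul_idem b) hadj.commute_idem_factor (hadj.transpose_arr_swap_factor hne) hss
    (h.br_map_swap_factor hadj hne), arrowBracket_self D.isTailForm, Sum.swap_swap,
    D.isTailForm.antisymm b.swap, mul_neg]
  simp only [map_sub, map_smul, map_mul, Algebra.TensorProduct.map_tmul, h.map_arr_swap,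
    h.map_idem]

theorem br_map_self_swap : (D.transpose hadj.tail_eq).br (ψ (𝐱 b)) (ψ (𝐱 b.swap)) =
    tensorSq ψ (arrowBracket Q D.form D.scalar b b.swap) := by
  have hD' := (D.transpose hadj.tail_eq).isFormBracket_br
  have hbs := hD'.arr_arr b b.swap
  rw [arrowBracket_swap (OrderDatum.isTailForm _), hadj.transpose_form_swap hne] at hbs
  rw [h.map_arr_self, h.map_arr_swap, hD'.isDoubleBracket.conj_pair (D.form_swap_eq_zero_or b)
    (idem_mul_arr b) (arr_swap_mul_idem b) hadj.commute_idem_factor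
    (hadj.transpose_arr_swap_factor hne) hbs (h.br_map_self_factor hadj hne),
    arrowBracket_swap D.isTailForm, pairTerm]
  simp only [map_add, map_sub, map_smul, map_mul, Algebra.TensorProduct.map_tmul, h.map_arr_self,
    h.map_arr_swap, h.map_idem]
  rfl

theorem br_map : (D.transpose hadj.tail_eq).br (ψ (𝐱 p)) (ψ (𝐱 q)) =
    tensorSq ψ (arrowBracket Q D.form D.scalar p q) := by
  have hD := D.isFormBracket_br
  have hsymm {p q : E ⊕ E} (hpq : (D.transpose hadj.tail_eq).br (ψ (𝐱 p)) (ψ (𝐱 q)) =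
      tensorSq ψ (arrowBracket Q D.form D.scalar p q)) :
      (D.transpose hadj.tail_eq).br (ψ (𝐱 q)) (ψ (𝐱 p)) =
        tensorSq ψ (arrowBracket Q D.form D.scalar q p) := by
    rw [← hD.arr_arr] at hpq ⊢
    exact bracket_map_symm hD.isDoubleBracket (OrderDatum.isFormBracket_br _).isDoubleBracket
      hpq
  by_cases hp : p ≠ b ∧ p ≠ b.swap
  · exact h.br_map_of_ne hadj hp.1 hp.2
  by_cases hq : q ≠ b ∧ q ≠ b.swap
  · exact hsymm (h.br_map_of_ne hadj hq.1 hq.2)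
  rw [← not_or, not_not] at hp hq
  rcases hp with rfl | rfl <;> rcases hq with rfl | rfl
  · exact h.br_map_self hadj hne
  · exact h.br_map_self_swap hadj hne
  · exact hsymm (h.br_map_self_swap hadj hne)
  · exact h.br_map_swap hadj hne

end IsConj

end TransposeBracket

/-! ### Independence of the orderings -/

section Orderings

theorem list_map_swap_of_notMem {α : Type*} [DecidableEq α] {a b : α} {l : List α} (ha : a ∉ l)
    (hb : b ∉ l) : l.map (Equiv.swap a b) = l :=
  (List.map_congr_left fun _ hc => Equiv.swap_apply_of_ne_of_ne (ne_of_mem_of_not_mem hc ha)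
    (ne_of_mem_of_not_mem hc hb)).trans l.map_id

variable {k : Type*} [Field k] {I E : Type*} {Q : FinQuiver I E}

namespace OrderDatum

theorem ext_of_list {D D' : OrderDatum k Q} (hlist : D.list = D'.list) (hsign : D.sign = D'.sign) :
    D = D' := by
  refine OrderDatum.ext (funext₂ fun p q => ?_) hsign hlist
  by_cases ht : Q.double.t p = Q.double.t q
  · have : Std.Symm fun p q => D.form p q = D'.form p q :=
      ⟨fun p q hpq => by rw [D.isTailForm.antisymm, D'.isTailForm.antisymm, hpq]⟩
    have hpairwise : (D.list (Q.double.t q)).Pairwise fun p q => D.form p q = D'.form p q :=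
      ((D.pairwise _).and (hlist ▸ D'.pairwise _)).imp fun h => h.1.trans h.2.symm
    exact hpairwise.forall_of_forall (fun p _ => by rw [D.isTailForm.self, D'.isTailForm.self])
      ((D.mem_list _ _).2 ht) ((D.mem_list _ _).2 rfl)
  · rw [D.isTailForm.eq_zero p q ht, D'.isTailForm.eq_zero p q ht]

theorem list_perm (D D' : OrderDatum k Q) (s : I) : (D.list s).Perm (D'.list s) :=
  (List.perm_ext_iff_of_nodup (D.nodup s) (D'.nodup s)).2 fun p => by rw [D.mem_list, D'.mem_list]

variable {D : OrderDatum k Q} {a b : E ⊕ E} {s : I} {pre l : List (E ⊕ E)}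

open Classical in
theorem list_map_swap (hlist : D.list s = pre ++ b :: a :: l) :
    (D.list s).map (Equiv.swap b a) = pre ++ a :: b :: l := by
  have hnodup := D.nodup s
  simp only [hlist, List.nodup_append, List.nodup_cons, List.mem_cons, not_or] at hnodup
  obtain ⟨-, ⟨⟨-, hbl⟩, hal, -⟩, hpre⟩ := hnodup
  rw [hlist, List.map_append, List.map_cons, List.map_cons, Equiv.swap_apply_left,
    Equiv.swap_apply_right, list_map_swap_of_notMem hbl hal,
    list_map_swap_of_notMem (fun hb => hpre b hb b (.inl rfl) rfl)
      (fun ha => hpre a ha a (.inr (.inl rfl)) rfl)]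

open Classical in
theorem list_map_swap_of_ne (hlist : D.list s = pre ++ b :: a :: l) {s' : I} (hs : s' ≠ s) :
    (D.list s').map (Equiv.swap b a) = D.list s' := by
  have hnotMem {p : E ⊕ E} (hp : p ∈ D.list s) : p ∉ D.list s' := fun hp' =>
    hs (((D.mem_list _ _).1 hp').symm.trans ((D.mem_list _ _).1 hp))
  exact list_map_swap_of_notMem (hnotMem (by simp [hlist])) (hnotMem (by simp [hlist]))

open Classical in
theorem map_swap_eq_update (hlist : D.list s = pre ++ b :: a :: l) :
    (fun s' => (D.list s').map (Equiv.swap b a)) =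
      Function.update D.list s (pre ++ a :: b :: l) := by
  funext s'
  rcases eq_or_ne s' s with rfl | hs
  · rw [list_map_swap hlist, Function.update_self]
  · rw [list_map_swap_of_ne hlist hs, Function.update_of_ne hs]

variable [Fintype I]

/- With `u` the factor of `a`, the map `ψ` turns the factor `v` of `b` into `u v u⁻¹`, hence `v u`
into `u v`. -/
theorem map_moment_of_isConj {ψ : AQ k Q →ₐ[k] AQ k Q}
    (h : IsConj b (D.factor a) ψ) (hlist : D.list s = pre ++ b :: a :: l)
    (ht : Q.double.t b = Q.double.t a) (s' : I) :
    ψ (D.moment s') = (D.transpose ht).moment s' := by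
  classical
  rcases eq_or_ne s' s with rfl | hs
  · have hnodup := D.nodup s'
    simp only [hlist, List.nodup_append, List.nodup_cons, List.mem_cons, not_or] at hnodup
    obtain ⟨-, ⟨⟨hba, hbl⟩, -, -⟩, hpre⟩ := hnodup
    have hlist' : (D.transpose ht).list s' = pre ++ a :: b :: l := list_map_swap hlist
    have hprod : Units.map (ψ : AQ k Q →* AQ k Q) (D.factorProd s') =
        (D.transpose ht).factorProd s' := by
      change _ = (((D.transpose ht).list s').map D.factor).prod
      simp only [factorProd, hlist, hlist', List.map_append, List.map_cons, List.prod_append,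
        List.prod_cons, map_mul, h.map_prod_factor_of_notMem D hbl,
        h.map_prod_factor_of_notMem D fun hb => hpre b hb b (.inl rfl) rfl,
        h.map_factor_of_ne D (Ne.symm hba), h.map_factor_self D]
      group
    rw [moment, moment, map_mul, h.map_idem, ← hprod]
    rfl
  · refine map_moment h.map_idem id ?_ fun p hp => h.map_factor_of_ne D ?_
    · rw [List.map_id]
      exact list_map_swap_of_ne hlist hs
    · rintro rfl
      exact hs (((D.mem_list _ _).1 hp).symm.trans ((D.mem_list s p).1 (by simp [hlist])))

theorem equivalent_transpose [NeZero (2 : k)] (hlist : D.list s = pre ++ b :: a :: l)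
    (hne : b.swap ≠ a) (ht : Q.double.t b = Q.double.t a) : D.Equivalent (D.transpose ht) := by
  have hadj := isAdjacent_of_list hlist
  obtain ⟨ψ, h⟩ := exists_isConj hadj.commute_idem_factor
  obtain ⟨ψ', h'⟩ := exists_isConj hadj.commute_idem_factor.units_inv_right
  have hψ := h.map_factor_of_ne D hadj.ne.symm
  have hψ' := h'.map_factor_of_ne D hadj.ne.symm
  exact equivalent_of_arr ψ ψ' (h'.comp_eq_id (by rwa [inv_inv]) (by rw [map_inv, hψ]))
    (h.comp_eq_id h' hψ') h.map_idem (fun _ _ => h.br_map hadj hne)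
    (map_moment_of_isConj h hlist ht)

variable [NeZero (2 : k)] [Finite E]

open Classical in
theorem exists_equivalent_swap (hlist : D.list s = pre ++ b :: a :: l) :
    ∃ D' : OrderDatum k Q, D'.list = Function.update D.list s (pre ++ a :: b :: l) ∧
      D'.sign = D.sign ∧ D.Equivalent D' := by
  have ht := (isAdjacent_of_list hlist).tail_eq
  rw [← map_swap_eq_update hlist]
  rcases ne_or_eq b.swap a with hne | rfl
  · exact ⟨D.transpose ht, rfl, rfl, equivalent_transpose hlist hne ht⟩
  -- Exchanging `b` and `b^*` is a relabelling, which spoils only the signs.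
  have hswap (p : E ⊕ E) : Equiv.swap b b.swap p.swap = (Equiv.swap b b.swap p).swap := by
    rcases eq_or_ne p b with rfl | hp
    · rw [Equiv.swap_apply_left, Equiv.swap_apply_right, Sum.swap_swap]
    rcases eq_or_ne p b.swap with rfl | hp'
    · rw [Sum.swap_swap, Equiv.swap_apply_left, Equiv.swap_apply_right]
    · rw [Equiv.swap_apply_of_ne_of_ne hp hp', Equiv.swap_apply_of_ne_of_ne
        (fun heq => hp' (swap_eq_iff.1 heq)) (fun heq => hp (Sum.swap_leftInverse.injective heq))]
  have ⟨D', _, hlist', hsign, hequiv⟩ := (D.relabel (Q' := Q) (Equiv.swap b b.swap) hswap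
    (Equiv.apply_swap_eq_self ht)).exists_equivalent_sign_eq D.sign_swap
  exact ⟨D', hlist', hsign, (D.equivalent_relabel ..).trans hequiv⟩

open Classical in
theorem exists_equivalent_of_perm {l' : List (E ⊕ E)} (hperm : l.Perm l') (D : OrderDatum k Q)
    (pre : List (E ⊕ E)) (hlist : D.list s = pre ++ l) :
    ∃ D' : OrderDatum k Q, D'.list = Function.update D.list s (pre ++ l') ∧ D'.sign = D.sign ∧
      D.Equivalent D' := by
  induction hperm generalizing D pre with
  | nil => exact ⟨D, by rw [← hlist, Function.update_eq_self], rfl, .refl D⟩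
  | cons p _ ih => simpa using ih D (pre ++ [p]) (by simpa using hlist)
  | swap a b l => exact exists_equivalent_swap hlist
  | trans _ _ ih ih' =>
    obtain ⟨D₁, hlist₁, hsign₁, hequiv₁⟩ := ih D pre hlist
    obtain ⟨D₂, hlist₂, hsign₂, hequiv₂⟩ := ih' D₁ pre (by rw [hlist₁, Function.update_self])
    exact ⟨D₂, by rw [hlist₂, hlist₁, Function.update_idem], hsign₂.trans hsign₁,
      hequiv₁.trans hequiv₂⟩

theorem exists_equivalent_list_eq_on (D D' : OrderDatum k Q) (S : Finset I) :
    ∃ D'' : OrderDatum k Q, (∀ s ∈ S, D''.list s = D'.list s) ∧ D''.sign = D.sign ∧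
      D.Equivalent D'' := by
  classical
  induction S using Finset.induction_on with
  | empty => exact ⟨D, by simp, rfl, .refl D⟩
  | insert s S hs ih =>
    obtain ⟨D₁, hlist₁, hsign₁, hequiv₁⟩ := ih
    obtain ⟨D₂, hlist₂, hsign₂, hequiv₂⟩ :=
      exists_equivalent_of_perm (D₁.list_perm D' s) D₁ [] rfl
    refine ⟨D₂, Finset.forall_mem_insert .. |>.2 ⟨?_, fun s' hs' => ?_⟩, hsign₂.trans hsign₁,
      hequiv₁.trans hequiv₂⟩
    · rw [hlist₂, Function.update_self, List.nil_append]
    · rw [hlist₂, Function.update_of_ne (ne_of_mem_of_not_mem hs' hs), hlist₁ s' hs']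

theorem equivalent (D D' : OrderDatum k Q) : D.Equivalent D' := by
  obtain ⟨D₁, -, -, hsign₁, hequiv₁⟩ := D.exists_equivalent_sign_eq D'.sign_swap
  obtain ⟨D₂, hlist₂, hsign₂, hequiv₂⟩ := D₁.exists_equivalent_list_eq_on D' Finset.univ
  obtain rfl : D₂ = D' :=
    ext_of_list (funext fun s => hlist₂ s (Finset.mem_univ s)) (hsign₂.trans hsign₁)
  exact hequiv₁.trans hequiv₂

end OrderDatum

end Orderings

/-! ### Independence of the orientation -/

section Orientation

variable {I E E' : Type*} {Q : FinQuiver I E} {Q' : FinQuiver I E'}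

theorem FinQuiver.SameGraph.exists_equiv (h : Q.SameGraph Q') : ∃ φ : E ⊕ E ≃ E' ⊕ E',
    (∀ p, φ p.swap = (φ p).swap) ∧ ∀ p, Q'.double.t (φ p) = Q.double.t p := by
  classical
  obtain ⟨τ, hτ⟩ := h
  have hends (x : E) : (Q'.t (τ x) = Q.t x ∧ Q'.h (τ x) = Q.h x) ∨
      (Q'.t (τ x) = Q.h x ∧ Q'.h (τ x) = Q.t x) := Sym2.eq_iff.1 (hτ x)
  let keeps (x : E) : Prop := Q'.t (τ x) = Q.t x ∧ Q'.h (τ x) = Q.h x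
  let reverse : E ⊕ E → E ⊕ E := Sum.elim (fun x => if keeps x then .inl x else .inr x)
    (fun x => if keeps x then .inr x else .inl x)
  have hreverse : Function.Involutive reverse := by
    rintro (x | x) <;> by_cases hx : keeps x <;> simp [reverse, hx]
  refine ⟨hreverse.toPerm.trans (Equiv.sumCongr τ τ), ?_, ?_⟩
  · rintro (x | x) <;> by_cases hx : keeps x <;> simp [reverse, hx]
  · rintro (x | x) <;> by_cases hx : keeps x
    · simpa [reverse, FinQuiver.double, hx] using hx.1
    · simpa [reverse, FinQuiver.double, hx] using ((hends x).resolve_left hx).2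
    · simpa [reverse, FinQuiver.double, hx] using hx.2
    · simpa [reverse, FinQuiver.double, hx] using ((hends x).resolve_left hx).1

end Orientation

section Standard

variable {k : Type*} [Field k] {I E : Type*} [Fintype I] [DecidableEq I] {Q : FinQuiver I E}
  {o : Q.Ordering}

variable (k o) in
theorem existsUnique_isVdBBracket : ∃! br, IsVdBBracket k Q o br := by
  obtain ⟨br, h⟩ := exists_isFormBracket (ordForm_isTailForm k o)
    (η := fun p => ((stdSign p : ℤ) : k)) (fun p => by simp [stdSign_swap])
  exact ⟨br, (isVdBBracket_iff k o br).2 h, fun br' h' =>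
    ((isVdBBracket_iff k o br').1 h').unique h⟩

variable [Fintype E] {br : AQ k Q →ₗ[k] AQ k Q →ₗ[k] AQ k Q ⊗[k] AQ k Q}

theorem IsVdBBracket.eq_br (h : IsVdBBracket k Q o br) : br = (stdDatum k o).br :=
  ((isVdBBracket_iff k o br).1 h).unique (stdDatum k o).isFormBracket_br

theorem IsVdBBracket.isQuasiHamiltonian [NeZero (2 : k)] (h : IsVdBBracket k Q o br) :
    IsQuasiHamiltonian (idem k Q) br (momentMap k Q o) where
  quasiPoisson := ((isVdBBracket_iff k o br).1 h).isDoubleQuasiPoisson (ordForm_isOrderForm k o)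
    (stdDatum k o).scalar_swap (stdDatum k o).scalar_mul_self
  moment := by
    rw [momentMap_eq]
    exact (stdDatum k o).isMultMomentMap ((isVdBBracket_iff k o br).1 h)

theorem IsVdBBracket.exists_isQHIso [NeZero (2 : k)] {E' : Type*} [Fintype E']
    {Q' : FinQuiver I E'} {o' : Q'.Ordering}
    {br' : AQ k Q' →ₗ[k] AQ k Q' →ₗ[k] AQ k Q' ⊗[k] AQ k Q'} (hQ : Q.SameGraph Q')
    (h : IsVdBBracket k Q o br) (h' : IsVdBBracket k Q' o' br') :
    ∃ ψ, IsQHIso (idem k Q) br (momentMap k Q o) (idem k Q') br' (momentMap k Q' o') ψ := by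
  obtain ⟨φ, hφ, ht⟩ := hQ.exists_equiv
  rw [h.eq_br, h'.eq_br, momentMap_eq, momentMap_eq]
  exact ((stdDatum k o).equivalent_relabel hφ ht).trans (OrderDatum.equivalent _ _)

end Standard

end

end VdB

theorem mainTheorem2_general {k : Type*} [Field k] [NeZero (2 : k)]
    {I : Type*} [Fintype I] [DecidableEq I]
    {E₁ : Type*} [Fintype E₁] {E₂ : Type*} [Fintype E₂]
    (Q₁ : VdB.FinQuiver I E₁) (Q₂ : VdB.FinQuiver I E₂) (hQ : Q₁.SameGraph Q₂)
    (o₁ : Q₁.Ordering) (o₂ : Q₂.Ordering) :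
    (∃! br₁, VdB.IsVdBBracket k Q₁ o₁ br₁) ∧
    (∃! br₂, VdB.IsVdBBracket k Q₂ o₂ br₂) ∧
    ∀ br₁ br₂, VdB.IsVdBBracket k Q₁ o₁ br₁ → VdB.IsVdBBracket k Q₂ o₂ br₂ →
      VdB.IsQuasiHamiltonian (VdB.idem k Q₁) br₁ (VdB.momentMap k Q₁ o₁) ∧
      VdB.IsQuasiHamiltonian (VdB.idem k Q₂) br₂ (VdB.momentMap k Q₂ o₂) ∧
      ∃ ψ : VdB.AQ k Q₁ ≃ₐ[k] VdB.AQ k Q₂,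
        VdB.IsQHIso (VdB.idem k Q₁) br₁ (VdB.momentMap k Q₁ o₁)
          (VdB.idem k Q₂) br₂ (VdB.momentMap k Q₂ o₂) ψ :=
  ⟨VdB.existsUnique_isVdBBracket k o₁, VdB.existsUnique_isVdBBracket k o₂, fun _ _ h₁ h₂ =>
    ⟨h₁.isQuasiHamiltonian, h₂.isQuasiHamiltonian, h₁.exists_isQHIso hQ h₂⟩⟩

theorem mainTheorem2 {k : Type*} [Field k] [CharZero k]
    {I : Type*} [Fintype I] [DecidableEq I]
    {E₁ : Type*} [Fintype E₁] {E₂ : Type*} [Fintype E₂]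
    (Q₁ : VdB.FinQuiver I E₁) (Q₂ : VdB.FinQuiver I E₂) (hQ : Q₁.SameGraph Q₂)
    (o₁ : Q₁.Ordering) (o₂ : Q₂.Ordering) :
    (∃! br₁, VdB.IsVdBBracket k Q₁ o₁ br₁) ∧
    (∃! br₂, VdB.IsVdBBracket k Q₂ o₂ br₂) ∧
    ∀ br₁ br₂, VdB.IsVdBBracket k Q₁ o₁ br₁ → VdB.IsVdBBracket k Q₂ o₂ br₂ →
      VdB.IsQuasiHamiltonian (VdB.idem k Q₁) br₁ (VdB.momentMap k Q₁ o₁) ∧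
      VdB.IsQuasiHamiltonian (VdB.idem k Q₂) br₂ (VdB.momentMap k Q₂ o₂) ∧
      ∃ ψ : VdB.AQ k Q₁ ≃ₐ[k] VdB.AQ k Q₂,
        VdB.IsQHIso (VdB.idem k Q₁) br₁ (VdB.momentMap k Q₁ o₁)
          (VdB.idem k Q₂) br₂ (VdB.momentMap k Q₂ o₂) ψ :=
  mainTheorem2_general Q₁ Q₂ hQ o₁ o₂
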